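/- Let $X,\varepsilon_1,\varepsilon_2$ be independent real random variables with $\varepsilon_1,\varepsilon_2$ distributed as $\varepsilon$, let $Y=(Y_1,Y_2)=(X+\varepsilon_1,X+\varepsilon_2)$, and let $Y_j=(Y_{j,1},Y_{j,2})$, $j=1,\dots,n$ ($n\ge1$), be independent copies of $Y$. Write $\phi_Z(u)=\mathbb E[e^{iuZ}]$, $\phi_Y(u)=\mathbb E[e^{iuY_2}]$, $\psi(u_1,u_2)=\mathbb E[e^{i(u_1Y_1+u_2Y_2)}]$, and $\|\cdot\|$ for the norm of $L^2(\mathbb R)$. Assume: - (A1) $X$ and $\varepsilon$ have square integrable Lebesgue densities $f_X$ and $f_\varepsilon$; - (A2) $\phi_X$ and $\phi_\varepsilon$ vanish nowhere; - (A3) $\mathbb E[\varepsilon]=0$; - (A4) for some constant $C_X>0$, $|\phi_X(u)|\le C_X|\phi_X(v)|$ whenever $0\le v\le u$. Let $p\ge1$ be an integer with $\mathbb E[|Y_1|^{2p}]<\infty$ and assume that $\phi_X''\phi_\varepsilon$ is integrable. Let $K\in L^2(\mathbb R)$ be a real kernel whose Fourier transform $\mathcal FK(u)=\int e^{iux}K(x)\,dx$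 (in the sense of Plancherel) vanishes a.e. outside $[-1,1]$ and satisfies $|\mathcal FK|\le M$ a.e. for a constant $M$. For $h>0$ put $K_h(x)=h^{-1}K(x/h)$. Define the estimators $$\hat\psi(0,u)=\frac1n\sum_{j=1}^n e^{iuY_{j,2}},\qquad \partial_1\hat\psi(0,u)=\frac1n\sum_{j=1}^n iY_{j,1}e^{iuY_{j,2}},\qquad \tilde\psi(0,u)=\frac{\hat\psi(0,u)}{\min\{n^{1/2}|\hat\psi(0,u)|,1\}},$$ $$\hat\phi_X^{\mathrm{mod}}(u)=\exp\int_0^u\frac{\partial_1\hat\psi(0,v)}{\tilde\psi(0,v)}\,dv,\qquad \hat\phi_X(u)=\frac{\hat\phi_X^{\mathrm{mod}}(u)}{\max\{1,|\hat\phi_X^{\mathrm{mod}}(u)|\}},\qquad \hat f_{X,h}(x)=\frac1{2\pi}\int e^{-iux}\hat\phi_X(u)\,\mathcal FK_h(u)\,du .$$ Then, for some constant $C>0$ depending only on $p$, $$\mathbb E\big[\|f_X-\hat f_{X,h}\|^2\big]\le 2\|f_X-K_h*f_X\|^2+\frac{C\,M^2\,C_X^2\,G(X,\varepsilon,1,1/h)}{n}\int_{-1/h}^{1/h}\int_0^{|u|}\frac{dz}{|\phi_\varepsilon(z)|^2}\,du$$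 $$\qquad+C\,M^2\,G(X,\varepsilon,p,1/h)\int_{-1/h}^{1/h}\Big(\frac1n\int_0^{|u|}\frac{dz}{|\phi_Y(z)|^2}\Big)^p du,$$ where, for a positive integer $q$ and $u\ge 0$, $$G(X,\varepsilon,q,u)=\big(\|\phi_X''\phi_\varepsilon\|_{L^1}+\mathbb E[\varepsilon^2]\|\phi_X\phi_\varepsilon\|_{L^1}+\|\phi_X'\phi_\varepsilon\|_{L^2}^2\big)^q+\Big(\int_0^u\Big|\frac{\partial}{\partial u_1}\log\psi(0,x)\Big|^2dx\Big)^q+\frac{\mathbb E[|Y_1|^{2q}]\,1_{\{q\ge2\}}\,u^q}{n^{q-1}}+\big(\mathbb E[|Y_1|^{2q}]\big)^{1/2}.$$ -/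

import Mathlib

open MeasureTheory ProbabilityTheory
open scoped ENNReal

namespace RepeatedMeasurements

noncomputable section

/-! ### The statistical model -/

/-- `f` is a Lebesgue density of the real random variable `Z` under `P`. -/
structure IsDensity {Ω : Type*} [MeasurableSpace Ω] (P : Measure Ω) (Z : Ω → ℝ) (f : ℝ → ℝ) :
    Prop where
  measurable : Measurable f
  nonneg : ∀ x, 0 ≤ f x
  map_eq : P.map Z = volume.withDensity (fun x => ENNReal.ofReal (f x))

/-- The repeated measurement model: `X`, `ε₁`, `ε₂` are independent, `ε₁` and `ε₂` have the same
law, and the observations `Y 0, …, Y (n - 1)` are independent copies of `(X + ε₁, X + ε₂)`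
(the sample may live on a probability space of its own). -/
structure Model {Ω Ω' : Type*} [MeasurableSpace Ω] [MeasurableSpace Ω'] (P : Measure Ω)
    (P' : Measure Ω') (X ε₁ ε₂ : Ω → ℝ) {n : ℕ} (Y : Fin n → Ω' → ℝ × ℝ) : Prop where
  measurable_X : Measurable X
  measurable_ε₁ : Measurable ε₁
  measurable_ε₂ : Measurable ε₂
  indep : iIndepFun ![X, ε₁, ε₂] P
  copies : IdentDistrib ε₁ ε₂ P P
  measurable_sample : ∀ j, Measurable (Y j)
  indep_sample : iIndepFun Y P'
  law_sample : ∀ j, IdentDistrib (Y j) (fun ω => (X ω + ε₁ ω, X ω + ε₂ ω)) P' P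

/-- The characteristic function `φ_Z(u) = E[exp(iuZ)]`. -/
def phi {Ω : Type*} [MeasurableSpace Ω] (P : Measure Ω) (Z : Ω → ℝ) : ℝ → ℂ :=
  charFun (P.map Z)

/-- The joint characteristic function `E[exp(i(u₁ Y₁ + u₂ Y₂))]`. -/
def psi {Ω : Type*} [MeasurableSpace Ω] (P : Measure Ω) (Y₁ Y₂ : Ω → ℝ) (u₁ u₂ : ℝ) : ℂ :=
  ∫ ω, Complex.exp (Complex.I * ((u₁ * Y₁ ω + u₂ * Y₂ ω : ℝ) : ℂ)) ∂P

/-! ### Fourier transform and kernels -/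

/-- The Fourier transform `u ↦ ∫ exp(iux) g(x) dx` of a square integrable function, in the sense
of Plancherel. Mathlib's inverse transform is `w ↦ ∫ exp(2πixw) g(x) dx`, hence the rescaling.
The function is determined up to null sets; it is set to `0` for `g` not in `L²`. -/
def fourierL2 (g : ℝ → ℂ) (u : ℝ) : ℂ :=
  open Classical in
  if hg : MemLp g 2 volume then
    (FourierTransformInv.fourierInv (hg.toLp g) : Lp ℂ 2 (volume : Measure ℝ)) (u / (2 * Real.pi))
  else 0

/-- The rescaled kernel `K_h(x) = K(x / h) / h`. -/
def scaledKernel (K : ℝ → ℝ) (h : ℝ) (x : ℝ) : ℝ := 1 / h * K (x / h)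

/-- The Fourier transform of a real kernel. -/
def kernelFourier (K : ℝ → ℝ) : ℝ → ℂ := fourierL2 (fun x => (K x : ℂ))

/-! ### The estimator, as a function of the observed sample `y` -/

/-- The empirical characteristic function of the sample. -/
def psiHat {n : ℕ} (y : Fin n → ℝ × ℝ) (u₁ u₂ : ℝ) : ℂ :=
  1 / (n : ℂ) * ∑ j, Complex.exp (Complex.I * ((u₁ * (y j).1 + u₂ * (y j).2 : ℝ) : ℂ))

/-- The partial derivative of the empirical characteristic function in its first variable. -/
def dpsiHat {n : ℕ} (y : Fin n → ℝ × ℝ) (u₁ u₂ : ℝ) : ℂ :=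
  1 / (n : ℂ) * ∑ j, Complex.I * ((y j).1 : ℂ) *
    Complex.exp (Complex.I * ((u₁ * (y j).1 + u₂ * (y j).2 : ℝ) : ℂ))

/-- The regularised empirical characteristic function
`ψ̂(0,u) / min {√n |ψ̂(0,u)|, 1}`. (For `n ≥ 1` the zeros of `u ↦ ψ̂(0,u)` are isolated, so the
value chosen there does not matter below.) -/
def psiTilde {n : ℕ} (y : Fin n → ℝ × ℝ) (u : ℝ) : ℂ :=
  psiHat y 0 u / ((min (Real.sqrt n * ‖psiHat y 0 u‖) 1 : ℝ) : ℂ)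

/-- The estimator of the characteristic function of `X` before truncation. -/
def phiMod {n : ℕ} (y : Fin n → ℝ × ℝ) (u : ℝ) : ℂ :=
  Complex.exp (∫ v in (0 : ℝ)..u, dpsiHat y 0 v / psiTilde y v)

/-- The truncated estimator of the characteristic function of `X`. -/
def phiHat {n : ℕ} (y : Fin n → ℝ × ℝ) (u : ℝ) : ℂ :=
  phiMod y u / ((max 1 ‖phiMod y u‖ : ℝ) : ℂ)

/-- The kernel estimator of the density of `X` with kernel `K` and bandwidth `h`. -/
def fHat (K : ℝ → ℝ) (h : ℝ) {n : ℕ} (y : Fin n → ℝ × ℝ) (x : ℝ) : ℂ :=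
  1 / (2 * (Real.pi : ℂ)) *
    ∫ u : ℝ, Complex.exp (-(Complex.I * ((u * x : ℝ) : ℂ))) * phiHat y u *
      kernelFourier (scaledKernel K h) u

/-! ### The quantity entering the variance terms -/

/-- `G(X, ε, p, u)` for `u ≥ 0` and sample size `n`. All norms and moments are taken in `[0, ∞]`,
so no integrability is hidden in the definition. -/
def G {Ω : Type*} [MeasurableSpace Ω] (P : Measure Ω) (X ε₁ ε₂ : Ω → ℝ) (n p : ℕ) (u : ℝ) :
    ℝ≥0∞ :=
  (eLpNorm (fun t => deriv (deriv (phi P X)) t * phi P ε₁ t) 1 volume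
      + (∫⁻ ω, ‖ε₁ ω‖ₑ ^ 2 ∂P) * eLpNorm (fun t => phi P X t * phi P ε₁ t) 1 volume
      + (eLpNorm (fun t => deriv (phi P X) t * phi P ε₁ t) 2 volume) ^ 2) ^ p
    + (∫⁻ x in Set.Icc 0 u, ‖logDeriv (fun s : ℝ => psi P (X + ε₁) (X + ε₂) s x) 0‖ₑ ^ 2) ^ p
    + (if 2 ≤ p then
        (∫⁻ ω, ‖X ω + ε₁ ω‖ₑ ^ (2 * p) ∂P) * ENNReal.ofReal u ^ p / (n : ℝ≥0∞) ^ (p - 1)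
      else 0)
    + (∫⁻ ω, ‖X ω + ε₁ ω‖ₑ ^ (2 * p) ∂P) ^ (1 / 2 : ℝ)

end

end RepeatedMeasurements

open RepeatedMeasurements

set_option linter.unusedSectionVars false

/-! By Plancherel the problem reduces to estimating the characteristic function. `K_h * f_X` and the
estimator are Fourier integrals of the same kernel spectrum, multiplied by `φ_X` and by its
estimate. So the error is the bias `f_X - K_h * f_X` plus one transform, and its squared norm is at
most twice the squared bias plus `M² / π` times the integral of `|φ_X - φ̂_X|²` over `[-1/h, 1/h]`.
It remains to bound the mean squared error at a fixed `u`, and conjugation symmetry allows `u ≥ 0`.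

Since the errors are centred, `∂₁ψ(0,·) / ψ(0,·) = φ_X' / φ_X`, hence `φ_X = exp ∫ ∂₁ψ / ψ`. The
untruncated estimator is therefore `φ_X exp(T₁ + T₂ + T₃)`, where `T₁` is the error of the numerator
divided by the true `φ_Y`, `T₂` is the true numerator times the error of the inverse denominator,
and `T₃` is the integrated product of the two errors. If all three are at most `1/3`, the
exponential is Lipschitz and the squared error is of order `|φ_X|² (|T₁|² + |T₂|² + |T₃|)`.
Otherwise truncation bounds it by `4`, which is dominated by `2p`-th powers of `T₁`, `T₂` and the
`p`-th power of `T₃`. The first case produces the term with `q = 1`, where quasi-monotonicity of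
`φ_X` turns `|φ_X(u)|² / |φ_Y(z)|²` into `C_X² / |φ_ε(z)|²`; the second produces the term with
exponent `p`.

The moments rest on Rosenthal's inequality (`integral_sum_pow_le`), obtained by adding one summand
at a time. `T₁` is a centred empirical mean whose variance is a double integral against `k(v - w)`,
with `k(u) = E[Y₁² exp(iuY₂)]`; a Schur test leaves only `‖k‖₁` (`lintegral_scoreIntegral_sq_le`).
`T₂` and `T₃` use the deterministic bound `norm_inv_regularised_sub_inv_le` for the regularised
inverse, followed by Cauchy–Schwarz and weighted Jensen. All three moments carry the common factor
`(n⁻¹ ∫ |φ_Y|⁻²)^q`, and the remaining factors are summands of `G`. -/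

/-! ### Plancherel transform and dilations -/

open FourierTransform in
/-- On `L¹ ∩ L²` the Plancherel transform agrees with the Fourier integral. -/
theorem MeasureTheory.MemLp.fourier_toLp_ae_eq {g : ℝ → ℂ} (hg : MemLp g 2 volume)
    (hg1 : Integrable g) :
    (𝓕 (hg.toLp g) : Lp ℂ 2 (volume : Measure ℝ)) =ᵐ[volume] 𝓕 g := by
  have hcont : Continuous (𝓕 g) :=
    VectorFourier.fourierIntegral_continuous Real.continuous_fourierChar
      (by exact continuous_inner) hg1
  -- Both sides are tested against smooth compactly supported functions: the `L²` transform is the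
  -- distributional one, and the multiplication formula moves the Fourier integral from the test
  -- function to `g`.
  refine ae_eq_of_integral_contDiff_smul_eq
    ((Lp.memLp _).locallyIntegrable (by norm_num)) hcont.locallyIntegrable ?_
  intro φ hφ hφc
  let φ' : SchwartzMap ℝ ℂ := HasCompactSupport.toSchwartzMap (f := fun x => (φ x : ℂ))
    (hφc.comp_left (g := fun x : ℝ => (x : ℂ)) (by simp))
    (Complex.ofRealCLM.contDiff.comp hφ)
  have hφ' : ∀ x, φ' x = (φ x : ℂ) := fun x => rfl
  have h1 := congrArg (fun T => T φ') (Lp.fourier_toTemperedDistribution_eq (hg.toLp g))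
  simp only [TemperedDistribution.fourier_apply, Lp.toTemperedDistribution_apply] at h1
  have h2 : ∫ x, (𝓕 φ') x • (hg.toLp g : ℝ → ℂ) x = ∫ x, (𝓕 φ') x • g x :=
    integral_congr_ae (by filter_upwards [hg.coeFn_toLp] with x hx; rw [hx])
  have h3 : ∫ x, (𝓕 (φ' : ℝ → ℂ)) x • g x = ∫ x, φ' x • 𝓕 g x := by
    have := VectorFourier.integral_fourierIntegral_smul_eq_flip (μ := volume) (ν := volume)
      (L := innerₗ ℝ) (f := (φ' : ℝ → ℂ)) (g := g)
      Real.continuous_fourierChar (by exact continuous_inner) φ'.integrable hg1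
    rwa [flip_innerₗ] at this
  rw [h2, SchwartzMap.fourier_coe, h3] at h1
  simpa [hφ'] using h1.symm

open FourierTransform in
/-- Plancherel's identity for the Fourier integral on `L¹ ∩ L²`. -/
theorem eLpNorm_fourier_eq {g : ℝ → ℂ} (hg : MemLp g 2 volume) (hg1 : Integrable g) :
    eLpNorm (𝓕 g) 2 volume = eLpNorm g 2 volume := by
  rw [← eLpNorm_congr_ae (hg.fourier_toLp_ae_eq hg1), ← Lp.enorm_def, ← eLpNorm_congr_ae hg.coeFn_toLp,
    ← Lp.enorm_def]
  simp only [enorm_eq_nnnorm, ENNReal.coe_inj]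
  exact NNReal.eq (Lp.norm_fourier_eq _)

theorem eLpNorm_two_sq {α E : Type*} [MeasurableSpace α] {μ : Measure α} [NormedAddCommGroup E]
    (g : α → E) : (eLpNorm g 2 μ) ^ 2 = ∫⁻ x, ‖g x‖ₑ ^ 2 ∂μ := by
  have := eLpNorm_nnreal_pow_eq_lintegral (f := g) (μ := μ) (p := 2) (by norm_num)
  simpa using this

theorem eLpNorm_add_sq_le {α E : Type*} [MeasurableSpace α] {μ : Measure α} [NormedAddCommGroup E]
    {f g : α → E} (hf : AEStronglyMeasurable f μ) (hg : AEStronglyMeasurable g μ) :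
    (eLpNorm (f + g) 2 μ) ^ 2 ≤ 2 * (eLpNorm f 2 μ) ^ 2 + 2 * (eLpNorm g 2 μ) ^ 2 := by
  calc (eLpNorm (f + g) 2 μ) ^ 2 ≤ (eLpNorm f 2 μ + eLpNorm g 2 μ) ^ 2 := by
        gcongr; exact eLpNorm_add_le hf hg (by norm_num)
    _ ≤ _ := by
        have := ENNReal.rpow_add_le_mul_rpow_add_rpow (eLpNorm f 2 μ) (eLpNorm g 2 μ)
          (p := 2) (by norm_num)
        norm_num at this
        rwa [mul_add] at this

open FourierTransform in
/-- The `L²` inverse Fourier transform of a real kernel. -/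
noncomputable def kernelSpectrum {K : ℝ → ℝ} (hK : MemLp (fun x => (K x : ℂ)) 2 volume) : ℝ → ℂ :=
  (𝓕⁻ (hK.toLp _) : Lp ℂ 2 (volume : Measure ℝ))

theorem fourierL2_eq_kernelSpectrum {K : ℝ → ℝ} (hK : MemLp (fun x => (K x : ℂ)) 2 volume)
    (u : ℝ) : kernelFourier K u = kernelSpectrum hK (u / (2 * Real.pi)) := by
  simp only [kernelFourier, fourierL2, hK, dif_pos, kernelSpectrum]

theorem quasiMeasurePreserving_real_mul_left {a : ℝ} (ha : a ≠ 0) :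
    Measure.QuasiMeasurePreserving (fun x : ℝ => a * x) volume volume :=
  ⟨measurable_const_mul a, by
    rw [Real.map_volume_mul_left ha]; exact Measure.smul_absolutelyContinuous⟩

theorem lintegral_comp_mul_left_real (f : ℝ → ℝ≥0∞) (hf : Measurable f) {a : ℝ} (ha : 0 < a) :
    ∫⁻ x, f (a * x) = ENNReal.ofReal a⁻¹ * ∫⁻ x, f x := by
  rw [← lintegral_map hf (measurable_const_mul a), Real.map_volume_mul_left ha.ne',
    lintegral_smul_measure, abs_of_pos (inv_pos.2 ha), smul_eq_mul]

theorem MeasureTheory.MemLp.comp_mul_left {E : Type*} [NormedAddCommGroup E] {g : ℝ → E}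
    {q : ℝ≥0∞} (hg : MemLp g q volume) {a : ℝ} (ha : a ≠ 0) :
    MemLp (fun x => g (a * x)) q volume := by
  have : MemLp g q (Measure.map (fun x : ℝ => a * x) volume) := by
    rw [Real.map_volume_mul_left ha]; exact hg.smul_measure (by simp)
  exact this.comp_of_map (measurable_const_mul a).aemeasurable

theorem charFun_eq_integral_density {Ω : Type*} [MeasurableSpace Ω] {P : Measure Ω} {Z : Ω → ℝ}
    {f : ℝ → ℝ} (hf : IsDensity P Z f) (u : ℝ) :
    phi P Z u = ∫ x : ℝ, Complex.exp (u * x * Complex.I) * (f x : ℂ) := by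
  rw [phi, charFun_apply_real, hf.map_eq]
  have := integral_withDensity_eq_integral_toReal_smul (μ := volume)
    (f := fun x => ENNReal.ofReal (f x)) hf.measurable.ennreal_ofReal
    (ae_of_all _ fun _ => ENNReal.ofReal_lt_top)
    (fun x : ℝ => Complex.exp (u * x * Complex.I))
  rw [this]
  refine integral_congr_ae (ae_of_all _ fun x => ?_)
  simp [ENNReal.toReal_ofReal (hf.nonneg x), mul_comm]

theorem RepeatedMeasurements.IsDensity.integrable {Ω : Type*} [MeasurableSpace Ω] {P : Measure Ω}
    [IsProbabilityMeasure P] {Z : Ω → ℝ} (hZ : Measurable Z)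
    {f : ℝ → ℝ} (hf : IsDensity P Z f) : Integrable f := by
  refine ⟨hf.measurable.aestronglyMeasurable, ?_⟩
  have h := congrArg (fun μ => μ Set.univ) hf.map_eq
  simp only [withDensity_apply _ MeasurableSet.univ, Measure.restrict_univ,
    Measure.map_apply hZ MeasurableSet.univ, Set.preimage_univ, measure_univ] at h
  rw [hasFiniteIntegral_iff_ofReal (ae_of_all _ hf.nonneg), ← h]
  exact ENNReal.one_lt_top

/-! ### Kernel estimators in the Fourier domain -/

section Kernel

open FourierTransform

theorem memLp_kernelSpectrum {K : ℝ → ℝ} (hK : MemLp (fun x => (K x : ℂ)) 2 volume)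
    : MemLp (kernelSpectrum hK) 2 volume := Lp.memLp _

theorem kernelSpectrum_eq_zero {K : ℝ → ℝ} (hK : MemLp (fun x => (K x : ℂ)) 2 volume)
    (hsupp : ∀ᵐ u : ℝ, u ∉ Set.Icc (-1 : ℝ) 1 → kernelFourier K u = 0) :
    ∀ᵐ w : ℝ, 2 * Real.pi * w ∉ Set.Icc (-1 : ℝ) 1 → kernelSpectrum hK w = 0 := by
  filter_upwards [(quasiMeasurePreserving_real_mul_left
    (a := 2 * Real.pi) (by positivity)).ae hsupp] with w hw h
  rw [← hw h, fourierL2_eq_kernelSpectrum hK, mul_div_cancel_left₀ _ (by positivity)]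

theorem norm_kernelSpectrum_le {K : ℝ → ℝ} (hK : MemLp (fun x => (K x : ℂ)) 2 volume)
    {M : ℝ} (hM : ∀ᵐ u : ℝ, ‖kernelFourier K u‖ ≤ M) :
    ∀ᵐ w : ℝ, ‖kernelSpectrum hK w‖ ≤ M := by
  filter_upwards [(quasiMeasurePreserving_real_mul_left
    (a := 2 * Real.pi) (by positivity)).ae hM] with w hw
  rwa [fourierL2_eq_kernelSpectrum hK, mul_div_cancel_left₀ _ (by positivity)] at hw

/-- A square integrable function that vanishes off a compact interval is integrable. This permits
honest Fourier integrals in place of `L²` classes from here on. -/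
theorem integrable_kernelSpectrum {K : ℝ → ℝ} (hK : MemLp (fun x => (K x : ℂ)) 2 volume)
    (hsupp : ∀ᵐ u : ℝ, u ∉ Set.Icc (-1 : ℝ) 1 → kernelFourier K u = 0) :
    Integrable (kernelSpectrum hK) := by
  have h1 : IntegrableOn (kernelSpectrum hK) (Set.Icc (-(2 * Real.pi)⁻¹) (2 * Real.pi)⁻¹) :=
    ((memLp_kernelSpectrum hK).locallyIntegrable (by norm_num)).integrableOn_isCompact isCompact_Icc
  refine (integrableOn_iff_integrable_of_support_subset (s := Set.Icc (-(2 * Real.pi)⁻¹)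
    (2 * Real.pi)⁻¹) (f := (Set.Icc (-(2 * Real.pi)⁻¹) (2 * Real.pi)⁻¹).indicator
    (kernelSpectrum hK)) Set.support_indicator_subset).1
    ((integrableOn_congr_fun (fun x hx => Set.indicator_of_mem hx _) measurableSet_Icc).2 h1)
    |>.congr ?_
  filter_upwards [kernelSpectrum_eq_zero hK hsupp] with w hw
  by_cases h : w ∈ Set.Icc (-(2 * Real.pi)⁻¹) (2 * Real.pi)⁻¹
  · rw [Set.indicator_of_mem h]
  · rw [Set.indicator_of_notMem h, hw]
    contrapose! h
    have hp : (0 : ℝ) < 2 * Real.pi := by positivity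
    constructor
    · rw [neg_le, ← mul_le_mul_iff_right₀ hp, mul_inv_cancel₀ hp.ne']; linarith [h.1]
    · rw [← mul_le_mul_iff_right₀ hp, mul_inv_cancel₀ hp.ne']; linarith [h.2]

theorem kernel_ae_eq {K : ℝ → ℝ} (hK : MemLp (fun x => (K x : ℂ)) 2 volume)
    (hsupp : ∀ᵐ u : ℝ, u ∉ Set.Icc (-1 : ℝ) 1 → kernelFourier K u = 0) :
    (fun x => (K x : ℂ)) =ᵐ[volume] 𝓕 (kernelSpectrum hK) := by
  have h1 := (memLp_kernelSpectrum hK).fourier_toLp_ae_eq (integrable_kernelSpectrum hK hsupp)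
  have h2 : (memLp_kernelSpectrum hK).toLp = 𝓕⁻ (hK.toLp _) := Lp.toLp_coeFn _ _
  rw [h2, FourierTransform.fourier_fourierInv_eq] at h1
  exact hK.coeFn_toLp.symm.trans h1

theorem scaledKernel_ae_eq {K : ℝ → ℝ} (hK : MemLp (fun x => (K x : ℂ)) 2 volume)
    {h : ℝ} (hh : 0 < h)
    (hsupp : ∀ᵐ u : ℝ, u ∉ Set.Icc (-1 : ℝ) 1 → kernelFourier K u = 0) :
    (fun x => (scaledKernel K h x : ℂ)) =ᵐ[volume] 𝓕 (fun w => kernelSpectrum hK (h * w)) := by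
  filter_upwards [(quasiMeasurePreserving_real_mul_left
    (a := h⁻¹) (by positivity)).ae (kernel_ae_eq hK hsupp)] with x hx
  have h1 := Measure.integral_comp_mul_left
    (fun s => Complex.exp (↑(-2 * Real.pi * s * (h⁻¹ * x)) * Complex.I) • kernelSpectrum hK s) h
  rw [scaledKernel, div_eq_inv_mul x, Complex.ofReal_mul, hx, Real.fourier_real_eq_integral_exp_smul,
    Real.fourier_real_eq_integral_exp_smul, one_div, ← abs_of_pos (inv_pos.2 hh), ← Complex.real_smul,
    abs_of_pos (inv_pos.2 hh)]
  rw [abs_of_pos (inv_pos.2 hh)] at h1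
  rw [← h1]
  congr 1; ext w
  congr 4
  field_simp

theorem memLp_scaledKernel {K : ℝ → ℝ} (hK : MemLp (fun x => (K x : ℂ)) 2 volume)
    {h : ℝ} (hh : 0 < h)
    : MemLp (fun x => (scaledKernel K h x : ℂ)) 2 volume := by
  have := (hK.comp_mul_left (a := h⁻¹) (by positivity)).const_mul ((h : ℂ)⁻¹)
  refine this.congr_norm this.1 ?_ |>.ae_eq ?_
  all_goals
    refine ae_of_all _ fun x => ?_
    simp [scaledKernel, div_eq_inv_mul]

/-- The rescaled kernel is already known to be the transform of the dilated spectrum, so inversion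
on `L²` gives the claim with no change of variables on `L²` classes. -/
theorem kernelFourier_scaledKernel_ae_eq {K : ℝ → ℝ} (hK : MemLp (fun x => (K x : ℂ)) 2 volume)
    {h : ℝ} (hh : 0 < h)
    (hsupp : ∀ᵐ u : ℝ, u ∉ Set.Icc (-1 : ℝ) 1 → kernelFourier K u = 0) :
    ∀ᵐ w : ℝ, kernelFourier (scaledKernel K h) (2 * Real.pi * w) = kernelSpectrum hK (h * w) := by
  have hKh := memLp_scaledKernel hK hh
  have hm := (memLp_kernelSpectrum hK).comp_mul_left hh.ne'
  have hi := (integrable_kernelSpectrum hK hsupp).comp_mul_left' hh.ne'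
  have h1 : hKh.toLp _ = 𝓕 (hm.toLp _) := by
    refine Lp.ext ?_
    exact (hKh.coeFn_toLp.trans (scaledKernel_ae_eq hK hh hsupp)).trans
      (hm.fourier_toLp_ae_eq hi).symm
  have h2 : 𝓕⁻ (hKh.toLp _) = hm.toLp _ := by
    rw [h1, FourierTransform.fourierInv_fourier_eq]
  filter_upwards [hm.coeFn_toLp] with w hw
  rw [fourierL2_eq_kernelSpectrum hKh, mul_div_cancel_left₀ _ (by positivity), kernelSpectrum, h2, hw]

/-- The substitution `u = 2πw` absorbs the factor `1 / (2π)` and passes to the normalisation with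
`2π` in the exponent. -/
theorem kernelEstimate_eq_fourier {K : ℝ → ℝ} (hK : MemLp (fun x => (K x : ℂ)) 2 volume)
    {h : ℝ} (hh : 0 < h)
    (hsupp : ∀ᵐ u : ℝ, u ∉ Set.Icc (-1 : ℝ) 1 → kernelFourier K u = 0)
    (χ : ℝ → ℂ) (x : ℝ) :
    1 / (2 * (Real.pi : ℂ)) * ∫ u : ℝ, Complex.exp (-(Complex.I * ((u * x : ℝ) : ℂ))) * χ u *
      kernelFourier (scaledKernel K h) u =
    𝓕 (fun w => χ (2 * Real.pi * w) * kernelSpectrum hK (h * w)) x := by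
  have hp : (0 : ℝ) < 2 * Real.pi := by positivity
  have h1 := Measure.integral_comp_mul_left
    (fun u => Complex.exp (-(Complex.I * ((u * x : ℝ) : ℂ))) * χ u *
      kernelFourier (scaledKernel K h) u) (2 * Real.pi)
  rw [abs_of_pos (inv_pos.2 hp), Complex.real_smul] at h1
  have h2 : (1 / (2 * (Real.pi : ℂ))) = (((2 * Real.pi)⁻¹ : ℝ) : ℂ) := by push_cast; ring
  rw [h2, ← h1, Real.fourier_real_eq_integral_exp_smul]
  refine integral_congr_ae ?_
  filter_upwards [kernelFourier_scaledKernel_ae_eq hK hh hsupp] with w hw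
  simp only [hw, smul_eq_mul]
  rw [mul_assoc]
  congr 2
  push_cast
  ring

/-- The multiplication formula transfers the transform from the kernel spectrum to the reflected,
translated density, whose transform is `φ_X` times a character. The smoothed density thus has the
same form as the estimator. -/
theorem convolution_scaledKernel_eq_fourier {K : ℝ → ℝ} (hK : MemLp (fun x => (K x : ℂ)) 2 volume)
    {h : ℝ} (hh : 0 < h)
    {Ω : Type*} [MeasurableSpace Ω] {P : Measure Ω}
    [IsProbabilityMeasure P] {X : Ω → ℝ} (hX : Measurable X) {f : ℝ → ℝ} (hf : IsDensity P X f)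
    (hsupp : ∀ᵐ u : ℝ, u ∉ Set.Icc (-1 : ℝ) 1 → kernelFourier K u = 0) (x : ℝ) :
    ((convolution (scaledKernel K h) f (ContinuousLinearMap.mul ℝ ℝ) volume x : ℝ) : ℂ) =
      𝓕 (fun w => phi P X (2 * Real.pi * w) * kernelSpectrum hK (h * w)) x := by
  have hi := (integrable_kernelSpectrum hK hsupp).comp_mul_left' hh.ne'
  have hfi : Integrable (fun t => (f (x - t) : ℂ)) := ((hf.integrable hX).comp_sub_left x).ofReal
  rw [convolution_def, ← integral_complex_ofReal]
  have h1 : ∫ t, ((ContinuousLinearMap.mul ℝ ℝ (scaledKernel K h t) (f (x - t)) : ℝ) : ℂ) =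
      ∫ t, 𝓕 (fun w => kernelSpectrum hK (h * w)) t • (f (x - t) : ℂ) := by
    refine integral_congr_ae ?_
    filter_upwards [scaledKernel_ae_eq hK hh hsupp] with t ht
    simp [← ht]
  rw [h1]
  have h2 := VectorFourier.integral_fourierIntegral_smul_eq_flip (μ := volume) (ν := volume)
      (L := innerₗ ℝ) (f := fun w => kernelSpectrum hK (h * w)) (g := fun t => (f (x - t) : ℂ))
      Real.continuous_fourierChar (by exact continuous_inner) hi hfi
  rw [flip_innerₗ] at h2
  refine h2.trans ?_
  rw [Real.fourier_real_eq_integral_exp_smul]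
  congr 1; ext w
  change _ • 𝓕 (fun t => (f (x - t) : ℂ)) w = _
  rw [Real.fourier_real_eq_integral_exp_smul, charFun_eq_integral_density hf, mul_comm (∫ _, _),
    ← smul_eq_mul (kernelSpectrum hK (h * w)), smul_comm]
  congr 1
  rw [← integral_sub_left_eq_self _ volume x, smul_eq_mul, ← integral_const_mul]
  congr 1; ext t
  rw [smul_eq_mul, ← mul_assoc, ← Complex.exp_add, sub_sub_cancel]
  congr 2
  push_cast
  ring

/-- The squared `L²` risk of a kernel estimator built from an estimate `χ` of the characteristic
function is at most a bias term plus the integrated squared error of `χ`. -/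
theorem eLpNorm_density_sub_kernelEstimate_sq_le {K : ℝ → ℝ} (hK : MemLp (fun x => (K x : ℂ)) 2 volume)
    {h : ℝ} (hh : 0 < h)
    {Ω : Type*} [MeasurableSpace Ω] {P : Measure Ω}
    [IsProbabilityMeasure P] {X : Ω → ℝ} (hX : Measurable X) {f : ℝ → ℝ} (hf : IsDensity P X f)
    (hsupp : ∀ᵐ u : ℝ, u ∉ Set.Icc (-1 : ℝ) 1 → kernelFourier K u = 0)
    {M : ℝ} (hM : ∀ᵐ u : ℝ, ‖kernelFourier K u‖ ≤ M) {χ : ℝ → ℂ} (hχ : Measurable χ)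
    (hχ1 : ∀ u, ‖χ u‖ ≤ 1) :
    (eLpNorm (fun x => (f x : ℂ) - 1 / (2 * (Real.pi : ℂ)) *
      ∫ u : ℝ, Complex.exp (-(Complex.I * ((u * x : ℝ) : ℂ))) * χ u *
        kernelFourier (scaledKernel K h) u) 2 volume) ^ 2 ≤
      2 * (eLpNorm (fun x => f x -
        convolution (scaledKernel K h) f (ContinuousLinearMap.mul ℝ ℝ) volume x) 2 volume) ^ 2 +
      ENNReal.ofReal (M ^ 2 / Real.pi) *
        ∫⁻ u in Set.Icc (-(1 / h)) (1 / h), ‖phi P X u - χ u‖ₑ ^ 2 := by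
  have hp : (0 : ℝ) < 2 * Real.pi := by positivity
  have hprob : IsProbabilityMeasure (P.map X) := Measure.isProbabilityMeasure_map hX.aemeasurable
  have hφm : Measurable (phi P X) := measurable_charFun
  have hm := (memLp_kernelSpectrum hK).comp_mul_left hh.ne'
  have hi := (integrable_kernelSpectrum hK hsupp).comp_mul_left' hh.ne'
  have hcont : ∀ g : ℝ → ℂ, Integrable g → Continuous (𝓕 g) := fun g hg =>
    VectorFourier.fourierIntegral_continuous Real.continuous_fourierChar
      (by exact continuous_inner) hg
  have hint : ∀ g : ℝ → ℂ, Measurable g → (∀ u, ‖g u‖ ≤ 1) →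
      Integrable (fun w => g (2 * Real.pi * w) * kernelSpectrum hK (h * w)) := fun g hg hb =>
    hi.bdd_mul (hg.comp (measurable_const_mul _)).aestronglyMeasurable (ae_of_all _ fun w => hb _)
  have hφ1 : ∀ u, ‖phi P X u‖ ≤ 1 := fun u => norm_charFun_le_one u
  have iφ := hint _ hφm hφ1
  have iχ := hint _ hχ hχ1
  have mdiff : MemLp (fun w => (phi P X (2 * Real.pi * w) - χ (2 * Real.pi * w)) *
      kernelSpectrum hK (h * w)) 2 volume := by
    refine MemLp.of_le_mul (c := 2) hm ?_ (ae_of_all _ fun w => ?_)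
    · exact (((hφm.sub hχ).comp (measurable_const_mul _)).aestronglyMeasurable).mul hm.1
    · rw [norm_mul]
      gcongr
      exact (norm_sub_le _ _).trans (by linarith [hφ1 (2 * Real.pi * w), hχ1 (2 * Real.pi * w)])
  have idiff : Integrable (fun w => (phi P X (2 * Real.pi * w) - χ (2 * Real.pi * w)) *
      kernelSpectrum hK (h * w)) := by
    refine (iφ.sub iχ).congr (ae_of_all _ fun w => ?_)
    simp [sub_mul]
  set cv := convolution (scaledKernel K h) f (ContinuousLinearMap.mul ℝ ℝ) volume with hcv
  -- Bias plus stochastic error. The latter is a single Fourier integral, so Plancherel applies to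
  -- it.
  have hdecomp : (fun x => (f x : ℂ) - 1 / (2 * (Real.pi : ℂ)) *
      ∫ u : ℝ, Complex.exp (-(Complex.I * ((u * x : ℝ) : ℂ))) * χ u *
        kernelFourier (scaledKernel K h) u) =
      (fun x => ((f x - cv x : ℝ) : ℂ)) + 𝓕 (fun w => (phi P X (2 * Real.pi * w) -
        χ (2 * Real.pi * w)) * kernelSpectrum hK (h * w)) := by
    ext x
    have h3 : 𝓕 (fun w => (phi P X (2 * Real.pi * w) - χ (2 * Real.pi * w)) *
        kernelSpectrum hK (h * w)) x =
        𝓕 (fun w => phi P X (2 * Real.pi * w) * kernelSpectrum hK (h * w)) x -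
        𝓕 (fun w => χ (2 * Real.pi * w) * kernelSpectrum hK (h * w)) x := by
      simp only [Real.fourier_eq]
      rw [← integral_sub ((Real.fourierIntegral_convergent_iff x).2 iφ)
        ((Real.fourierIntegral_convergent_iff x).2 iχ)]
      congr 1; ext w
      rw [sub_mul, smul_sub]
    rw [Pi.add_apply, h3, kernelEstimate_eq_fourier hK hh hsupp,
      ← convolution_scaledKernel_eq_fourier hK hh hX hf hsupp]
    push_cast
    ring
  have hcvm : AEStronglyMeasurable (fun x => (cv x : ℂ)) volume := by
    simp_rw [hcv, convolution_scaledKernel_eq_fourier hK hh hX hf hsupp]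
    exact (hcont _ iφ).aestronglyMeasurable
  have h4 : AEStronglyMeasurable (fun x => ((f x - cv x : ℝ) : ℂ)) volume := by
    simp only [Complex.ofReal_sub]
    exact (Complex.measurable_ofReal.comp hf.measurable).aestronglyMeasurable.sub hcvm
  rw [hdecomp]
  refine (eLpNorm_add_sq_le h4 (hcont _ idiff).aestronglyMeasurable).trans ?_
  rw [eLpNorm_fourier_eq mdiff idiff]
  have h5 : eLpNorm (fun x => ((f x - cv x : ℝ) : ℂ)) 2 volume =
      eLpNorm (fun x => f x - cv x) 2 volume :=
    eLpNorm_congr_norm_ae (ae_of_all _ fun x => by rw [Complex.norm_real])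
  rw [h5]
  refine add_le_add le_rfl ?_
  rw [eLpNorm_two_sq]
  let F : ℝ → ℝ≥0∞ := (Set.Icc (-(1 / h)) (1 / h)).indicator
    fun u => ‖phi P X u - χ u‖ₑ ^ 2
  have hF : Measurable F := ((hφm.sub hχ).enorm.pow_const 2).indicator measurableSet_Icc
  have h6 : ∫⁻ w, ‖(phi P X (2 * Real.pi * w) - χ (2 * Real.pi * w)) *
      kernelSpectrum hK (h * w)‖ₑ ^ 2 ≤
      ∫⁻ w, ENNReal.ofReal (M ^ 2) * F (2 * Real.pi * w) := by
    refine lintegral_mono_ae ?_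
    filter_upwards [(quasiMeasurePreserving_real_mul_left hh.ne').ae (kernelSpectrum_eq_zero hK hsupp),
      (quasiMeasurePreserving_real_mul_left hh.ne').ae (norm_kernelSpectrum_le hK hM)] with w h0 h1
    by_cases hw : 2 * Real.pi * w ∈ Set.Icc (-(1 / h)) (1 / h)
    · simp only [F, Set.indicator_of_mem hw]
      rw [enorm_mul, mul_pow, mul_comm]
      gcongr
      rw [← ofReal_norm, ← ENNReal.ofReal_pow (norm_nonneg _)]
      gcongr
    · rw [h0]
      · simp
      contrapose! hw
      have e : 2 * Real.pi * w = 1 / h * (2 * Real.pi * (h * w)) := by field_simp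
      have h1h : 0 < 1 / h := by positivity
      rw [e]
      exact ⟨by nlinarith [hw.1], by nlinarith [hw.2]⟩
  calc 2 * ∫⁻ w, ‖(phi P X (2 * Real.pi * w) - χ (2 * Real.pi * w)) *
      kernelSpectrum hK (h * w)‖ₑ ^ 2
      ≤ 2 * ∫⁻ w, ENNReal.ofReal (M ^ 2) * F (2 * Real.pi * w) := by gcongr
    _ = 2 * (ENNReal.ofReal (M ^ 2) * (ENNReal.ofReal (2 * Real.pi)⁻¹ * ∫⁻ u, F u)) := by
        rw [lintegral_const_mul _ (f := fun w => F (2 * Real.pi * w)) (hF.comp (measurable_const_mul _)),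
          lintegral_comp_mul_left_real F hF hp]
    _ = ENNReal.ofReal (M ^ 2 / Real.pi) * ∫⁻ u, F u := by
        have : ENNReal.ofReal (M ^ 2 / Real.pi) =
            2 * (ENNReal.ofReal (M ^ 2) * ENNReal.ofReal (2 * Real.pi)⁻¹) := by
          rw [← ENNReal.ofReal_mul (sq_nonneg M),
            show (2 : ℝ≥0∞) = ENNReal.ofReal 2 by simp, ← ENNReal.ofReal_mul zero_le_two]
          congr 1; field_simp
        rw [this]; ring
    _ = _ := by rw [lintegral_indicator measurableSet_Icc]

end Kernel

/-! ### Rosenthal's inequality for real variables -/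

section Moments

theorem abs_pow_le_one_add_pow (x : ℝ) {m q : ℕ} (hm : m ≤ 2 * q) : |x| ^ m ≤ 1 + x ^ (2 * q) := by
  have h0 : 0 ≤ x ^ (2 * q) := (even_two_mul q).pow_nonneg x
  rcases le_total |x| 1 with h | h
  · linarith [pow_le_one₀ (n := m) (abs_nonneg x) h]
  · rw [← (even_two_mul q).pow_abs] at h0 ⊢
    linarith [pow_le_pow_right₀ h hm]

variable {Ω : Type*} [MeasurableSpace Ω] {P : Measure Ω} [IsProbabilityMeasure P]

theorem integrable_pow_of_le {Z : Ω → ℝ} (hZ : Measurable Z) {m q : ℕ} (hm : m ≤ 2 * q)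
    (h : Integrable (fun ω => Z ω ^ (2 * q)) P) : Integrable (fun ω => Z ω ^ m) P := by
  refine ((integrable_const 1).add h).mono' (hZ.pow_const m).aestronglyMeasurable
    (ae_of_all _ fun ω => ?_)
  rw [norm_pow, Real.norm_eq_abs]
  exact abs_pow_le_one_add_pow _ hm

/-- One step of the moment recursion for sums of independent centred variables. -/
theorem integral_add_pow_le {T Z : Ω → ℝ} (hT : Measurable T) (hZ : Measurable Z)
    (hTZ : IndepFun T Z P) {q : ℕ} (hTi : Integrable (fun ω => T ω ^ (2 * q)) P)
    (hZi : Integrable (fun ω => Z ω ^ (2 * q)) P) (h0 : ∫ ω, Z ω ∂P = 0) {a : ℝ}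
    (ha : ∀ m, 2 ≤ m → m ≤ 2 * q → |∫ ω, Z ω ^ m ∂P| ≤ a) (ha0 : 0 ≤ a) :
    Integrable (fun ω => (Z ω + T ω) ^ (2 * q)) P ∧
    1 + ∫ ω, (Z ω + T ω) ^ (2 * q) ∂P ≤ (1 + ∫ ω, T ω ^ (2 * q) ∂P) * (1 + a * 4 ^ q) := by
  have hind : ∀ m k : ℕ, IndepFun (fun ω => Z ω ^ m) (fun ω => T ω ^ k) P := fun m k =>
    hTZ.symm.comp (measurable_id.pow_const m) (measurable_id.pow_const k)
  have hint : ∀ m ∈ Finset.range (2 * q + 1), Integrable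
      (fun ω => Z ω ^ m * T ω ^ (2 * q - m) * ((2 * q).choose m : ℝ)) P := by
    intro m hm
    have hm' : m ≤ 2 * q := Nat.lt_succ_iff.1 (Finset.mem_range.1 hm)
    exact ((hind m _).integrable_mul (integrable_pow_of_le hZ hm' hZi)
      (integrable_pow_of_le hT (Nat.sub_le _ _) hTi)).mul_const _
  simp_rw [add_pow]
  refine ⟨integrable_finsetSum _ hint, ?_⟩
  rw [integral_finsetSum _ hint]
  set A := ∫ ω, T ω ^ (2 * q) ∂P with hA
  have hA0 : 0 ≤ A := integral_nonneg fun ω => (even_two_mul q).pow_nonneg _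
  have hterm : ∀ m ∈ Finset.range (2 * q + 1),
      ∫ ω, Z ω ^ m * T ω ^ (2 * q - m) * ((2 * q).choose m : ℝ) ∂P ≤
        (if m = 0 then A else 0) + ((2 * q).choose m : ℝ) * (a * (1 + A)) := by
    intro m hm
    have hm' : m ≤ 2 * q := Nat.lt_succ_iff.1 (Finset.mem_range.1 hm)
    rw [integral_mul_const, (hind m _).integral_fun_mul_eq_mul_integral
      (hZ.pow_const m).aestronglyMeasurable (hT.pow_const _).aestronglyMeasurable]
    have hpos : 0 ≤ ((2 * q).choose m : ℝ) * (a * (1 + A)) := by positivity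
    -- In the binomial expansion `m = 0` reproduces the old moment, `m = 1` vanishes by centring and
    -- independence, and every other term costs at most `a * (1 + A)`. The binomial coefficients sum
    -- to `4 ^ q`.
    rcases m with _ | _ | m
    · simpa [← hA] using mul_nonneg ha0 (by linarith)
    · simpa [h0] using hpos
    · have h1 : |∫ ω, T ω ^ (2 * q - (m + 2)) ∂P| ≤ 1 + A := by
        refine (abs_integral_le_integral_abs).trans ?_
        have : 1 + A = ∫ ω, (1 + T ω ^ (2 * q)) ∂P := by
          rw [integral_add (integrable_const 1) hTi]; simp [hA]
        rw [this]
        refine integral_mono (integrable_pow_of_le hT (Nat.sub_le _ _) hTi).abs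
          ((integrable_const 1).add hTi) fun ω => ?_
        rw [abs_pow]
        exact abs_pow_le_one_add_pow _ (Nat.sub_le _ _)
      have h2 := ha (m + 2) (by omega) hm'
      simp only [Nat.add_eq_zero_iff, OfNat.ofNat_ne_zero, and_false, if_false, zero_add,
        show m + 1 + 1 = m + 2 from rfl]
      rw [mul_comm]
      refine mul_le_mul_of_nonneg_left ?_ (Nat.cast_nonneg _)
      calc _ ≤ |(∫ ω, Z ω ^ (m + 2) ∂P) * ∫ ω, T ω ^ (2 * q - (m + 2)) ∂P| := le_abs_self _
        _ ≤ _ := by rw [abs_mul]; gcongr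
  have hsum := Finset.sum_le_sum hterm
  rw [Finset.sum_add_distrib, ← Finset.sum_mul, Finset.sum_ite_eq' _ _ (fun _ => A)] at hsum
  have hch : ∑ m ∈ Finset.range (2 * q + 1), ((2 * q).choose m : ℝ) = 4 ^ q := by
    rw [← Nat.cast_sum, Nat.sum_range_choose, pow_mul]; norm_num
  rw [hch, if_pos (Finset.mem_range.2 (Nat.succ_pos _))] at hsum
  nlinarith [hsum]

/-- The normalised case. Each summand multiplies one plus the moment by at most `1 + 2 · 4^q / n`,
and `n` such factors stay below `exp (2 · 4^q)`. -/
theorem integral_sum_pow_le_exp {n : ℕ} (hn : 1 ≤ n) {ξ : Fin n → Ω → ℝ} (hind : iIndepFun ξ P)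
    (hm : ∀ j, Measurable (ξ j)) {q : ℕ} (hi : ∀ j, Integrable (fun ω => ξ j ω ^ (2 * q)) P)
    (h0 : ∀ j, ∫ ω, ξ j ω ∂P = 0) (hq : 1 ≤ q) (h2 : ∀ j, n * ∫ ω, ξ j ω ^ 2 ∂P ≤ 1)
    (h2q : ∀ j, n * ∫ ω, ξ j ω ^ (2 * q) ∂P ≤ 1) :
    Integrable (fun ω => (∑ j, ξ j ω) ^ (2 * q)) P ∧
    ∫ ω, (∑ j, ξ j ω) ^ (2 * q) ∂P ≤ Real.exp (2 * 4 ^ q) := by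
  have hn0 : (0 : ℝ) < n := by exact_mod_cast hn
  -- Intermediate powers satisfy `|x|^m ≤ x² + x^(2q)`, and each of the two moments on the right is
  -- at most `1 / n`.
  have ha : ∀ j, ∀ m, 2 ≤ m → m ≤ 2 * q → |∫ ω, ξ j ω ^ m ∂P| ≤ 2 / n := by
    intro j m hm2 hmq
    have i2 := integrable_pow_of_le (hm j) (m := 2) (by omega) (hi j)
    calc |∫ ω, ξ j ω ^ m ∂P| ≤ ∫ ω, |ξ j ω ^ m| ∂P := abs_integral_le_integral_abs
      _ ≤ ∫ ω, (ξ j ω ^ 2 + ξ j ω ^ (2 * q)) ∂P := by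
          refine integral_mono (integrable_pow_of_le (hm j) hmq (hi j)).abs
            (i2.add (hi j)) fun ω => ?_
          have e1 : 0 ≤ ξ j ω ^ (2 * q) := (even_two_mul q).pow_nonneg _
          rw [abs_pow]
          rcases le_total |ξ j ω| 1 with h | h
          · have := pow_le_pow_of_le_one (abs_nonneg (ξ j ω)) h hm2
            rw [sq_abs] at this
            linarith
          · have := pow_le_pow_right₀ h hmq
            rw [(even_two_mul q).pow_abs] at this
            nlinarith [sq_nonneg (ξ j ω)]
      _ = (∫ ω, ξ j ω ^ 2 ∂P) + ∫ ω, ξ j ω ^ (2 * q) ∂P := integral_add i2 (hi j)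
      _ ≤ 2 / n := by rw [le_div_iff₀ hn0]; linarith [h2 j, h2q j]
  have key : ∀ s : Finset (Fin n), Integrable (fun ω => (∑ j ∈ s, ξ j ω) ^ (2 * q)) P ∧
      1 + ∫ ω, (∑ j ∈ s, ξ j ω) ^ (2 * q) ∂P ≤ (1 + 2 / n * 4 ^ q) ^ s.card := by
    intro s
    induction s using Finset.induction_on with
    | empty =>
      simp [zero_pow (show 2 * q ≠ 0 by omega)]
    | insert i s his ih =>
      have hTZ : IndepFun (fun ω => ∑ j ∈ s, ξ j ω) (ξ i) P := by
        have := hind.indepFun_finsetSum_of_notMem hm his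
        rwa [show (∑ j ∈ s, ξ j) = fun ω => ∑ j ∈ s, ξ j ω by ext; simp] at this
      obtain ⟨a1, a2⟩ := integral_add_pow_le (Finset.measurable_sum s fun j _ => hm j) (hm i) hTZ
        ih.1 (hi i) (h0 i) (ha i) (by positivity)
      simp_rw [Finset.sum_insert his]
      refine ⟨a1, a2.trans ?_⟩
      rw [Finset.card_insert_of_notMem his, pow_succ]
      gcongr
      exact ih.2
  obtain ⟨k1, k2⟩ := key Finset.univ
  refine ⟨k1, ?_⟩
  rw [Finset.card_univ, Fintype.card_fin] at k2
  have : (1 + 2 / n * 4 ^ q : ℝ) ^ n ≤ Real.exp (2 * 4 ^ q) := by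
    calc (1 + 2 / n * 4 ^ q : ℝ) ^ n ≤ Real.exp (2 / n * 4 ^ q) ^ n := by
          gcongr; linarith [Real.add_one_le_exp (2 / n * 4 ^ q : ℝ)]
      _ = Real.exp (2 * 4 ^ q) := by rw [← Real.exp_nat_mul]; congr 1; field_simp
  linarith

/-- Rosenthal's inequality for even moments of sums of independent centred real variables. -/
theorem integral_sum_pow_le {n : ℕ} (hn : 1 ≤ n) {ξ : Fin n → Ω → ℝ} (hind : iIndepFun ξ P)
    (hm : ∀ j, Measurable (ξ j)) {q : ℕ} (hi : ∀ j, Integrable (fun ω => ξ j ω ^ (2 * q)) P)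
    (h0 : ∀ j, ∫ ω, ξ j ω ∂P = 0) (hq : 1 ≤ q) {s t : ℝ} (hs : 0 ≤ s) (ht : 0 ≤ t)
    (h2 : ∀ j, ∫ ω, ξ j ω ^ 2 ∂P ≤ s) (h2q : ∀ j, ∫ ω, ξ j ω ^ (2 * q) ∂P ≤ t) :
    Integrable (fun ω => (∑ j, ξ j ω) ^ (2 * q)) P ∧
    ∫ ω, (∑ j, ξ j ω) ^ (2 * q) ∂P ≤ Real.exp (2 * 4 ^ q) * ((n * s) ^ q + n * t) := by
  have hn0 : (0 : ℝ) < n := by exact_mod_cast hn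
  -- Dividing by `Λ` with `Λ^(2q) = (ns)^q + nt + δ` reduces to the normalised case; `δ` keeps `Λ`
  -- positive when `s = t = 0`.
  have key : ∀ δ : ℝ, 0 < δ → Integrable (fun ω => (∑ j, ξ j ω) ^ (2 * q)) P ∧
      ∫ ω, (∑ j, ξ j ω) ^ (2 * q) ∂P ≤ Real.exp (2 * 4 ^ q) * ((n * s) ^ q + n * t + δ) := by
    intro δ hδ
    have hR : 0 < (n * s) ^ q + n * t + δ := by positivity
    obtain ⟨Λ, hΛ, hΛq⟩ : ∃ Λ : ℝ, 0 < Λ ∧ Λ ^ (2 * q) = (n * s) ^ q + n * t + δ :=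
      ⟨((n * s) ^ q + n * t + δ) ^ (((2 * q : ℕ) : ℝ)⁻¹), Real.rpow_pos_of_pos hR _,
        Real.rpow_inv_natCast_pow hR.le (by omega)⟩
    have hscale : ∀ (x : ℝ) (m : ℕ), (Λ⁻¹ * x) ^ m = (Λ ^ m)⁻¹ * x ^ m := fun x m => by
      rw [mul_pow, inv_pow]
    have hnt : 0 ≤ n * t := by positivity
    have h2' : n * s ≤ Λ ^ 2 := by
      refine (pow_le_pow_iff_left₀ (by positivity) (by positivity) (n := q) (by omega)).1 ?_
      rw [← pow_mul, hΛq]; linarith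
    have h2q' : n * t ≤ Λ ^ (2 * q) := by
      rw [hΛq]; have : 0 ≤ (n * s) ^ q := by positivity
      linarith
    obtain ⟨a1, a2⟩ := integral_sum_pow_le_exp (P := P) hn (ξ := fun j ω => Λ⁻¹ * ξ j ω)
      (hind.comp (fun _ x => Λ⁻¹ * x) fun _ => measurable_const_mul _)
      (fun j => (hm j).const_mul _) (q := q)
      (fun j => by simp_rw [hscale]; exact (hi j).const_mul _)
      (fun j => by rw [integral_const_mul, h0, mul_zero]) hq
      (fun j => by
        simp_rw [hscale]
        rw [integral_const_mul, mul_left_comm, inv_mul_le_iff₀ (by positivity), mul_one]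
        exact (mul_le_mul_of_nonneg_left (h2 j) hn0.le).trans h2')
      (fun j => by
        simp_rw [hscale]
        rw [integral_const_mul, mul_left_comm, inv_mul_le_iff₀ (by positivity), mul_one]
        exact (mul_le_mul_of_nonneg_left (h2q j) hn0.le).trans h2q')
    simp_rw [← Finset.mul_sum, hscale] at a1 a2
    have hΛ' : (Λ ^ (2 * q))⁻¹ ≠ 0 := by positivity
    refine ⟨(integrable_const_mul_iff (IsUnit.mk0 _ hΛ') _).1 a1, ?_⟩
    rw [integral_const_mul, inv_mul_le_iff₀ (by positivity), hΛq] at a2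
    linarith
  refine ⟨(key 1 one_pos).1, le_of_forall_pos_le_add fun δ hδ => ?_⟩
  have hE := Real.exp_pos (2 * 4 ^ q)
  have := (key (δ / Real.exp (2 * 4 ^ q)) (by positivity)).2
  rwa [mul_add, mul_div_cancel₀ _ hE.ne'] at this

end Moments

/-! ### Moments of complex empirical means -/

section ComplexMoments

theorem ENNReal.add_pow_le_mul (a b : ℝ≥0∞) (q : ℕ) :
    (a + b) ^ q ≤ 2 ^ q * (a ^ q + b ^ q) := by
  rcases q.eq_zero_or_pos with rfl | hq
  · simp
  have h := ENNReal.rpow_add_le_mul_rpow_add_rpow a b (p := q) (by exact_mod_cast hq)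
  simp only [ENNReal.rpow_natCast] at h
  refine h.trans ?_
  gcongr
  rw [← ENNReal.rpow_natCast]
  exact ENNReal.rpow_le_rpow_of_exponent_le (by norm_num) (by linarith)

/-- Jensen's inequality for powers, for measures of arbitrary mass. -/
theorem lintegral_pow_le_mul {α : Type*} [MeasurableSpace α] (ρ : Measure α) {f : α → ℝ≥0∞}
    (hf : AEMeasurable f ρ) {q : ℕ} (hq : 1 ≤ q) :
    (∫⁻ x, f x ∂ρ) ^ q ≤ ρ Set.univ ^ (q - 1) * ∫⁻ x, f x ^ q ∂ρ := by
  rcases hq.eq_or_lt with rfl | hq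
  · simp
  have hq1 : (1 : ℝ) < q := by exact_mod_cast hq
  have hc := Real.HolderConjugate.conjExponent hq1
  have h := ENNReal.lintegral_mul_le_Lp_mul_Lq ρ hc hf (aemeasurable_const (b := (1 : ℝ≥0∞)))
  simp only [Pi.mul_apply, mul_one, ENNReal.rpow_natCast, ENNReal.one_rpow, lintegral_one] at h
  calc (∫⁻ x, f x ∂ρ) ^ q
      ≤ ((∫⁻ x, f x ^ q ∂ρ) ^ (1 / (q : ℝ)) * ρ Set.univ ^ (1 / (q : ℝ).conjExponent)) ^ q := by
        gcongr
    _ = _ := by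
        rw [mul_pow, ← ENNReal.rpow_natCast, ← ENNReal.rpow_natCast, ← ENNReal.rpow_mul,
          ← ENNReal.rpow_mul, one_div_mul_cancel (by positivity), ENNReal.rpow_one, mul_comm]
        congr 1
        rw [← ENNReal.rpow_natCast]
        congr 1
        rw [Nat.cast_sub hq.le, Nat.cast_one, Real.conjExponent]
        field_simp

variable {Ω : Type*} [MeasurableSpace Ω] {P : Measure Ω} [IsProbabilityMeasure P]

theorem lintegral_pow_le_lintegral_pow {f : Ω → ℝ≥0∞} (hf : AEMeasurable f P) {q : ℕ}
    (hq : 1 ≤ q) : (∫⁻ x, f x ∂P) ^ q ≤ ∫⁻ x, f x ^ q ∂P := by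
  simpa using lintegral_pow_le_mul P hf hq

theorem enorm_pow_two_mul_eq (x : ℝ) (q : ℕ) : ‖x‖ₑ ^ (2 * q) = ENNReal.ofReal (x ^ (2 * q)) := by
  rw [← ofReal_norm, ← ENNReal.ofReal_pow (norm_nonneg _), Real.norm_eq_abs,
    (even_two_mul q).pow_abs]

/-- The constant in Rosenthal's inequality. -/
noncomputable def rosenthalConst (q : ℕ) : ℝ≥0∞ := ENNReal.ofReal (Real.exp (2 * 4 ^ q))

/-- Rosenthal's inequality for real variables, in `[0, ∞]`. -/
theorem lintegral_real_sum_pow_le {n : ℕ} (hn : 1 ≤ n) {ξ : Fin n → Ω → ℝ} (hind : iIndepFun ξ P)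
    (hm : ∀ j, Measurable (ξ j)) {q : ℕ} (hq : 1 ≤ q) (h0 : ∀ j, ∫ ω, ξ j ω ∂P = 0)
    {s t : ℝ≥0∞} (hs : ∀ j, ∫⁻ ω, ‖ξ j ω‖ₑ ^ 2 ∂P ≤ s) (ht : ∀ j, ∫⁻ ω, ‖ξ j ω‖ₑ ^ (2 * q) ∂P ≤ t) :
    ∫⁻ ω, ‖∑ j, ξ j ω‖ₑ ^ (2 * q) ∂P ≤ rosenthalConst q * ((n * s) ^ q + n * t) := by
  have hn0 : (n : ℝ≥0∞) ≠ 0 := by simp; omega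
  have hC : rosenthalConst q ≠ 0 := by simp [rosenthalConst, Real.exp_pos]
  -- If a bound is infinite, so is the right-hand side, because `n` and the constant are nonzero.
  by_cases hst : s = ∞ ∨ t = ∞
  · have : (n * s) ^ q + n * t = ∞ := by
      rcases hst with rfl | rfl
      · rw [ENNReal.mul_top hn0, ENNReal.top_pow (by omega), top_add]
      · rw [ENNReal.mul_top hn0, add_top]
    rw [this, ENNReal.mul_top hC]
    exact le_top
  push Not at hst
  lift s to NNReal using hst.1
  lift t to NNReal using hst.2
  have hi : ∀ j, Integrable (fun ω => ξ j ω ^ (2 * q)) P := fun j => by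
    refine ⟨((hm j).pow_const _).aestronglyMeasurable, ?_⟩
    rw [hasFiniteIntegral_iff_ofReal (ae_of_all _ fun ω => (even_two_mul q).pow_nonneg _)]
    simp_rw [← enorm_pow_two_mul_eq]
    exact (ht j).trans_lt ENNReal.coe_lt_top
  have hreal : ∀ (j) (k : ℕ) (b : NNReal), k ≤ q → ∫⁻ ω, ‖ξ j ω‖ₑ ^ (2 * k) ∂P ≤ b →
      ∫ ω, ξ j ω ^ (2 * k) ∂P ≤ b := by
    intro j k b hk hb
    rw [integral_eq_lintegral_of_nonneg_ae (ae_of_all _ fun ω => (even_two_mul k).pow_nonneg _)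
      ((hm j).pow_const _).aestronglyMeasurable]
    simp_rw [← enorm_pow_two_mul_eq]
    exact ENNReal.toReal_le_coe_of_le_coe hb
  obtain ⟨a1, a2⟩ := integral_sum_pow_le hn hind hm hi h0 hq s.2 t.2
    (fun j => hreal j 1 s hq (hs j)) (fun j => hreal j q t le_rfl (ht j))
  simp_rw [enorm_pow_two_mul_eq]
  rw [← ofReal_integral_eq_lintegral_ofReal a1 (ae_of_all _ fun ω => (even_two_mul q).pow_nonneg _),
    rosenthalConst]
  refine (ENNReal.ofReal_le_ofReal a2).trans (le_of_eq ?_)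
  rw [ENNReal.ofReal_mul (Real.exp_pos _).le]
  congr 1
  have hs0 : (0 : ℝ) ≤ s := s.2
  have ht0 : (0 : ℝ) ≤ t := t.2
  rw [ENNReal.ofReal_add (by positivity) (by positivity), ENNReal.ofReal_pow (by positivity),
    ENNReal.ofReal_mul (by positivity), ENNReal.ofReal_mul (by positivity), ENNReal.ofReal_natCast]
  simp

theorem Complex.enorm_pow_le (z : ℂ) (q : ℕ) :
    ‖z‖ₑ ^ (2 * q) ≤ 2 ^ q * (‖z.re‖ₑ ^ (2 * q) + ‖z.im‖ₑ ^ (2 * q)) := by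
  have h : ‖z‖ₑ ^ 2 = ‖z.re‖ₑ ^ 2 + ‖z.im‖ₑ ^ 2 := by
    have h1 := enorm_pow_two_mul_eq z.re 1
    have h2 := enorm_pow_two_mul_eq z.im 1
    rw [mul_one] at h1 h2
    rw [h1, h2, ← ENNReal.ofReal_add (sq_nonneg _) (sq_nonneg _), ← ofReal_norm,
      ← ENNReal.ofReal_pow (norm_nonneg _), ← Complex.normSq_eq_norm_sq, Complex.normSq_apply]
    congr 1; ring
  rw [pow_mul, h, pow_mul, pow_mul]
  exact ENNReal.add_pow_le_mul _ _ _

theorem Complex.enorm_re_le (z : ℂ) : ‖z.re‖ₑ ≤ ‖z‖ₑ := by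
  rw [← ofReal_norm, ← ofReal_norm]; exact ENNReal.ofReal_le_ofReal (Complex.abs_re_le_norm z)

theorem Complex.enorm_im_le (z : ℂ) : ‖z.im‖ₑ ≤ ‖z‖ₑ := by
  rw [← ofReal_norm, ← ofReal_norm]; exact ENNReal.ofReal_le_ofReal (Complex.abs_im_le_norm z)

/-- Rosenthal's inequality for even moments of sums of independent centred complex variables. -/
theorem lintegral_sum_pow_le {n : ℕ} (hn : 1 ≤ n) {ζ : Fin n → Ω → ℂ} (hind : iIndepFun ζ P)
    (hm : ∀ j, Measurable (ζ j)) {q : ℕ} (hq : 1 ≤ q) (hi : ∀ j, Integrable (ζ j) P)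
    (h0 : ∀ j, ∫ ω, ζ j ω ∂P = 0)
    {s t : ℝ≥0∞} (hs : ∀ j, ∫⁻ ω, ‖ζ j ω‖ₑ ^ 2 ∂P ≤ s) (ht : ∀ j, ∫⁻ ω, ‖ζ j ω‖ₑ ^ (2 * q) ∂P ≤ t) :
    ∫⁻ ω, ‖∑ j, ζ j ω‖ₑ ^ (2 * q) ∂P ≤
      2 ^ q * (2 * rosenthalConst q) * ((n * s) ^ q + n * t) := by
  have hre := lintegral_real_sum_pow_le hn (ξ := fun j ω => (ζ j ω).re)
    (hind.comp (fun _ => Complex.re) fun _ => Complex.measurable_re)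
    (fun j => Complex.measurable_re.comp (hm j)) hq
    (fun j => by
      have := integral_re (hi j)
      simp only [RCLike.re_eq_complex_re] at this
      rw [this, h0, Complex.zero_re])
    (fun j => (lintegral_mono fun ω => pow_le_pow_left' (Complex.enorm_re_le _) 2).trans (hs j))
    (fun j => (lintegral_mono fun ω => pow_le_pow_left' (Complex.enorm_re_le _) _).trans (ht j))
  have him := lintegral_real_sum_pow_le hn (ξ := fun j ω => (ζ j ω).im)
    (hind.comp (fun _ => Complex.im) fun _ => Complex.measurable_im)
    (fun j => Complex.measurable_im.comp (hm j)) hq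
    (fun j => by
      have := integral_im (hi j)
      simp only [RCLike.im_eq_complex_im] at this
      rw [this, h0, Complex.zero_im])
    (fun j => (lintegral_mono fun ω => pow_le_pow_left' (Complex.enorm_im_le _) 2).trans (hs j))
    (fun j => (lintegral_mono fun ω => pow_le_pow_left' (Complex.enorm_im_le _) _).trans (ht j))
  calc ∫⁻ ω, ‖∑ j, ζ j ω‖ₑ ^ (2 * q) ∂P
      ≤ ∫⁻ ω, 2 ^ q * (‖∑ j, (ζ j ω).re‖ₑ ^ (2 * q) + ‖∑ j, (ζ j ω).im‖ₑ ^ (2 * q)) ∂P := by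
        refine lintegral_mono fun ω => ?_
        have := Complex.enorm_pow_le (∑ j, ζ j ω) q
        rwa [Complex.re_sum, Complex.im_sum] at this
    _ = 2 ^ q * ((∫⁻ ω, ‖∑ j, (ζ j ω).re‖ₑ ^ (2 * q) ∂P) +
          ∫⁻ ω, ‖∑ j, (ζ j ω).im‖ₑ ^ (2 * q) ∂P) := by
        have m1 : Measurable fun ω => ‖∑ j, (ζ j ω).re‖ₑ ^ (2 * q) :=
          (Finset.measurable_sum _ fun j _ => Complex.measurable_re.comp (hm j)).enorm.pow_const _
        have m2 : Measurable fun ω => ‖∑ j, (ζ j ω).im‖ₑ ^ (2 * q) :=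
          (Finset.measurable_sum _ fun j _ => Complex.measurable_im.comp (hm j)).enorm.pow_const _
        rw [lintegral_const_mul' _ _ (by finiteness), lintegral_add_left m1]
    _ ≤ 2 ^ q * (rosenthalConst q * ((n * s) ^ q + n * t) +
          rosenthalConst q * ((n * s) ^ q + n * t)) := by gcongr
    _ = _ := by ring

/-- The constant in the moment bound for empirical means. -/
noncomputable def empiricalConst (q : ℕ) : ℝ≥0∞ :=
  2 ^ q * (2 * rosenthalConst q) * (2 ^ (2 * q) * 2 ^ q)

theorem empiricalConst_ne_top (q : ℕ) : empiricalConst q ≠ ∞ := by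
  simp only [empiricalConst, rosenthalConst]
  finiteness

/-- By convexity centring costs only a constant: Jensen bounds the power of the mean by the moment
itself. -/
theorem lintegral_sub_integral_pow_le {ζ : Ω → ℂ} (hm : Measurable ζ) {m : ℕ} (hm1 : 1 ≤ m) :
    ∫⁻ ω, ‖ζ ω - ∫ ω', ζ ω' ∂P‖ₑ ^ m ∂P ≤ 2 ^ m * (2 * ∫⁻ ω, ‖ζ ω‖ₑ ^ m ∂P) := by
  calc ∫⁻ ω, ‖ζ ω - ∫ ω', ζ ω' ∂P‖ₑ ^ m ∂P
      ≤ ∫⁻ ω, 2 ^ m * (‖ζ ω‖ₑ ^ m + ‖∫ ω', ζ ω' ∂P‖ₑ ^ m) ∂P := by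
        refine lintegral_mono fun ω => ?_
        exact (pow_le_pow_left' (enorm_sub_le) m).trans (ENNReal.add_pow_le_mul _ _ _)
    _ = 2 ^ m * ((∫⁻ ω, ‖ζ ω‖ₑ ^ m ∂P) + ‖∫ ω', ζ ω' ∂P‖ₑ ^ m) := by
        rw [lintegral_const_mul _ ((hm.enorm.pow_const _).add_const _),
          lintegral_add_right _ measurable_const]
        simp
    _ ≤ _ := by
        rw [two_mul (∫⁻ _, _ ∂_)]
        gcongr
        exact (pow_le_pow_left' (enorm_integral_le_lintegral_enorm _) m).trans
          (lintegral_pow_le_lintegral_pow hm.enorm.aemeasurable hm1)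

/-- Moments of the deviation of an empirical mean from the mean. -/
theorem lintegral_empirical_pow_le {n : ℕ} (hn : 1 ≤ n) {ζ : Fin n → Ω → ℂ} (hind : iIndepFun ζ P)
    (hm : ∀ j, Measurable (ζ j)) {q : ℕ} (hq : 1 ≤ q) (hi : ∀ j, Integrable (ζ j) P) {a : ℂ}
    (h0 : ∀ j, ∫ ω, ζ j ω ∂P = a)
    {s t : ℝ≥0∞} (hs : ∀ j, ∫⁻ ω, ‖ζ j ω‖ₑ ^ 2 ∂P ≤ s) (ht : ∀ j, ∫⁻ ω, ‖ζ j ω‖ₑ ^ (2 * q) ∂P ≤ t) :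
    ∫⁻ ω, ‖1 / (n : ℂ) * ∑ j, ζ j ω - a‖ₑ ^ (2 * q) ∂P ≤
      empiricalConst q * ((s / n) ^ q + t / n ^ (2 * q - 1)) := by
  have hn0 : (n : ℝ≥0∞) ≠ 0 := by simp; omega
  have hnt : (n : ℝ≥0∞) ≠ ∞ := ENNReal.natCast_ne_top n
  have hn0' : (n : ℂ) ≠ 0 := by simp; omega
  have h1 := lintegral_sum_pow_le hn (ζ := fun j ω => ζ j ω - a)
    (hind.comp (fun _ z => z - a) fun _ => measurable_id.sub_const a)
    (fun j => (hm j).sub_const a) hq (fun j => (hi j).sub (integrable_const a))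
    (fun j => by rw [integral_sub (hi j) (integrable_const a), h0]; simp)
    (s := 2 ^ 2 * (2 * s)) (t := 2 ^ (2 * q) * (2 * t))
    (fun j => by
      rw [← h0 j]
      refine (lintegral_sub_integral_pow_le (hm j) (by norm_num)).trans ?_
      gcongr; exact hs j)
    (fun j => by
      rw [← h0 j]
      refine (lintegral_sub_integral_pow_le (hm j) (by omega)).trans ?_
      gcongr; exact ht j)
  have h2 : ∀ ω, ‖1 / (n : ℂ) * ∑ j, ζ j ω - a‖ₑ ^ (2 * q) =
      ((n : ℝ≥0∞) ^ (2 * q))⁻¹ * ‖∑ j, (ζ j ω - a)‖ₑ ^ (2 * q) := fun ω => by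
    have : 1 / (n : ℂ) * ∑ j, ζ j ω - a = (n : ℂ)⁻¹ * ∑ j, (ζ j ω - a) := by
      rw [Finset.sum_sub_distrib]
      simp only [Finset.sum_const, Finset.card_univ, Fintype.card_fin, nsmul_eq_mul]
      field_simp
    rw [this, enorm_mul, mul_pow, enorm_inv hn0', ENNReal.inv_pow]
    congr 3
    simp [enorm_eq_nnnorm]
  simp_rw [h2]
  rw [lintegral_const_mul _ ((Finset.measurable_sum _ fun j _ =>
    (hm j).sub_const a).enorm.pow_const _)]
  refine (mul_le_mul_right h1 _).trans ?_
  have e1 : ((n : ℝ≥0∞) ^ (2 * q))⁻¹ * (n * s) ^ q = (s / n) ^ q := by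
    rw [mul_pow, ← mul_assoc, two_mul, pow_add, ENNReal.mul_inv (Or.inl (by positivity))
      (Or.inl (by finiteness)), mul_assoc ((n : ℝ≥0∞) ^ q)⁻¹, ENNReal.inv_mul_cancel
      (by positivity) (by finiteness), mul_one, ENNReal.div_eq_inv_mul, mul_pow, ENNReal.inv_pow]
  have e2 : ((n : ℝ≥0∞) ^ (2 * q))⁻¹ * (n * t) = t / n ^ (2 * q - 1) := by
    obtain ⟨k, hk⟩ : ∃ k, 2 * q = k + 1 := ⟨2 * q - 1, by omega⟩
    rw [hk, Nat.add_sub_cancel, pow_succ, ENNReal.mul_inv (Or.inl (by positivity))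
      (Or.inl (by finiteness)), mul_assoc, ← mul_assoc (n : ℝ≥0∞)⁻¹, ENNReal.inv_mul_cancel hn0 hnt,
      one_mul, ENNReal.div_eq_inv_mul]
  -- Centring gives a factor `2 ^ q` on the variance term but only `2` on the other; the larger one
  -- serves both.
  have hq2 : (2 : ℝ≥0∞) ≤ 2 ^ q := by
    simpa using pow_le_pow_right₀ (one_le_two : (1 : ℝ≥0∞) ≤ 2) hq
  calc ((n : ℝ≥0∞) ^ (2 * q))⁻¹ * (2 ^ q * (2 * rosenthalConst q) *
        ((n * (2 ^ 2 * (2 * s))) ^ q + n * (2 ^ (2 * q) * (2 * t))))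
      = 2 ^ q * (2 * rosenthalConst q) * (2 ^ (2 * q) * (2 ^ q *
          (((n : ℝ≥0∞) ^ (2 * q))⁻¹ * (n * s) ^ q) +
          2 * (((n : ℝ≥0∞) ^ (2 * q))⁻¹ * (n * t)))) := by
        rw [show (n * (2 ^ 2 * (2 * s))) ^ q = 2 ^ (2 * q) * 2 ^ q * (n * s) ^ q by
          rw [pow_mul, ← mul_pow, ← mul_pow]; congr 1; ring]
        ring
    _ ≤ 2 ^ q * (2 * rosenthalConst q) * (2 ^ (2 * q) * (2 ^ q *
          (((n : ℝ≥0∞) ^ (2 * q))⁻¹ * (n * s) ^ q) +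
          2 ^ q * (((n : ℝ≥0∞) ^ (2 * q))⁻¹ * (n * t)))) := by gcongr
    _ = _ := by rw [e1, e2, empiricalConst]; ring

/-- A simplified moment bound, of the Marcinkiewicz–Zygmund type. -/
theorem lintegral_empirical_pow_le_div {n : ℕ} (hn : 1 ≤ n) {ζ : Fin n → Ω → ℂ}
    (hind : iIndepFun ζ P)
    (hm : ∀ j, Measurable (ζ j)) {q : ℕ} (hq : 1 ≤ q) (hi : ∀ j, Integrable (ζ j) P) {a : ℂ}
    (h0 : ∀ j, ∫ ω, ζ j ω ∂P = a)
    {t : ℝ≥0∞} (ht : ∀ j, ∫⁻ ω, ‖ζ j ω‖ₑ ^ (2 * q) ∂P ≤ t) :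
    ∫⁻ ω, ‖1 / (n : ℂ) * ∑ j, ζ j ω - a‖ₑ ^ (2 * q) ∂P ≤ 2 * empiricalConst q * (t / n ^ q) := by
  have hn1 : (1 : ℝ≥0∞) ≤ n := by exact_mod_cast hn
  have hq0 : (q : ℝ) ≠ 0 := by positivity
  -- Jensen bounds the variance by `t^(1/q)`, which makes the variance term exactly `t / n^q`. The
  -- other term is no larger, as `q ≤ 2q - 1` and `n ≥ 1`.
  have hs : ∀ j, ∫⁻ ω, ‖ζ j ω‖ₑ ^ 2 ∂P ≤ t ^ (q : ℝ)⁻¹ := fun j => by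
    rw [ENNReal.le_rpow_inv_iff (by positivity), ENNReal.rpow_natCast]
    refine (lintegral_pow_le_lintegral_pow ((hm j).enorm.pow_const 2).aemeasurable hq).trans ?_
    simp_rw [← pow_mul]
    exact ht j
  refine (lintegral_empirical_pow_le hn hind hm hq hi h0 hs ht).trans ?_
  have h1 : (t ^ (q : ℝ)⁻¹ / n) ^ q = t / n ^ q := by
    rw [ENNReal.div_eq_inv_mul, mul_pow, ENNReal.div_eq_inv_mul, ENNReal.inv_pow,
      ← ENNReal.rpow_natCast (t ^ _), ← ENNReal.rpow_mul, inv_mul_cancel₀ hq0, ENNReal.rpow_one]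
  have h2 : t / n ^ (2 * q - 1) ≤ t / n ^ q := by
    gcongr
    omega
  calc _ ≤ empiricalConst q * (t / n ^ q + t / n ^ q) := by rw [h1]; gcongr
    _ = _ := by ring

end ComplexMoments

/-! ### Characteristic functions and their derivatives -/

section CharFun

variable {Ω : Type*} [MeasurableSpace Ω] {P : Measure Ω} [IsProbabilityMeasure P]

theorem phi_eq_integral {Z : Ω → ℝ} (hZ : Measurable Z) (u : ℝ) :
    phi P Z u = ∫ ω, Complex.exp (u * Z ω * Complex.I) ∂P := by
  rw [phi, charFun_apply_real, integral_map hZ.aemeasurable]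
  exact (by fun_prop : Continuous fun x : ℝ => Complex.exp (u * x * Complex.I)).aestronglyMeasurable

theorem phi_zero {Z : Ω → ℝ} (hZ : Measurable Z) : phi P Z 0 = 1 := by
  rw [phi_eq_integral hZ]; simp

theorem norm_phi_le_one {Z : Ω → ℝ} (hZ : Measurable Z) (u : ℝ) : ‖phi P Z u‖ ≤ 1 := by
  have : IsProbabilityMeasure (P.map Z) := Measure.isProbabilityMeasure_map hZ.aemeasurable
  exact norm_charFun_le_one u

theorem continuous_phi {Z : Ω → ℝ} (hZ : Measurable Z) : Continuous (phi P Z) := by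
  have : IsProbabilityMeasure (P.map Z) := Measure.isProbabilityMeasure_map hZ.aemeasurable
  exact continuous_charFun

theorem phi_neg (Z : Ω → ℝ) (u : ℝ) : phi P Z (-u) = starRingEnd ℂ (phi P Z u) := charFun_neg u

theorem contDiff_phi {Z : Ω → ℝ} (hZ : Measurable Z) (hZ2 : MemLp Z 2 P) :
    ContDiff ℝ 2 (phi P Z) := by
  have : IsProbabilityMeasure (P.map Z) := Measure.isProbabilityMeasure_map hZ.aemeasurable
  exact contDiff_charFun (n := 2)
    ((memLp_map_measure_iff aestronglyMeasurable_id hZ.aemeasurable).2 hZ2)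

theorem iteratedDeriv_phi {Z : Ω → ℝ} (hZ : Measurable Z) {m : ℕ} (hZm : MemLp Z m P) (u : ℝ) :
    iteratedDeriv m (phi P Z) u =
      Complex.I ^ m * ∫ ω, (Z ω : ℂ) ^ m * Complex.exp (u * Z ω * Complex.I) ∂P := by
  have : IsProbabilityMeasure (P.map Z) := Measure.isProbabilityMeasure_map hZ.aemeasurable
  rw [phi, iteratedDeriv_charFun
    ((memLp_map_measure_iff aestronglyMeasurable_id hZ.aemeasurable).2 hZm),
    integral_map hZ.aemeasurable]
  exact (by fun_prop : Continuous fun x : ℝ =>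
    (x : ℂ) ^ m * Complex.exp (u * x * Complex.I)).aestronglyMeasurable

theorem deriv_phi {Z : Ω → ℝ} (hZ : Measurable Z) (hZ1 : Integrable Z P) (u : ℝ) :
    deriv (phi P Z) u = Complex.I * ∫ ω, (Z ω : ℂ) * Complex.exp (u * Z ω * Complex.I) ∂P := by
  have := iteratedDeriv_phi (m := 1) hZ (by simpa using memLp_one_iff_integrable.2 hZ1) u
  simpa using this

theorem deriv_deriv_phi {Z : Ω → ℝ} (hZ : Measurable Z) (hZ2 : MemLp Z 2 P) (u : ℝ) :
    deriv (deriv (phi P Z)) u =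
      -∫ ω, (Z ω : ℂ) ^ 2 * Complex.exp (u * Z ω * Complex.I) ∂P := by
  have := iteratedDeriv_phi (m := 2) hZ hZ2 u
  rw [iteratedDeriv_succ, iteratedDeriv_one] at this
  simpa using this

/-- A nonvanishing `C¹` characteristic function is the exponential of the integral of its
logarithmic derivative. -/
theorem phi_eq_exp_integral {Z : Ω → ℝ} (hZ : Measurable Z) (hZ2 : MemLp Z 2 P)
    (h0 : ∀ u, phi P Z u ≠ 0) (u : ℝ) :
    phi P Z u = Complex.exp (∫ v in (0 : ℝ)..u, deriv (phi P Z) v / phi P Z v) := by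
  have hC := contDiff_phi hZ hZ2
  have hd : ∀ v, HasDerivAt (phi P Z) (deriv (phi P Z) v) v := fun v =>
    (hC.differentiable (by norm_num) v).hasDerivAt
  have hcont : Continuous fun v => deriv (phi P Z) v / phi P Z v :=
    (hC.continuous_deriv (by norm_num)).div (continuous_phi hZ) h0
  have hI : ∀ v, HasDerivAt (fun w => ∫ v in (0 : ℝ)..w, deriv (phi P Z) v / phi P Z v)
      (deriv (phi P Z) v / phi P Z v) v := fun v =>
    intervalIntegral.integral_hasDerivAt_right (hcont.intervalIntegrable _ _)
      (hcont.stronglyMeasurableAtFilter _ _) hcont.continuousAt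
  -- The product of `φ` with the exponential of minus the integral has derivative zero and equals
  -- `1` at `0`; this avoids any choice of complex logarithm.
  have hg : ∀ v, HasDerivAt (fun w => phi P Z w *
      Complex.exp (-∫ v in (0 : ℝ)..w, deriv (phi P Z) v / phi P Z v)) 0 v := fun v => by
    refine ((hd v).mul (hI v).neg.cexp).congr_deriv ?_
    have := h0 v
    simp only [Pi.neg_apply]
    field_simp
    ring
  have := is_const_of_deriv_eq_zero (fun v => (hg v).differentiableAt) (fun v => (hg v).deriv) u 0
  simp only [intervalIntegral.integral_same, neg_zero, Complex.exp_zero, mul_one, phi_zero hZ] at this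
  rw [Complex.exp_neg, mul_inv_eq_one₀ (Complex.exp_ne_zero _)] at this
  exact this

end CharFun

/-! ### Identities in the repeated measurement model -/

section Model

variable {Ω Ω' : Type*} [MeasurableSpace Ω] [MeasurableSpace Ω'] {P : Measure Ω}
  [IsProbabilityMeasure P] {P' : Measure Ω'} {X ε₁ ε₂ : Ω → ℝ} {n : ℕ}
  {Y : Fin n → Ω' → ℝ × ℝ}

namespace RepeatedMeasurements.Model

theorem indepFun_X_ε₁ (hM : Model P P' X ε₁ ε₂ Y) : IndepFun X ε₁ P := by
  simpa using hM.indep.indepFun (i := 0) (j := 1) (by decide)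

theorem indepFun_prod (hM : Model P P' X ε₁ ε₂ Y) : IndepFun (fun ω => (X ω, ε₁ ω)) ε₂ P := by
  have hm : ∀ i, Measurable (![X, ε₁, ε₂] i) := by
    intro i; fin_cases i
    exacts [hM.measurable_X, hM.measurable_ε₁, hM.measurable_ε₂]
  simpa using hM.indep.indepFun_prodMk hm 0 1 2 (by decide) (by decide)

theorem integral_mul_mul (hM : Model P P' X ε₁ ε₂ Y) {a b c : ℝ → ℂ} (ha : Measurable a)
    (hb : Measurable b) (hc : Measurable c) :
    ∫ ω, a (X ω) * b (ε₁ ω) * c (ε₂ ω) ∂P =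
      (∫ ω, a (X ω) ∂P) * (∫ ω, b (ε₁ ω) ∂P) * ∫ ω, c (ε₂ ω) ∂P := by
  have h1 : IndepFun (fun ω => a (X ω) * b (ε₁ ω)) (fun ω => c (ε₂ ω)) P :=
    hM.indepFun_prod.comp (φ := fun z : ℝ × ℝ => a z.1 * b z.2)
      ((ha.comp measurable_fst).mul (hb.comp measurable_snd)) hc
  have h2 : IndepFun (fun ω => a (X ω)) (fun ω => b (ε₁ ω)) P := hM.indepFun_X_ε₁.comp ha hb
  have mX := (ha.comp hM.measurable_X).aestronglyMeasurable (μ := P)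
  have m1 := (hb.comp hM.measurable_ε₁).aestronglyMeasurable (μ := P)
  have m2 := (hc.comp hM.measurable_ε₂).aestronglyMeasurable (μ := P)
  rw [h1.integral_fun_mul_eq_mul_integral (mX.mul m1) m2,
    h2.integral_fun_mul_eq_mul_integral mX m1]

theorem integrable_mul_mul (hM : Model P P' X ε₁ ε₂ Y) {a b c : ℝ → ℂ} (ha : Measurable a)
    (hb : Measurable b) (hc : Measurable c) (ia : Integrable (fun ω => a (X ω)) P)
    (ib : Integrable (fun ω => b (ε₁ ω)) P) (ic : Integrable (fun ω => c (ε₂ ω)) P) :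
    Integrable (fun ω => a (X ω) * b (ε₁ ω) * c (ε₂ ω)) P := by
  have h1 : IndepFun (fun ω => a (X ω) * b (ε₁ ω)) (fun ω => c (ε₂ ω)) P :=
    hM.indepFun_prod.comp (φ := fun z : ℝ × ℝ => a z.1 * b z.2)
      ((ha.comp measurable_fst).mul (hb.comp measurable_snd)) hc
  have h2 : IndepFun (fun ω => a (X ω)) (fun ω => b (ε₁ ω)) P := hM.indepFun_X_ε₁.comp ha hb
  exact h1.integrable_mul (h2.integrable_mul ia ib) ic

theorem phi_ε₂ (hM : Model P P' X ε₁ ε₂ Y) : phi P ε₂ = phi P ε₁ := by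
  rw [phi, phi, hM.copies.map_eq]

theorem phi_add (hM : Model P P' X ε₁ ε₂ Y) (u : ℝ) :
    phi P (X + ε₂) u = phi P X u * phi P ε₁ u := by
  have h : IndepFun X ε₂ P := by
    simpa using hM.indep.indepFun (i := 0) (j := 2) (by decide)
  rw [← hM.phi_ε₂, phi, h.charFun_map_add_eq_mul hM.measurable_X.aemeasurable
    hM.measurable_ε₂.aemeasurable]
  rfl

/-- First `X = Y₁ - ε₁` is integrable, then `X ε₁` is by independence, so `X² + ε₁² = Y₁² - 2 X ε₁`
is integrable and dominates both squares. -/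
theorem memLp_two (hM : Model P P' X ε₁ ε₂ Y) {p : ℕ} (hp : 1 ≤ p)
    (hY : Integrable (fun ω => |X ω + ε₁ ω| ^ (2 * p)) P) (hε : Integrable ε₁ P) :
    MemLp X 2 P ∧ MemLp ε₁ 2 P := by
  have mX := hM.measurable_X
  have mε := hM.measurable_ε₁
  have hYm : Measurable fun ω => X ω + ε₁ ω := mX.add mε
  simp_rw [(even_two_mul p).pow_abs] at hY
  have hY2 := integrable_pow_of_le hYm (m := 2) (by omega) hY
  have hY1 : Integrable (fun ω => X ω + ε₁ ω) P := by
    simpa using integrable_pow_of_le hYm (m := 1) (by omega) hY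
  have hX1 : Integrable X P := by
    refine (hY1.sub hε).congr (ae_of_all _ fun ω => ?_)
    simp
  have hprod : Integrable (fun ω => X ω * ε₁ ω) P := hM.indepFun_X_ε₁.integrable_mul hX1 hε
  have hsum : Integrable (fun ω => X ω ^ 2 + ε₁ ω ^ 2) P := by
    refine (hY2.sub (hprod.const_mul 2)).congr (ae_of_all _ fun ω => ?_)
    simp only [Pi.sub_apply]; ring
  constructor
  · refine (memLp_two_iff_integrable_sq mX.aestronglyMeasurable).2
      (hsum.mono' (mX.pow_const 2).aestronglyMeasurable (ae_of_all _ fun ω => ?_))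
    rw [Real.norm_of_nonneg (sq_nonneg _)]
    linarith [sq_nonneg (ε₁ ω)]
  · refine (memLp_two_iff_integrable_sq mε.aestronglyMeasurable).2
      (hsum.mono' (mε.pow_const 2).aestronglyMeasurable (ae_of_all _ fun ω => ?_))
    rw [Real.norm_of_nonneg (sq_nonneg _)]
    linarith [sq_nonneg (X ω)]

theorem measurable_exp (u : ℝ) : Measurable fun x : ℝ => Complex.exp (u * x * Complex.I) := by
  fun_prop

theorem integrable_exp {Z : Ω → ℝ} (hZ : Measurable Z) (u : ℝ) :
    Integrable (fun ω => Complex.exp (u * Z ω * Complex.I)) P := by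
  refine (integrable_const (1 : ℝ)).mono' ((measurable_exp u).comp hZ).aestronglyMeasurable
    (ae_of_all _ fun ω => ?_)
  rw [← Complex.ofReal_mul, Complex.norm_exp_ofReal_mul_I]

theorem integrable_pow_mul_exp {Z : Ω → ℝ} (hZ : Measurable Z) {m : ℕ}
    (hi : Integrable (fun ω => Z ω ^ m) P) (u : ℝ) :
    Integrable (fun ω => (Z ω : ℂ) ^ m * Complex.exp (u * Z ω * Complex.I)) P := by
  refine hi.norm.mono' (((Complex.measurable_ofReal.comp hZ).pow_const m).mul
    ((measurable_exp u).comp hZ)).aestronglyMeasurable (ae_of_all _ fun ω => ?_)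
  rw [norm_mul, ← Complex.ofReal_mul, Complex.norm_exp_ofReal_mul_I, mul_one, norm_pow, norm_pow,
    Complex.norm_real]

theorem integral_add_two_mul_add {f g h : Ω → ℂ} (hf : Integrable f P) (hg : Integrable g P)
    (hh : Integrable h P) :
    ∫ ω, (f ω + 2 * g ω + h ω) ∂P = (∫ ω, f ω ∂P) + 2 * (∫ ω, g ω ∂P) + ∫ ω, h ω ∂P := by
  have hfg : Integrable (fun ω => f ω + 2 * g ω) P := hf.add (hg.const_mul 2)
  rw [integral_add hfg hh, integral_add hf (hg.const_mul 2), integral_const_mul]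

theorem integral_ofReal_ε₁ (hε0 : ∫ ω, ε₁ ω ∂P = 0) : ∫ ω, (ε₁ ω : ℂ) ∂P = 0 := by
  rw [integral_complex_ofReal, hε0, Complex.ofReal_zero]

/-- After splitting `Y₁ = X + ε₁`, the part with `ε₁` factorises by independence and vanishes by
centring, so `∂₁ψ(0,u) = φ_X'(u) φ_ε(u)`. -/
theorem integral_fst_mul_exp (hM : Model P P' X ε₁ ε₂ Y) (hX2 : MemLp X 2 P)
    (hε2 : MemLp ε₁ 2 P) (hε0 : ∫ ω, ε₁ ω ∂P = 0) (u : ℝ) :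
    ∫ ω, Complex.I * ((X ω + ε₁ ω : ℝ) : ℂ) * Complex.exp (u * (X ω + ε₂ ω : ℝ) * Complex.I) ∂P =
      deriv (phi P X) u * phi P ε₁ u := by
  have iX := hX2.integrable (by norm_num)
  have iε := hε2.integrable (by norm_num)
  have mE := measurable_exp u
  have m1 : Measurable fun x : ℝ => (x : ℂ) * Complex.exp (u * x * Complex.I) := by fun_prop
  have e : ∀ ω, Complex.I * ((X ω + ε₁ ω : ℝ) : ℂ) *
      Complex.exp (u * (X ω + ε₂ ω : ℝ) * Complex.I) =
      Complex.I * (((X ω : ℂ) * Complex.exp (u * X ω * Complex.I) * 1 *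
        Complex.exp (u * ε₂ ω * Complex.I)) +
      Complex.exp (u * X ω * Complex.I) * (ε₁ ω : ℂ) * Complex.exp (u * ε₂ ω * Complex.I)) := by
    intro ω
    rw [show (u * ((X ω + ε₂ ω : ℝ) : ℂ) * Complex.I) =
      u * X ω * Complex.I + u * ε₂ ω * Complex.I by push_cast; ring, Complex.exp_add]
    push_cast; ring
  simp_rw [e]
  rw [integral_const_mul, integral_add
    (hM.integrable_mul_mul (b := fun _ => 1) m1 measurable_const mE
      (by simpa using integrable_pow_mul_exp hM.measurable_X (m := 1) (by simpa using iX) u)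
      (integrable_const _) (integrable_exp hM.measurable_ε₂ u))
    (hM.integrable_mul_mul mE Complex.measurable_ofReal mE (integrable_exp hM.measurable_X u)
      iε.ofReal (integrable_exp hM.measurable_ε₂ u)),
    hM.integral_mul_mul (a := fun x => (x : ℂ) * Complex.exp (u * x * Complex.I))
      (b := fun _ => 1) (c := fun x => Complex.exp (u * x * Complex.I)) m1 measurable_const mE,
    hM.integral_mul_mul (a := fun x => Complex.exp (u * x * Complex.I))
      (b := fun x => (x : ℂ)) (c := fun x => Complex.exp (u * x * Complex.I)) mE
      Complex.measurable_ofReal mE, integral_ofReal_ε₁ hε0,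
    deriv_phi hM.measurable_X iX, ← hM.phi_ε₂, phi_eq_integral hM.measurable_ε₂]
  simp [mul_assoc]

/-- This is the function `k` governing the variance of the numerator. Centring removes the cross
term; the two survivors give the two `L¹` norms in `G`. -/
theorem integral_fst_sq_mul_exp (hM : Model P P' X ε₁ ε₂ Y) (hX2 : MemLp X 2 P)
    (hε2 : MemLp ε₁ 2 P) (hε0 : ∫ ω, ε₁ ω ∂P = 0) (u : ℝ) :
    ∫ ω, ((X ω + ε₁ ω : ℝ) : ℂ) ^ 2 * Complex.exp (u * (X ω + ε₂ ω : ℝ) * Complex.I) ∂P =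
      -(deriv (deriv (phi P X)) u * phi P ε₁ u) +
        ((∫ ω, ε₁ ω ^ 2 ∂P : ℝ) : ℂ) * (phi P X u * phi P ε₁ u) := by
  have iX := hX2.integrable (by norm_num)
  have iε := hε2.integrable (by norm_num)
  have mE := measurable_exp u
  have m1 : Measurable fun x : ℝ => (x : ℂ) * Complex.exp (u * x * Complex.I) := by fun_prop
  have m2 : Measurable fun x : ℝ => (x : ℂ) ^ 2 * Complex.exp (u * x * Complex.I) := by fun_prop
  have mS : Measurable fun x : ℝ => (x : ℂ) ^ 2 := by fun_prop
  have e : ∀ ω, ((X ω + ε₁ ω : ℝ) : ℂ) ^ 2 *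
      Complex.exp (u * (X ω + ε₂ ω : ℝ) * Complex.I) =
      (((X ω : ℂ) ^ 2 * Complex.exp (u * X ω * Complex.I) * 1 *
        Complex.exp (u * ε₂ ω * Complex.I)) +
      2 * ((X ω : ℂ) * Complex.exp (u * X ω * Complex.I) * (ε₁ ω : ℂ) *
        Complex.exp (u * ε₂ ω * Complex.I))) +
      Complex.exp (u * X ω * Complex.I) * (ε₁ ω : ℂ) ^ 2 * Complex.exp (u * ε₂ ω * Complex.I) := by
    intro ω
    rw [show (u * ((X ω + ε₂ ω : ℝ) : ℂ) * Complex.I) =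
      u * X ω * Complex.I + u * ε₂ ω * Complex.I by push_cast; ring, Complex.exp_add]
    push_cast; ring
  simp_rw [e]
  have iXe : Integrable (fun ω => (X ω : ℂ) * Complex.exp (u * X ω * Complex.I)) P := by
    simpa using integrable_pow_mul_exp hM.measurable_X (m := 1) (by simpa using iX) u
  have iE2 := integrable_exp (P := P) hM.measurable_ε₂ u
  have iε2 : Integrable (fun ω => (ε₁ ω : ℂ) ^ 2) P := by
    have := hε2.integrable_sq.ofReal (𝕜 := ℂ)
    simpa using this
  have i1 := hM.integrable_mul_mul (b := fun _ => 1) m2 measurable_const mE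
      (integrable_pow_mul_exp hM.measurable_X hX2.integrable_sq u)
      (integrable_const _) iE2
  have i2 := hM.integrable_mul_mul m1 Complex.measurable_ofReal mE iXe iε.ofReal iE2
  have i3 := hM.integrable_mul_mul mE mS mE (integrable_exp hM.measurable_X u) iε2 iE2
  rw [integral_add_two_mul_add i1 i2 i3,
    hM.integral_mul_mul (a := fun x => (x : ℂ) ^ 2 * Complex.exp (u * x * Complex.I))
      (b := fun _ => 1) (c := fun x => Complex.exp (u * x * Complex.I)) m2 measurable_const mE,
    hM.integral_mul_mul (a := fun x => (x : ℂ) * Complex.exp (u * x * Complex.I))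
      (b := fun x => (x : ℂ)) (c := fun x => Complex.exp (u * x * Complex.I)) m1
      Complex.measurable_ofReal mE,
    hM.integral_mul_mul (a := fun x => Complex.exp (u * x * Complex.I))
      (b := fun x => (x : ℂ) ^ 2) (c := fun x => Complex.exp (u * x * Complex.I)) mE
      mS mE, integral_ofReal_ε₁ hε0,
    deriv_deriv_phi hM.measurable_X hX2, ← hM.phi_ε₂, phi_eq_integral hM.measurable_ε₂,
    phi_eq_integral hM.measurable_X, ← integral_complex_ofReal]
  simp only [Complex.ofReal_pow]
  simp
  ring

theorem psi_eq (hM : Model P P' X ε₁ ε₂ Y) (s x : ℝ) :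
    psi P (X + ε₁) (X + ε₂) s x = phi P X (s + x) * phi P ε₁ s * phi P ε₁ x := by
  have e : ∀ ω, Complex.exp (Complex.I * ((s * (X + ε₁) ω + x * (X + ε₂) ω : ℝ) : ℂ)) =
      Complex.exp (((s + x : ℝ) : ℂ) * X ω * Complex.I) * Complex.exp (s * ε₁ ω * Complex.I) *
        Complex.exp (x * ε₂ ω * Complex.I) := by
    intro ω
    rw [← Complex.exp_add, ← Complex.exp_add]
    congr 1
    simp only [Pi.add_apply]; push_cast; ring
  simp_rw [psi, e]
  rw [hM.integral_mul_mul (measurable_exp (s + x)) (measurable_exp s) (measurable_exp x),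
    ← phi_eq_integral hM.measurable_X, ← phi_eq_integral hM.measurable_ε₁,
    ← phi_eq_integral hM.measurable_ε₂, hM.phi_ε₂]

/-- Centring gives `φ_ε'(0) = 0`, so only the factor in `X` is differentiated, and `φ_ε(x)` cancels.
This is the identification of `φ_X` behind the estimator. -/
theorem logDeriv_psi (hM : Model P P' X ε₁ ε₂ Y) (hX2 : MemLp X 2 P)
    (hε2 : MemLp ε₁ 2 P) (hε0 : ∫ ω, ε₁ ω ∂P = 0) (h0 : ∀ u, phi P ε₁ u ≠ 0) (x : ℝ) :
    logDeriv (fun s : ℝ => psi P (X + ε₁) (X + ε₂) s x) 0 = deriv (phi P X) x / phi P X x := by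
  have iε := hε2.integrable (by norm_num)
  have dX : HasDerivAt (fun s => phi P X (s + x)) (deriv (phi P X) x) 0 := by
    have : HasDerivAt (phi P X) (deriv (phi P X) (0 + x)) (0 + x) :=
      ((contDiff_phi hM.measurable_X hX2).differentiable (by norm_num) _).hasDerivAt
    have := this.comp_add_const 0 x
    rwa [zero_add] at this
  have dε : HasDerivAt (phi P ε₁) 0 0 := by
    have h1 := ((contDiff_phi hM.measurable_ε₁ hε2).differentiable (by norm_num) 0).hasDerivAt
    rw [deriv_phi hM.measurable_ε₁ iε] at h1
    simpa [integral_ofReal_ε₁ hε0] using h1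
  have := ((dX.mul dε).mul_const (phi P ε₁ x)).deriv
  rw [logDeriv_apply]
  simp_rw [hM.psi_eq]
  simp only [Pi.mul_apply] at this
  rw [this]
  simp only [phi_zero hM.measurable_ε₁, zero_add, mul_one, mul_zero, add_zero]
  rw [mul_div_mul_right _ _ (h0 x)]

end RepeatedMeasurements.Model

end Model

/-! ### Deterministic perturbation bounds -/

section Deterministic

/-- Perturbation bound for the inverse of the regularised empirical characteristic function. -/
theorem norm_inv_regularised_sub_inv_le {N : ℝ} (hN : 0 < N) {z w : ℂ} (hw : w ≠ 0) :
    ‖1 / (z / ((min (N * ‖z‖) 1 : ℝ) : ℂ)) - 1 / w‖ ≤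
      4 * (1 + N ^ 2 * ‖z - w‖ ^ 2) * N⁻¹ * (‖w‖ ^ 2)⁻¹ := by
  have hw0 : 0 < ‖w‖ := norm_pos_iff.2 hw
  -- `D` bounds the distance from the regularised value to `w`: the error of `z` plus the
  -- displacement, at most `1/N`, caused by the regularisation.
  set D := ‖z - w‖ + N⁻¹ with hD
  have hNi : 0 < N⁻¹ := inv_pos.2 hN
  have hD0 : 0 < D := by positivity
  have hfin : D * (1 + N * D) ≤ 4 * (1 + N ^ 2 * ‖z - w‖ ^ 2) * N⁻¹ := by
    have e : D = (N * ‖z - w‖ + 1) * N⁻¹ := by rw [hD]; field_simp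
    have e2 : N * D = N * ‖z - w‖ + 1 := by rw [hD]; field_simp
    rw [e2, e]
    have := norm_nonneg (z - w)
    -- With `a = N‖z - w‖` this is `(a + 1)(a + 2) ≤ 4(1 + a²)`.
    have hq : (N * ‖z - w‖ + 1) * (1 + (N * ‖z - w‖ + 1)) ≤ 4 * (1 + N ^ 2 * ‖z - w‖ ^ 2) := by
      nlinarith [sq_nonneg (N * ‖z - w‖ - 1)]
    nlinarith
  suffices h : ‖1 / (z / ((min (N * ‖z‖) 1 : ℝ) : ℂ)) - 1 / w‖ ≤ D * (1 + N * D) * (‖w‖ ^ 2)⁻¹ from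
    h.trans (by gcongr)
  -- At `z = 0` the inverse is `0` by the convention for division by zero; the error is `1/‖w‖`, and
  -- `‖w‖ ≤ D`.
  rcases eq_or_ne z 0 with rfl | hz
  · have hDw : ‖w‖ ≤ D := by rw [hD]; simp [hNi.le]
    simp only [zero_div, div_zero, zero_sub, norm_neg, norm_div, norm_one]
    rw [one_div, ← div_eq_mul_inv, le_div_iff₀ (by positivity), sq, inv_mul_cancel_left₀ hw0.ne']
    nlinarith [mul_pos hN hD0]
  set zt := z / ((min (N * ‖z‖) 1 : ℝ) : ℂ) with hzt
  have hz0 : 0 < ‖z‖ := norm_pos_iff.2 hz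
  have key : N⁻¹ ≤ ‖zt‖ ∧ ‖zt - w‖ ≤ D := by
    rcases le_total (N * ‖z‖) 1 with h | h
    · rw [min_eq_left h] at hzt
      have e1 : ‖zt‖ = N⁻¹ := by
        rw [hzt, norm_div, Complex.norm_real, Real.norm_of_nonneg (by positivity)]
        field_simp
      refine ⟨e1.ge, ?_⟩
      have e2 : zt - z = (((N * ‖z‖)⁻¹ - 1 : ℝ) : ℂ) * z := by
        rw [hzt]; push_cast; ring
      have h1 : 1 ≤ (N * ‖z‖)⁻¹ := (one_le_inv₀ (by positivity)).2 h
      have e3 : ‖zt - z‖ ≤ N⁻¹ := by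
        rw [e2, norm_mul, Complex.norm_real, Real.norm_of_nonneg (by linarith)]
        calc ((N * ‖z‖)⁻¹ - 1) * ‖z‖ = N⁻¹ - ‖z‖ := by field_simp
          _ ≤ N⁻¹ := by linarith
      calc ‖zt - w‖ = ‖(zt - z) + (z - w)‖ := by ring_nf
        _ ≤ ‖zt - z‖ + ‖z - w‖ := norm_add_le _ _
        _ ≤ D := by rw [hD]; linarith
    · rw [min_eq_right h, Complex.ofReal_one, div_one] at hzt
      rw [hzt]
      refine ⟨?_, by rw [hD]; linarith⟩
      rw [inv_le_iff_one_le_mul₀ hN]; linarith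
  obtain ⟨k1, k2⟩ := key
  have hzt0 : 0 < ‖zt‖ := hNi.trans_le k1
  have hztne : zt ≠ 0 := norm_pos_iff.1 hzt0
  have e : ‖1 / zt - 1 / w‖ = ‖zt - w‖ * (‖zt‖⁻¹ * ‖w‖⁻¹) := by
    rw [div_sub_div _ _ hztne hw, norm_div, norm_mul, one_mul, mul_one, norm_sub_rev,
      div_eq_mul_inv, mul_inv]
  have hinv : ‖zt‖⁻¹ ≤ N := inv_le_of_inv_le₀ hN k1
  -- From `‖w‖ ≤ ‖zt‖ + D` and `‖zt‖⁻¹ ≤ N`: the random inverse is traded for the deterministic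
  -- `‖w‖⁻¹`.
  have h3 : ‖zt‖⁻¹ ≤ ‖w‖⁻¹ * (1 + N * D) := by
    have h4 : ‖w‖ ≤ ‖zt‖ + D := by
      calc ‖w‖ = ‖zt - (zt - w)‖ := by ring_nf
        _ ≤ ‖zt‖ + ‖zt - w‖ := norm_sub_le _ _
        _ ≤ _ := by linarith
    calc ‖zt‖⁻¹ = ‖w‖⁻¹ * (‖w‖ * ‖zt‖⁻¹) := by field_simp
      _ ≤ ‖w‖⁻¹ * ((‖zt‖ + D) * ‖zt‖⁻¹) := by gcongr
      _ = ‖w‖⁻¹ * (1 + ‖zt‖⁻¹ * D) := by field_simp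
      _ ≤ ‖w‖⁻¹ * (1 + N * D) := by gcongr
  rw [e]
  calc ‖zt - w‖ * (‖zt‖⁻¹ * ‖w‖⁻¹) ≤ D * ((‖w‖⁻¹ * (1 + N * D)) * ‖w‖⁻¹) := by gcongr
    _ = _ := by rw [sq, mul_inv]; ring

/-- Radial projection to the unit disc moves `z` by `‖z‖ - 1 ≤ ‖z‖ - ‖w‖ ≤ ‖z - w‖` when `‖z‖ ≥ 1`,
and not at all otherwise. -/
theorem norm_truncate_sub_le {z w : ℂ} (hw : ‖w‖ ≤ 1) :
    ‖z / ((max 1 ‖z‖ : ℝ) : ℂ) - w‖ ≤ 2 * ‖z - w‖ := by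
  rcases le_total ‖z‖ 1 with h | h
  · rw [max_eq_left h, Complex.ofReal_one, div_one]
    linarith [norm_nonneg (z - w)]
  · rw [max_eq_right h]
    have hz : (0 : ℝ) < ‖z‖ := by linarith
    have e : z / ((‖z‖ : ℝ) : ℂ) - z = ((‖z‖⁻¹ - 1 : ℝ) : ℂ) * z := by push_cast; ring
    have h1 : ‖z / ((‖z‖ : ℝ) : ℂ) - z‖ = ‖z‖ - 1 := by
      rw [e, norm_mul, Complex.norm_real, Real.norm_of_nonpos (by
        linarith [inv_le_one_of_one_le₀ h])]
      field_simp
      ring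
    calc ‖z / ((‖z‖ : ℝ) : ℂ) - w‖ = ‖(z / ((‖z‖ : ℝ) : ℂ) - z) + (z - w)‖ := by ring_nf
      _ ≤ (‖z‖ - 1) + ‖z - w‖ := by rw [← h1]; exact norm_add_le _ _
      _ ≤ _ := by linarith [norm_sub_norm_le z w]

theorem norm_truncate_le_one (z : ℂ) : ‖z / ((max 1 ‖z‖ : ℝ) : ℂ)‖ ≤ 1 := by
  have h : (0 : ℝ) < max 1 ‖z‖ := by positivity
  rw [norm_div, Complex.norm_real, Real.norm_of_nonneg h.le, div_le_one h]
  exact le_max_right _ _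

/-- The error of a truncated exponential estimator in terms of three summands of the error of its
logarithm. -/
theorem norm_truncate_exp_sub_sq_le {w T₁ T₂ T₃ : ℂ} (hw : ‖w‖ ≤ 1) (p : ℕ) {z : ℂ}
    (hz : z = w * Complex.exp (T₁ + T₂ + T₃)) :
    ‖z / ((max 1 ‖z‖ : ℝ) : ℂ) - w‖ ^ 2 ≤
      (48 + 4 * 9 ^ p) * (‖w‖ ^ 2 * (‖T₁‖ ^ 2 + ‖T₂‖ ^ 2 + ‖T₃‖)) +
      (48 + 4 * 9 ^ p) * (‖T₁‖ ^ (2 * p) + ‖T₂‖ ^ (2 * p) + ‖T₃‖ ^ p) := by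
  have hpow : ∀ {a : ℝ} (m : ℕ), 1 / 3 < a → 1 ≤ (3 * a) ^ m := fun m h =>
    one_le_pow₀ (by linarith)
  have n1 := norm_nonneg T₁
  have n2 := norm_nonneg T₂
  have n3 := norm_nonneg T₃
  have p1 : 0 ≤ ‖T₁‖ ^ (2 * p) := by positivity
  have p2 : 0 ≤ ‖T₂‖ ^ (2 * p) := by positivity
  have p3 : 0 ≤ ‖T₃‖ ^ p := by positivity
  have p9 : (1 : ℝ) ≤ 9 ^ p := one_le_pow₀ (by norm_num)
  have p39 : (3 : ℝ) ^ p ≤ 9 ^ p := by gcongr; norm_num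
  -- With thirds the sum stays in the unit disc, where `‖exp x - 1‖ ≤ 2‖x‖`. Truncation gives
  -- another factor `2`, and `(2 · 2)² · 3 = 48`. In the other case the squared error is at most
  -- `4`, while some `3‖Tᵢ‖` exceeds `1`; this gives `4 · 9^p`.
  by_cases h : ‖T₁‖ ≤ 1 / 3 ∧ ‖T₂‖ ≤ 1 / 3 ∧ ‖T₃‖ ≤ 1 / 3
  · obtain ⟨h1, h2, h3⟩ := h
    have hT : ‖T₁ + T₂ + T₃‖ ≤ ‖T₁‖ + ‖T₂‖ + ‖T₃‖ := norm_add₃_le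
    have hE := Complex.norm_exp_sub_one_le (x := T₁ + T₂ + T₃) (by linarith)
    have hzw : ‖z - w‖ ≤ ‖w‖ * (2 * (‖T₁‖ + ‖T₂‖ + ‖T₃‖)) := by
      rw [hz, show w * Complex.exp (T₁ + T₂ + T₃) - w = w * (Complex.exp (T₁ + T₂ + T₃) - 1) by ring,
        norm_mul]
      gcongr
      linarith
    have h4 := (norm_truncate_sub_le (z := z) hw).trans (mul_le_mul_of_nonneg_left hzw zero_le_two)
    have h5 : ‖z / ((max 1 ‖z‖ : ℝ) : ℂ) - w‖ ^ 2 ≤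
        (2 * (‖w‖ * (2 * (‖T₁‖ + ‖T₂‖ + ‖T₃‖)))) ^ 2 := by gcongr
    -- Here `‖T₃‖² ≤ ‖T₃‖`, as `‖T₃‖ ≤ 1/3`. The first power suffices because `T₃` is already a
    -- product of two errors.
    have h6 : (‖T₁‖ + ‖T₂‖ + ‖T₃‖) ^ 2 ≤ 3 * (‖T₁‖ ^ 2 + ‖T₂‖ ^ 2 + ‖T₃‖) := by
      nlinarith [sq_nonneg (‖T₁‖ - ‖T₂‖), sq_nonneg (‖T₁‖ - ‖T₃‖), sq_nonneg (‖T₂‖ - ‖T₃‖)]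
    have h7 : (2 * (‖w‖ * (2 * (‖T₁‖ + ‖T₂‖ + ‖T₃‖)))) ^ 2 ≤
        48 * (‖w‖ ^ 2 * (‖T₁‖ ^ 2 + ‖T₂‖ ^ 2 + ‖T₃‖)) := by
      nlinarith [mul_le_mul_of_nonneg_left h6 (sq_nonneg ‖w‖)]
    have h8 : 0 ≤ 4 * 9 ^ p * (‖w‖ ^ 2 * (‖T₁‖ ^ 2 + ‖T₂‖ ^ 2 + ‖T₃‖)) := by positivity
    have h9 : 0 ≤ (48 + 4 * 9 ^ p) * (‖T₁‖ ^ (2 * p) + ‖T₂‖ ^ (2 * p) + ‖T₃‖ ^ p) := by positivity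
    linarith
  · have h4 : ‖z / ((max 1 ‖z‖ : ℝ) : ℂ) - w‖ ^ 2 ≤ 4 := by
      have := (norm_sub_le (z / ((max 1 ‖z‖ : ℝ) : ℂ)) w).trans
        (add_le_add (norm_truncate_le_one z) hw)
      nlinarith [norm_nonneg (z / ((max 1 ‖z‖ : ℝ) : ℂ) - w)]
    have h5 : 0 ≤ (48 + 4 * 9 ^ p) * (‖w‖ ^ 2 * (‖T₁‖ ^ 2 + ‖T₂‖ ^ 2 + ‖T₃‖)) := by positivity
    have e9 : ∀ a : ℝ, (3 * a) ^ (2 * p) = 9 ^ p * a ^ (2 * p) := fun a => by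
      rw [mul_pow, pow_mul]; norm_num
    have h6 : 1 ≤ 9 ^ p * (‖T₁‖ ^ (2 * p) + ‖T₂‖ ^ (2 * p) + ‖T₃‖ ^ p) := by
      rw [not_and_or, not_and_or, not_le, not_le, not_le] at h
      rcases h with h | h | h
      · have := hpow (2 * p) h
        rw [e9] at this
        nlinarith
      · have := hpow (2 * p) h
        rw [e9] at this
        nlinarith
      · have := hpow p h
        rw [mul_pow] at this
        nlinarith
    have h7 : 0 ≤ ‖T₁‖ ^ (2 * p) + ‖T₂‖ ^ (2 * p) + ‖T₃‖ ^ p := by positivity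
    nlinarith

end Deterministic

/-! ### Symmetry, measurability and boundedness of the estimators -/

section Estimators

variable {n : ℕ}

theorem psiHat_zero (y : Fin n → ℝ × ℝ) (u : ℝ) :
    psiHat y 0 u = 1 / (n : ℂ) * ∑ j, Complex.exp (u * (y j).2 * Complex.I) := by
  simp only [psiHat]
  congr 2; ext j; congr 1; push_cast; ring

theorem dpsiHat_zero (y : Fin n → ℝ × ℝ) (u : ℝ) :
    dpsiHat y 0 u = 1 / (n : ℂ) * ∑ j, Complex.I * ((y j).1 : ℂ) *
      Complex.exp (u * (y j).2 * Complex.I) := by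
  simp only [dpsiHat]
  congr 2; ext j; congr 2; push_cast; ring

theorem exp_neg_mul_eq_conj (u x : ℝ) : Complex.exp (((-u : ℝ) : ℂ) * x * Complex.I) =
    starRingEnd ℂ (Complex.exp (u * x * Complex.I)) := by
  rw [← Complex.exp_conj]; simp

theorem psiHat_neg (y : Fin n → ℝ × ℝ) (u : ℝ) :
    psiHat y 0 (-u) = starRingEnd ℂ (psiHat y 0 u) := by
  simp_rw [psiHat_zero, exp_neg_mul_eq_conj]
  simp

theorem dpsiHat_neg (y : Fin n → ℝ × ℝ) (u : ℝ) :
    dpsiHat y 0 (-u) = -starRingEnd ℂ (dpsiHat y 0 u) := by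
  simp_rw [dpsiHat_zero, exp_neg_mul_eq_conj]
  simp

theorem psiTilde_neg (y : Fin n → ℝ × ℝ) (u : ℝ) :
    psiTilde y (-u) = starRingEnd ℂ (psiTilde y u) := by
  simp [psiTilde, psiHat_neg]

/-- Under `v ↦ -v` the integrand becomes minus its conjugate, which the reversed orientation
compensates. The risk at `u` is thereby reduced to the risk at `|u|`. -/
theorem phiMod_neg (y : Fin n → ℝ × ℝ) (u : ℝ) :
    phiMod y (-u) = starRingEnd ℂ (phiMod y u) := by
  have h1 : ∫ v in (0 : ℝ)..(-u), dpsiHat y 0 v / psiTilde y v =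
      -∫ v in (0 : ℝ)..u, dpsiHat y 0 (-v) / psiTilde y (-v) := by
    have := intervalIntegral.integral_comp_neg (a := 0) (b := u)
      (fun v => dpsiHat y 0 v / psiTilde y v)
    rw [this, neg_zero, intervalIntegral.integral_symm]
  rw [phiMod, phiMod, h1, ← Complex.exp_conj, ← intervalIntegral.integral_neg]
  congr 1
  simp_rw [dpsiHat_neg, psiTilde_neg, neg_div, neg_neg, ← map_div₀]
  simp only [intervalIntegral, map_sub, ← integral_conj]

theorem phiHat_neg (y : Fin n → ℝ × ℝ) (u : ℝ) :
    phiHat y (-u) = starRingEnd ℂ (phiHat y u) := by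
  simp [phiHat, phiMod_neg]

theorem norm_phiHat_le_one (y : Fin n → ℝ × ℝ) (u : ℝ) : ‖phiHat y u‖ ≤ 1 :=
  norm_truncate_le_one _

variable {Ω' : Type*} [MeasurableSpace Ω'] {Y : Fin n → Ω' → ℝ × ℝ}

theorem measurable_psiHat (hY : ∀ j, Measurable (Y j)) :
    Measurable fun z : Ω' × ℝ => psiHat (fun j => Y j z.1) 0 z.2 := by
  simp_rw [psiHat_zero]
  fun_prop

theorem measurable_dpsiHat (hY : ∀ j, Measurable (Y j)) :
    Measurable fun z : Ω' × ℝ => dpsiHat (fun j => Y j z.1) 0 z.2 := by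
  simp_rw [dpsiHat_zero]
  fun_prop

theorem measurable_psiTilde (hY : ∀ j, Measurable (Y j)) :
    Measurable fun z : Ω' × ℝ => psiTilde (fun j => Y j z.1) z.2 := by
  have := measurable_psiHat hY
  simp only [psiTilde]
  fun_prop

/-- The moving endpoint is encoded by indicators of measurable sets of triples, so parametric
integration over the whole line applies. Joint measurability is needed for Tonelli in the sample and
the frequency. -/
theorem measurable_intervalIntegral {α : Type*} [MeasurableSpace α] {f : α × ℝ → ℂ}
    (hf : Measurable f) : Measurable fun z : α × ℝ => ∫ v in (0 : ℝ)..z.2, f (z.1, v) := by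
  have h : ∀ s : Set ((α × ℝ) × ℝ), MeasurableSet s →
      Measurable fun z : α × ℝ => ∫ v, s.indicator (fun w => f (w.1.1, w.2)) (z, v) := fun s hs => by
    have : Measurable (s.indicator fun w : (α × ℝ) × ℝ => f (w.1.1, w.2)) :=
      (hf.comp (by fun_prop)).indicator hs
    exact (this.stronglyMeasurable.integral_prod_right').measurable
  have m1 : MeasurableSet {w : (α × ℝ) × ℝ | w.2 ∈ Set.Ioc 0 w.1.2} :=
    (measurableSet_lt measurable_const measurable_snd).inter
      (measurableSet_le measurable_snd (measurable_snd.comp measurable_fst))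
  have m2 : MeasurableSet {w : (α × ℝ) × ℝ | w.2 ∈ Set.Ioc w.1.2 0} :=
    (measurableSet_lt (measurable_snd.comp measurable_fst) measurable_snd).inter
      (measurableSet_le measurable_snd measurable_const)
  convert (h _ m1).sub (h _ m2) using 2 with z
  rw [intervalIntegral, ← integral_indicator measurableSet_Ioc,
    ← integral_indicator measurableSet_Ioc]
  rfl

theorem measurable_phiHat (hY : ∀ j, Measurable (Y j)) :
    Measurable fun z : Ω' × ℝ => phiHat (fun j => Y j z.1) z.2 := by
  have h := measurable_intervalIntegral ((measurable_dpsiHat hY).div (measurable_psiTilde hY))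
  simp only [phiHat, phiMod]
  simp only [Pi.div_apply] at h
  fun_prop

/-- The point of the regularisation: the inverse stays bounded by `√n`, so the integral in the
exponent converges even near zeros of the empirical characteristic function. -/
theorem norm_inv_psiTilde_le (y : Fin n → ℝ × ℝ) (v : ℝ) :
    ‖1 / psiTilde y v‖ ≤ Real.sqrt n := by
  rcases eq_or_ne (psiHat y 0 v) 0 with h | h
  · simp [psiTilde, h]
  have h0 : 0 < ‖psiHat y 0 v‖ := norm_pos_iff.2 h
  rw [psiTilde, one_div_div, norm_div, Complex.norm_real, Real.norm_of_nonneg (by positivity),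
    div_le_iff₀ h0]
  exact min_le_left _ _

end Estimators

/-! ### Errors of the denominator and of the product -/

section Sample

/-- An independent sample of pairs whose second component has characteristic function `φ`, with
`dφ u = E[i Y₁ exp(iuY₂)]`, `k u = E[Y₁² exp(iuY₂)]` and absolute moments `m q = E|Y₁|^q`. -/
structure IsSample {Ω' : Type*} [MeasurableSpace Ω'] (P' : Measure Ω') {n : ℕ}
    (Y : Fin n → Ω' → ℝ × ℝ) (φ dφ k : ℝ → ℂ) (m : ℕ → ℝ≥0∞) : Prop where
  measurable : ∀ j, Measurable (Y j)
  indep : iIndepFun Y P'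
  memLp : ∀ j, MemLp (fun ω => (Y j ω).1) 2 P'
  continuous_char : Continuous φ
  char_ne_zero : ∀ u, φ u ≠ 0
  continuous_dchar : Continuous dφ
  measurable_k : Measurable k
  char : ∀ j (u : ℝ), ∫ ω, Complex.exp (u * (Y j ω).2 * Complex.I) ∂P' = φ u
  dchar : ∀ j (u : ℝ), ∫ ω, Complex.I * ((Y j ω).1 : ℂ) * Complex.exp (u * (Y j ω).2 * Complex.I) ∂P' =
    dφ u
  kchar : ∀ j (u : ℝ), ∫ ω, ((Y j ω).1 : ℂ) ^ 2 * Complex.exp (u * (Y j ω).2 * Complex.I) ∂P' = k u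
  moment : ∀ j q, ∫⁻ ω, ‖(Y j ω).1‖ₑ ^ q ∂P' = m q

theorem Measurable.section_left {α β γ : Type*} [MeasurableSpace α] [MeasurableSpace β]
    [MeasurableSpace γ] {f : α × β → γ} (hf : Measurable f) (a : α) :
    Measurable fun b => f (a, b) :=
  hf.comp measurable_prodMk_left

theorem Measurable.section_right {α β γ : Type*} [MeasurableSpace α] [MeasurableSpace β]
    [MeasurableSpace γ] {f : α × β → γ} (hf : Measurable f) (b : β) :
    Measurable fun a => f (a, b) :=
  hf.comp measurable_prodMk_right

/-- The inverse squared modulus of a characteristic function. -/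
noncomputable def invSq (φ : ℝ → ℂ) (v : ℝ) : ℝ≥0∞ := (‖φ v‖ₑ ^ 2)⁻¹

/-- The normalised squared fluctuation of the empirical characteristic function. -/
noncomputable def fluctuation (φ : ℝ → ℂ) {n : ℕ} (y : Fin n → ℝ × ℝ) (v : ℝ) : ℝ≥0∞ :=
  4 * (1 + n * ‖psiHat y 0 v - φ v‖ₑ ^ 2)

/-- A bound for the moments of the fluctuation. -/
noncomputable def fluctuationConst (q : ℕ) : ℝ≥0∞ :=
  4 ^ (2 * q) * (2 ^ (2 * q) * (1 + 2 * empiricalConst (2 * q)))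

theorem fluctuationConst_ne_top (q : ℕ) : fluctuationConst q ≠ ∞ := by
  have := empiricalConst_ne_top (2 * q)
  simp only [fluctuationConst]
  finiteness

theorem ENNReal.two_mul_mul_le (a b : ℝ≥0∞) : 2 * (a * b) ≤ a ^ 2 + b ^ 2 := by
  wlog h : a ≤ b generalizing a b
  · rw [mul_comm a, add_comm]; exact this b a (le_of_not_ge h)
  obtain ⟨c, rfl⟩ := le_iff_exists_add.1 h
  calc 2 * (a * (a + c)) ≤ 2 * (a * (a + c)) + c ^ 2 := le_self_add
    _ = _ := by ring

/-- Jensen's inequality for powers, for weighted integrals. -/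
theorem lintegral_mul_pow_le {α : Type*} [MeasurableSpace α] (μ : Measure α) {f w : α → ℝ≥0∞}
    (hf : Measurable f) (hw : Measurable w) {q : ℕ} (hq : 1 ≤ q) :
    (∫⁻ x, f x * w x ∂μ) ^ q ≤ (∫⁻ x, w x ∂μ) ^ (q - 1) * ∫⁻ x, f x ^ q * w x ∂μ := by
  have h := lintegral_pow_le_mul (μ.withDensity w) hf.aemeasurable hq
  rw [lintegral_withDensity_eq_lintegral_mul _ hw hf,
    lintegral_withDensity_eq_lintegral_mul _ hw (hf.pow_const q),
    withDensity_apply _ MeasurableSet.univ, Measure.restrict_univ] at h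
  simpa only [Pi.mul_apply, mul_comm] using h

/-- The Cauchy–Schwarz inequality. -/
theorem lintegral_mul_sq_le {α : Type*} [MeasurableSpace α] (μ : Measure α) {f g : α → ℝ≥0∞}
    (hf : AEMeasurable f μ) (hg : AEMeasurable g μ) :
    (∫⁻ x, f x * g x ∂μ) ^ 2 ≤ (∫⁻ x, f x ^ 2 ∂μ) * ∫⁻ x, g x ^ 2 ∂μ := by
  have h := ENNReal.lintegral_mul_le_Lp_mul_Lq μ Real.HolderConjugate.two_two hf hg
  simp only [Pi.mul_apply, ENNReal.rpow_two] at h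
  calc (∫⁻ x, f x * g x ∂μ) ^ 2
      ≤ ((∫⁻ x, f x ^ 2 ∂μ) ^ (1 / (2 : ℝ)) * (∫⁻ x, g x ^ 2 ∂μ) ^ (1 / (2 : ℝ))) ^ 2 := by gcongr
    _ = _ := by
      rw [mul_pow, ← ENNReal.rpow_two, ← ENNReal.rpow_two, ← ENNReal.rpow_mul, ← ENNReal.rpow_mul]
      norm_num

/-- Moments of a weighted integral of a random function. -/
theorem lintegral_lintegral_mul_pow_le {α β : Type*} [MeasurableSpace α] [MeasurableSpace β]
    (ν : Measure α) [SFinite ν] (μ : Measure β) [SFinite μ] {f : α × β → ℝ≥0∞} {w : β → ℝ≥0∞}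
    (hf : Measurable f) (hw : Measurable w) {q : ℕ} (hq : 1 ≤ q) {c : ℝ≥0∞}
    (hc : ∀ v, ∫⁻ ω, f (ω, v) ^ q ∂ν ≤ c) :
    ∫⁻ ω, (∫⁻ v, f (ω, v) * w v ∂μ) ^ q ∂ν ≤ c * (∫⁻ v, w v ∂μ) ^ q := by
  have hjoint : Measurable fun z : α × β => f z ^ q * w z.2 :=
    (hf.pow_const _).mul (hw.comp measurable_snd)
  have hi : Measurable fun ω => ∫⁻ v, f (ω, v) ^ q * w v ∂μ := hjoint.lintegral_prod_right'
  calc ∫⁻ ω, (∫⁻ v, f (ω, v) * w v ∂μ) ^ q ∂ν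
      -- Jensen spends `q - 1` powers of the total weight; Tonelli and the uniform moment bound
      -- supply the last one.
      ≤ ∫⁻ ω, (∫⁻ v, w v ∂μ) ^ (q - 1) * ∫⁻ v, f (ω, v) ^ q * w v ∂μ ∂ν :=
        lintegral_mono fun ω => lintegral_mul_pow_le μ
          (hf.section_left ω) hw hq
    _ = (∫⁻ v, w v ∂μ) ^ (q - 1) * ∫⁻ v, (∫⁻ ω, f (ω, v) ^ q ∂ν) * w v ∂μ := by
        rw [lintegral_const_mul _ hi,
          lintegral_lintegral_swap (f := fun ω v => f (ω, v) ^ q * w v) hjoint.aemeasurable]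
        congr 1
        refine lintegral_congr fun v => ?_
        exact lintegral_mul_const _ ((hf.section_right v).pow_const _)
    _ ≤ (∫⁻ v, w v ∂μ) ^ (q - 1) * ∫⁻ v, c * w v ∂μ := by
        gcongr
        exact hc _
    _ = c * ((∫⁻ v, w v ∂μ) ^ (q - 1) * ∫⁻ v, w v ∂μ) := by
        rw [lintegral_const_mul _ hw]; ring
    _ = _ := by rw [← pow_succ, Nat.sub_add_cancel hq]

namespace IsSample

variable {Ω' : Type*} [MeasurableSpace Ω'] {P' : Measure Ω'} [IsProbabilityMeasure P'] {n : ℕ}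
  {Y : Fin n → Ω' → ℝ × ℝ} {φ dφ k : ℝ → ℂ} {m : ℕ → ℝ≥0∞}

theorem measurable_invSq (hS : IsSample P' Y φ dφ k m) : Measurable (invSq φ) :=
  (hS.continuous_char.measurable.enorm.pow_const 2).inv

theorem measurable_fst (hS : IsSample P' Y φ dφ k m) (j : Fin n) :
    Measurable fun ω => (Y j ω).1 := (hS.measurable j).fst

theorem measurable_snd (hS : IsSample P' Y φ dφ k m) (j : Fin n) :
    Measurable fun ω => (Y j ω).2 := (hS.measurable j).snd

theorem measurable_fluctuation (hS : IsSample P' Y φ dφ k m) :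
    Measurable fun z : Ω' × ℝ => fluctuation φ (fun j => Y j z.1) z.2 := by
  have h1 := measurable_psiHat hS.measurable
  have h2 := hS.continuous_char.measurable
  exact measurable_const.mul (measurable_const.add (measurable_const.mul
    ((h1.sub (h2.comp _root_.measurable_snd)).enorm.pow_const 2)))

/-- The exponentials have modulus one, so the moment bound of order `4q` applies with `t = 1`, and
its `n^(-2q)` cancels the normalisation. The bound is uniform in `n` and `v`. -/
theorem lintegral_fluctuation_pow_le (hS : IsSample P' Y φ dφ k m) (hn : 1 ≤ n) {q : ℕ}
    (hq : 1 ≤ q) (v : ℝ) :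
    ∫⁻ ω, fluctuation φ (fun j => Y j ω) v ^ (2 * q) ∂P' ≤ fluctuationConst q := by
  have hn0 : (n : ℝ≥0∞) ≠ 0 := by simp; omega
  have hm1 : ∀ j, Measurable fun ω => Complex.exp (v * (Y j ω).2 * Complex.I) := fun j =>
    (Model.measurable_exp v).comp (hS.measurable_snd j)
  have h := lintegral_empirical_pow_le_div (P := P') hn
    (ζ := fun j ω => Complex.exp (v * (Y j ω).2 * Complex.I))
    (hS.indep.comp (fun _ z => Complex.exp (v * z.2 * Complex.I)) fun _ => by fun_prop)
    hm1 (q := 2 * q) (by omega) (fun j => Model.integrable_exp (hS.measurable_snd j) v)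
    (fun j => hS.char j v) (t := 1) (fun j => le_of_eq (by
      have : ∀ ω, ‖Complex.exp (v * (Y j ω).2 * Complex.I)‖ₑ = 1 := fun ω => by
        rw [← ofReal_norm, ← Complex.ofReal_mul, Complex.norm_exp_ofReal_mul_I, ENNReal.ofReal_one]
      simp [this]))
  simp_rw [← psiHat_zero (fun j => Y j _) v] at h
  calc ∫⁻ ω, fluctuation φ (fun j => Y j ω) v ^ (2 * q) ∂P'
      ≤ ∫⁻ ω, 4 ^ (2 * q) * (2 ^ (2 * q) * (1 + (n : ℝ≥0∞) ^ (2 * q) *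
          ‖psiHat (fun j => Y j ω) 0 v - φ v‖ₑ ^ (2 * (2 * q)))) ∂P' := by
        refine lintegral_mono fun ω => ?_
        rw [fluctuation, mul_pow]
        refine mul_le_mul_right ((ENNReal.add_pow_le_mul _ _ _).trans (le_of_eq ?_)) _
        rw [one_pow, mul_pow, ← pow_mul]
    _ = 4 ^ (2 * q) * (2 ^ (2 * q) * (1 + (n : ℝ≥0∞) ^ (2 * q) *
          ∫⁻ ω, ‖psiHat (fun j => Y j ω) 0 v - φ v‖ₑ ^ (2 * (2 * q)) ∂P')) := by
        rw [lintegral_const_mul' _ _ (by finiteness), lintegral_const_mul' _ _ (by finiteness),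
          lintegral_add_left measurable_const, lintegral_const_mul' _ _ (by finiteness)]
        simp
    _ ≤ 4 ^ (2 * q) * (2 ^ (2 * q) * (1 + (n : ℝ≥0∞) ^ (2 * q) *
          (2 * empiricalConst (2 * q) * (1 / (n : ℝ≥0∞) ^ (2 * q))))) := by gcongr
    _ = _ := by
        rw [fluctuationConst, mul_left_comm ((n : ℝ≥0∞) ^ (2 * q)), one_div,
          ENNReal.mul_inv_cancel (by positivity) (by finiteness), mul_one]

theorem lintegral_dpsiHat_sub_pow_le (hS : IsSample P' Y φ dφ k m) (hn : 1 ≤ n) {q : ℕ}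
    (hq : 1 ≤ q) (v : ℝ) :
    ∫⁻ ω, ‖dpsiHat (fun j => Y j ω) 0 v - dφ v‖ₑ ^ (2 * q) ∂P' ≤
      2 * empiricalConst q * (m (2 * q) / n ^ q) := by
  have hm1 : ∀ j, Measurable fun ω => Complex.I * ((Y j ω).1 : ℂ) *
      Complex.exp (v * (Y j ω).2 * Complex.I) := fun j => by
    have := hS.measurable_fst j
    have := hS.measurable_snd j
    fun_prop
  have hnorm : ∀ j ω, ‖Complex.I * ((Y j ω).1 : ℂ) * Complex.exp (v * (Y j ω).2 * Complex.I)‖ =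
      ‖(Y j ω).1‖ := fun j ω => by
    rw [norm_mul, norm_mul, Complex.norm_I, one_mul, Complex.norm_real, ← Complex.ofReal_mul,
      Complex.norm_exp_ofReal_mul_I, mul_one]
  have h := lintegral_empirical_pow_le_div (P := P') hn
    (ζ := fun j ω => Complex.I * ((Y j ω).1 : ℂ) * Complex.exp (v * (Y j ω).2 * Complex.I))
    (hS.indep.comp (fun _ z => Complex.I * (z.1 : ℂ) * Complex.exp (v * z.2 * Complex.I))
      fun _ => by fun_prop)
    hm1 hq (fun j => ((hS.memLp j).integrable (by norm_num)).congr'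
      (hm1 j).aestronglyMeasurable (ae_of_all _ fun ω => (hnorm j ω).symm))
    (fun j => hS.dchar j v) (t := m (2 * q)) (fun j => le_of_eq (by
      rw [← hS.moment j]
      refine lintegral_congr fun ω => ?_
      rw [← ofReal_norm, hnorm, ofReal_norm]))
  simp_rw [dpsiHat_zero]
  exact h

theorem enorm_inv_psiTilde_sub_le (hS : IsSample P' Y φ dφ k m) (hn : 1 ≤ n)
    (y : Fin n → ℝ × ℝ) (v : ℝ) :
    ‖1 / psiTilde y v - 1 / φ v‖ₑ ≤
      fluctuation φ y v * (ENNReal.ofReal (Real.sqrt n))⁻¹ * invSq φ v := by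
  have hN : 0 < Real.sqrt n := Real.sqrt_pos.2 (by exact_mod_cast hn)
  have hw := norm_pos_iff.2 (hS.char_ne_zero v)
  have h := norm_inv_regularised_sub_inv_le hN (z := psiHat y 0 v) (hS.char_ne_zero v)
  rw [← ofReal_norm]
  refine (ENNReal.ofReal_le_ofReal h).trans (le_of_eq ?_)
  rw [Real.sq_sqrt (Nat.cast_nonneg n), ENNReal.ofReal_mul (by positivity),
    ENNReal.ofReal_mul (by positivity), ENNReal.ofReal_mul (by positivity),
    ENNReal.ofReal_add zero_le_one (by positivity), ENNReal.ofReal_mul (by positivity),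
    ENNReal.ofReal_inv_of_pos hN, ENNReal.ofReal_inv_of_pos (by positivity),
    ENNReal.ofReal_pow (norm_nonneg _), ENNReal.ofReal_pow (norm_nonneg _), ofReal_norm,
    ofReal_norm, fluctuation, invSq, ENNReal.ofReal_one, ENNReal.ofReal_natCast]
  simp

theorem ofReal_sqrt_sq (n : ℕ) : ENNReal.ofReal (Real.sqrt n) ^ 2 = n := by
  rw [← ENNReal.ofReal_pow (Real.sqrt_nonneg _), Real.sq_sqrt (Nat.cast_nonneg n),
    ENNReal.ofReal_natCast]

theorem invSq_mul (hS : IsSample P' Y φ dφ k m) (v : ℝ) : ‖φ v‖ₑ ^ 2 * invSq φ v = 1 := by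
  have : ‖φ v‖ₑ ≠ 0 := by simpa using hS.char_ne_zero v
  exact ENNReal.mul_inv_cancel (by positivity) (by finiteness)

/-- Writing `dφ = (dφ / φ) φ` before Cauchy–Schwarz isolates the `L²` norm of the logarithmic
derivative; the spare `|φ|²` cancels one of the two factors `|φ|⁻²`. -/
theorem enorm_denominator_error_sq_le (hS : IsSample P' Y φ dφ k m) (hn : 1 ≤ n) (u : ℝ)
    (ω : Ω') :
    ‖∫ v in Set.Ioc 0 u, dφ v * (1 / psiTilde (fun j => Y j ω) v - 1 / φ v)‖ₑ ^ 2 ≤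
      (∫⁻ v in Set.Ioc 0 u, ‖dφ v / φ v‖ₑ ^ 2) * (n : ℝ≥0∞)⁻¹ *
        ∫⁻ v in Set.Ioc 0 u, fluctuation φ (fun j => Y j ω) v ^ 2 * invSq φ v := by
  have hφm := hS.continuous_char.measurable
  have hdm := hS.continuous_dchar.measurable
  have ha := hS.measurable_invSq
  have hf := hS.measurable_fluctuation.section_left ω
  generalize hr : (ENNReal.ofReal (Real.sqrt n))⁻¹ = r
  have hr2 : r ^ 2 = (n : ℝ≥0∞)⁻¹ := by rw [← hr, ← ENNReal.inv_pow, ofReal_sqrt_sq]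
  have h1 : ‖∫ v in Set.Ioc 0 u, dφ v * (1 / psiTilde (fun j => Y j ω) v - 1 / φ v)‖ₑ ≤
      ∫⁻ v in Set.Ioc 0 u, ‖dφ v / φ v‖ₑ *
        (‖φ v‖ₑ * (fluctuation φ (fun j => Y j ω) v * r * invSq φ v)) := by
    refine (enorm_integral_le_lintegral_enorm _).trans (lintegral_mono fun v => ?_)
    rw [← mul_assoc, ← enorm_mul, div_mul_cancel₀ _ (hS.char_ne_zero v), enorm_mul, ← hr]
    exact mul_le_mul_right (hS.enorm_inv_psiTilde_sub_le hn _ v) _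
  refine (pow_le_pow_left' h1 2).trans ?_
  refine (lintegral_mul_sq_le _ (hdm.div hφm).enorm.aemeasurable
    (hφm.enorm.mul ((hf.mul_const _).mul ha)).aemeasurable).trans ?_
  rw [mul_assoc]
  refine mul_le_mul_right (le_of_eq ?_) _
  rw [← lintegral_const_mul' _ _ (ENNReal.inv_ne_top.2 (Nat.cast_ne_zero.2 (by omega)))]
  refine lintegral_congr fun v => ?_
  calc (‖φ v‖ₑ * (fluctuation φ (fun j => Y j ω) v * r * invSq φ v)) ^ 2
      = r ^ 2 * ((fluctuation φ (fun j => Y j ω) v) ^ 2 * invSq φ v) *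
        (‖φ v‖ₑ ^ 2 * invSq φ v) := by ring
    _ = _ := by rw [hS.invSq_mul, mul_one, hr2]

/-- The contribution of the error of the denominator. -/
theorem lintegral_denominator_error_pow_le (hS : IsSample P' Y φ dφ k m) (hn : 1 ≤ n) {q : ℕ}
    (hq : 1 ≤ q) (u : ℝ) :
    ∫⁻ ω, ‖∫ v in Set.Ioc 0 u, dφ v * (1 / psiTilde (fun j => Y j ω) v - 1 / φ v)‖ₑ ^ (2 * q) ∂P' ≤
      fluctuationConst q * (∫⁻ v in Set.Ioc 0 u, ‖dφ v / φ v‖ₑ ^ 2) ^ q *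
        ((∫⁻ v in Set.Ioc 0 u, invSq φ v) / n) ^ q := by
  have hf := hS.measurable_fluctuation
  have ha := hS.measurable_invSq
  have hmain := lintegral_lintegral_mul_pow_le P' (volume.restrict (Set.Ioc 0 u))
    (hf.pow_const 2) ha hq (c := fluctuationConst q)
    (fun v => by simp_rw [← pow_mul]; exact hS.lintegral_fluctuation_pow_le hn hq v)
  have hi : Measurable fun ω =>
      ∫⁻ v in Set.Ioc 0 u, fluctuation φ (fun j => Y j ω) v ^ 2 * invSq φ v :=
    ((hf.pow_const 2).mul (ha.comp _root_.measurable_snd)).lintegral_prod_right'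
  have hpt := hS.enorm_denominator_error_sq_le hn u
  generalize (∫⁻ v in Set.Ioc 0 u, ‖dφ v / φ v‖ₑ ^ 2) = L at hpt ⊢
  generalize (∫⁻ v in Set.Ioc 0 u, invSq φ v) = A at hmain ⊢
  calc _ ≤ ∫⁻ ω, (L * (n : ℝ≥0∞)⁻¹) ^ q *
        (∫⁻ v in Set.Ioc 0 u, fluctuation φ (fun j => Y j ω) v ^ 2 * invSq φ v) ^ q ∂P' := by
        refine lintegral_mono fun ω => ?_
        rw [pow_mul, ← mul_pow]
        exact pow_le_pow_left' (hpt ω) q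
    _ ≤ (L * (n : ℝ≥0∞)⁻¹) ^ q * (fluctuationConst q * A ^ q) := by
        rw [lintegral_const_mul _ (hi.pow_const q)]
        exact mul_le_mul_right hmain _
    _ = _ := by
        rw [ENNReal.div_eq_inv_mul, mul_pow, mul_pow]
        ring

theorem enorm_mixed_error_le (hS : IsSample P' Y φ dφ k m) (hn : 1 ≤ n) (u : ℝ) (ω : Ω') :
    ‖∫ v in Set.Ioc 0 u, (dpsiHat (fun j => Y j ω) 0 v - dφ v) *
        (1 / psiTilde (fun j => Y j ω) v - 1 / φ v)‖ₑ ≤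
      (ENNReal.ofReal (Real.sqrt n))⁻¹ * ∫⁻ v in Set.Ioc 0 u,
        (‖dpsiHat (fun j => Y j ω) 0 v - dφ v‖ₑ * fluctuation φ (fun j => Y j ω) v) *
          invSq φ v := by
  have hr : (ENNReal.ofReal (Real.sqrt n))⁻¹ ≠ ∞ := by
    have : 0 < Real.sqrt n := Real.sqrt_pos.2 (by exact_mod_cast hn)
    simpa using this
  rw [← lintegral_const_mul' _ _ hr]
  refine (enorm_integral_le_lintegral_enorm _).trans (lintegral_mono fun v => ?_)
  calc ‖(dpsiHat (fun j => Y j ω) 0 v - dφ v) *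
        (1 / psiTilde (fun j => Y j ω) v - 1 / φ v)‖ₑ
      ≤ ‖dpsiHat (fun j => Y j ω) 0 v - dφ v‖ₑ * (fluctuation φ (fun j => Y j ω) v *
        (ENNReal.ofReal (Real.sqrt n))⁻¹ * invSq φ v) := by
        rw [enorm_mul]
        exact mul_le_mul_right (hS.enorm_inv_psiTilde_sub_le hn _ v) _
    _ = _ := by ring

/-- Cauchy–Schwarz over the sample separates numerator and denominator. It is the origin of the
square root of the `2q`-th moment in `G`, and gives `n^(-q/2)`; the other half of `n^(-q)` comes
from the perturbation bound. -/
theorem lintegral_dpsiHat_mul_fluctuation_pow_le (hS : IsSample P' Y φ dφ k m) (hn : 1 ≤ n) {q : ℕ}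
    (hq : 1 ≤ q) (v : ℝ) :
    ∫⁻ ω, (‖dpsiHat (fun j => Y j ω) 0 v - dφ v‖ₑ *
      fluctuation φ (fun j => Y j ω) v) ^ q ∂P' ≤
      (2 * empiricalConst q * fluctuationConst q) ^ (1 / 2 : ℝ) * m (2 * q) ^ (1 / 2 : ℝ) *
        (ENNReal.ofReal (Real.sqrt n))⁻¹ ^ q := by
  have m1 := (((measurable_dpsiHat hS.measurable).section_right v).sub_const (dφ v)).enorm
  have m2 := hS.measurable_fluctuation.section_right v
  have h := lintegral_mul_sq_le P' (m1.pow_const q).aemeasurable (m2.pow_const q).aemeasurable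
  simp_rw [← mul_pow, ← pow_mul, mul_comm q 2] at h
  have h2 := h.trans (mul_le_mul' (hS.lintegral_dpsiHat_sub_pow_le hn hq v)
    (hS.lintegral_fluctuation_pow_le hn hq v))
  generalize hr : (ENNReal.ofReal (Real.sqrt n))⁻¹ = r
  have hr2 : r ^ 2 = (n : ℝ≥0∞)⁻¹ := by rw [← hr, ← ENNReal.inv_pow, ofReal_sqrt_sq]
  have h3 : ∀ {a b : ℝ≥0∞}, a ^ 2 ≤ b → a ≤ b ^ (1 / 2 : ℝ) := fun {a b} hab => by
    rw [one_div, ENNReal.le_rpow_inv_iff (by norm_num), ENNReal.rpow_two]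
    exact hab
  refine (h3 h2).trans (le_of_eq ?_)
  have e : m (2 * q) / n ^ q = m (2 * q) * (r ^ q) ^ 2 := by
    rw [ENNReal.div_eq_inv_mul, ← pow_mul, mul_comm q 2, pow_mul, hr2, ENNReal.inv_pow, mul_comm]
  rw [e, show 2 * empiricalConst q * (m (2 * q) * (r ^ q) ^ 2) * fluctuationConst q =
    (2 * empiricalConst q * fluctuationConst q) * m (2 * q) * (r ^ q) ^ 2 by ring,
    ENNReal.mul_rpow_of_nonneg _ _ (by norm_num), ENNReal.mul_rpow_of_nonneg _ _ (by norm_num),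
    ← ENNReal.rpow_two (r ^ q), ← ENNReal.rpow_mul (r ^ q), mul_one_div_cancel two_ne_zero,
    ENNReal.rpow_one]

/-- The contribution of the product of the errors of numerator and denominator. -/
theorem lintegral_mixed_error_pow_le (hS : IsSample P' Y φ dφ k m) (hn : 1 ≤ n) {q : ℕ}
    (hq : 1 ≤ q) (u : ℝ) :
    ∫⁻ ω, ‖∫ v in Set.Ioc 0 u, (dpsiHat (fun j => Y j ω) 0 v - dφ v) *
        (1 / psiTilde (fun j => Y j ω) v - 1 / φ v)‖ₑ ^ q ∂P' ≤
      (2 * empiricalConst q * fluctuationConst q) ^ (1 / 2 : ℝ) * m (2 * q) ^ (1 / 2 : ℝ) *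
        ((∫⁻ v in Set.Ioc 0 u, invSq φ v) / n) ^ q := by
  have hd : Measurable fun z : Ω' × ℝ => ‖dpsiHat (fun j => Y j z.1) 0 z.2 - dφ z.2‖ₑ :=
    ((measurable_dpsiHat hS.measurable).sub
      (hS.continuous_dchar.measurable.comp _root_.measurable_snd)).enorm
  have ha := hS.measurable_invSq
  have hprod := hd.mul hS.measurable_fluctuation
  have hmain := lintegral_lintegral_mul_pow_le P' (volume.restrict (Set.Ioc 0 u)) hprod ha hq
    (hS.lintegral_dpsiHat_mul_fluctuation_pow_le hn hq)
  have hi : Measurable fun ω => ∫⁻ v in Set.Ioc 0 u,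
      (‖dpsiHat (fun j => Y j ω) 0 v - dφ v‖ₑ * fluctuation φ (fun j => Y j ω) v) * invSq φ v :=
    (hprod.mul (ha.comp _root_.measurable_snd)).lintegral_prod_right'
  have hpt := hS.enorm_mixed_error_le hn u
  generalize hr : (ENNReal.ofReal (Real.sqrt n))⁻¹ = r at hpt hmain
  have hr2 : r ^ 2 = (n : ℝ≥0∞)⁻¹ := by rw [← hr, ← ENNReal.inv_pow, ofReal_sqrt_sq]
  generalize (∫⁻ v in Set.Ioc 0 u, invSq φ v) = A at hmain ⊢
  generalize (2 * empiricalConst q * fluctuationConst q) ^ (1 / 2 : ℝ) *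
    m (2 * q) ^ (1 / 2 : ℝ) = c at hmain ⊢
  calc _ ≤ ∫⁻ ω, r ^ q * (∫⁻ v in Set.Ioc 0 u, (‖dpsiHat (fun j => Y j ω) 0 v - dφ v‖ₑ *
          fluctuation φ (fun j => Y j ω) v) * invSq φ v) ^ q ∂P' := by
        refine lintegral_mono fun ω => ?_
        rw [← mul_pow]
        exact pow_le_pow_left' (hpt ω) q
    _ ≤ r ^ q * (c * r ^ q * A ^ q) := by
        rw [lintegral_const_mul _ (hi.pow_const q)]
        exact mul_le_mul_right hmain _
    _ = _ := by
        rw [ENNReal.div_eq_inv_mul, mul_pow, ← hr2]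
        ring

end IsSample

end Sample

/-! ### Linearised error of the numerator -/

section Numerator

/-- The contribution of one observation to the linearised error of the logarithm. -/
noncomputable def scoreIntegral (φ : ℝ → ℂ) (u : ℝ) (y : ℝ × ℝ) : ℂ :=
  ∫ v in Set.Ioc 0 u, Complex.I * (y.1 : ℂ) * Complex.exp (v * y.2 * Complex.I) * (φ v)⁻¹

theorem measurable_scoreIntegral {φ : ℝ → ℂ} (hφ : Measurable φ) (u : ℝ) :
    Measurable (scoreIntegral φ u) := by
  have : Measurable fun z : (ℝ × ℝ) × ℝ => Complex.I * (z.1.1 : ℂ) *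
      Complex.exp (z.2 * z.1.2 * Complex.I) * (φ z.2)⁻¹ := by fun_prop
  exact (this.stronglyMeasurable.integral_prod_right').measurable

theorem norm_I_mul_mul_exp (a v b : ℝ) :
    ‖Complex.I * (a : ℂ) * Complex.exp (v * b * Complex.I)‖ = ‖a‖ := by
  rw [norm_mul, norm_mul, Complex.norm_I, one_mul, Complex.norm_real, ← Complex.ofReal_mul,
    Complex.norm_exp_ofReal_mul_I, mul_one]

theorem enorm_scoreIntegral_le (φ : ℝ → ℂ) (u : ℝ) (y : ℝ × ℝ) :
    ‖scoreIntegral φ u y‖ₑ ≤ ‖y.1‖ₑ * ∫⁻ v in Set.Ioc 0 u, ‖(φ v)⁻¹‖ₑ := by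
  rw [← lintegral_const_mul' _ _ (by finiteness)]
  refine (enorm_integral_le_lintegral_enorm _).trans (lintegral_mono fun v => ?_)
  rw [enorm_mul, ← ofReal_norm (Complex.I * _ * _), norm_I_mul_mul_exp, ofReal_norm]

/-- A Schur test: `2 g(v) g(w) ≤ g(v)² + g(w)²` decouples the variables, and translation invariance
integrates the kernel out. -/
theorem lintegral_prod_kernel_le (μ : Measure ℝ) [SFinite μ] (hμ : μ ≤ volume) {g k : ℝ → ℝ≥0∞}
    (hg : Measurable g) (hk : Measurable k) :
    ∫⁻ z, g z.1 * g z.2 * k (z.1 - z.2) ∂μ.prod μ ≤ (∫⁻ v, k v) * ∫⁻ v, g v ^ 2 ∂μ := by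
  have hk' : Measurable fun z : ℝ × ℝ => k (z.1 - z.2) := hk.comp (by fun_prop)
  have h1 : ∫⁻ z, g z.1 ^ 2 * k (z.1 - z.2) ∂μ.prod μ ≤ (∫⁻ v, k v) * ∫⁻ v, g v ^ 2 ∂μ := by
    have hm : Measurable fun z : ℝ × ℝ => g z.1 ^ 2 * k (z.1 - z.2) :=
      ((hg.comp measurable_fst).pow_const 2).mul hk'
    rw [lintegral_prod _ hm.aemeasurable,
      ← lintegral_const_mul _ (hg.pow_const 2)]
    refine lintegral_mono fun v => ?_
    dsimp only
    rw [lintegral_const_mul _ (hk'.section_left v), mul_comm]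
    refine mul_le_mul' ?_ le_rfl
    exact (lintegral_mono' hμ le_rfl).trans (lintegral_sub_left_eq_self k v).le
  have h2 : ∫⁻ z, g z.2 ^ 2 * k (z.1 - z.2) ∂μ.prod μ ≤ (∫⁻ v, k v) * ∫⁻ v, g v ^ 2 ∂μ := by
    have hm : Measurable fun z : ℝ × ℝ => g z.2 ^ 2 * k (z.1 - z.2) :=
      ((hg.comp measurable_snd).pow_const 2).mul hk'
    rw [lintegral_prod_symm _ hm.aemeasurable,
      ← lintegral_const_mul _ (hg.pow_const 2)]
    refine lintegral_mono fun v => ?_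
    dsimp only
    rw [lintegral_const_mul _ (hk'.section_right v), mul_comm]
    refine mul_le_mul' ?_ le_rfl
    exact (lintegral_mono' hμ le_rfl).trans (lintegral_sub_right_eq_self k v).le
  have h3 : 2 * ∫⁻ z, g z.1 * g z.2 * k (z.1 - z.2) ∂μ.prod μ ≤
      2 * ((∫⁻ v, k v) * ∫⁻ v, g v ^ 2 ∂μ) := by
    calc 2 * ∫⁻ z, g z.1 * g z.2 * k (z.1 - z.2) ∂μ.prod μ
        = ∫⁻ z, 2 * (g z.1 * g z.2 * k (z.1 - z.2)) ∂μ.prod μ :=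
          (lintegral_const_mul' _ _ (by finiteness)).symm
      _ ≤ ∫⁻ z, (g z.1 ^ 2 * k (z.1 - z.2) + g z.2 ^ 2 * k (z.1 - z.2)) ∂μ.prod μ := by
          refine lintegral_mono fun z => ?_
          rw [← mul_assoc, ← add_mul]
          gcongr
          exact ENNReal.two_mul_mul_le _ _
      _ = (∫⁻ z, g z.1 ^ 2 * k (z.1 - z.2) ∂μ.prod μ) +
          ∫⁻ z, g z.2 ^ 2 * k (z.1 - z.2) ∂μ.prod μ :=
          lintegral_add_left (((hg.comp measurable_fst).pow_const 2).mul hk') _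
      _ ≤ _ := by rw [two_mul]; gcongr
  exact (ENNReal.mul_le_mul_iff_right two_ne_zero (by finiteness)).1 h3

namespace IsSample

variable {Ω' : Type*} [MeasurableSpace Ω'] {P' : Measure Ω'} [IsProbabilityMeasure P'] {n : ℕ}
  {Y : Fin n → Ω' → ℝ × ℝ} {φ dφ k : ℝ → ℂ} {m : ℕ → ℝ≥0∞}

theorem continuous_inv (hS : IsSample P' Y φ dφ k m) : Continuous fun v => (φ v)⁻¹ :=
  hS.continuous_char.inv₀ hS.char_ne_zero

theorem enorm_inv_sq (hS : IsSample P' Y φ dφ k m) (v : ℝ) : ‖(φ v)⁻¹‖ₑ ^ 2 = invSq φ v := by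
  rw [enorm_inv (hS.char_ne_zero v), ← ENNReal.inv_pow, invSq]

/-- Cauchy–Schwarz on an interval of length `u`; this is where the power of `u` in `G` originates.
-/
theorem lintegral_inv_sq_le (hS : IsSample P' Y φ dφ k m) (u : ℝ) :
    (∫⁻ v in Set.Ioc 0 u, ‖(φ v)⁻¹‖ₑ) ^ 2 ≤
      ENNReal.ofReal u * ∫⁻ v in Set.Ioc 0 u, invSq φ v := by
  have h := lintegral_pow_le_mul (volume.restrict (Set.Ioc 0 u))
    (f := fun v => ‖(φ v)⁻¹‖ₑ) hS.continuous_inv.measurable.enorm.aemeasurable one_le_two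
  simp_rw [hS.enorm_inv_sq] at h
  simpa using h

theorem integral_scoreIntegral (hS : IsSample P' Y φ dφ k m) (j : Fin n) (u : ℝ) :
    ∫ ω, scoreIntegral φ u (Y j ω) ∂P' = ∫ v in Set.Ioc 0 u, dφ v * (φ v)⁻¹ := by
  have hYm := hS.measurable j
  have hg : Integrable (fun v => (φ v)⁻¹) (volume.restrict (Set.Ioc 0 u)) :=
    hS.continuous_inv.integrableOn_Ioc
  have hφm := hS.continuous_char.measurable
  have hY : Integrable (fun ω => (((Y j ω).1 : ℝ) : ℂ)) P' :=
    ((hS.memLp j).integrable (by norm_num)).ofReal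
  have hint : Integrable (Function.uncurry fun (ω : Ω') (v : ℝ) => Complex.I * ((Y j ω).1 : ℂ) *
      Complex.exp (v * (Y j ω).2 * Complex.I) * (φ v)⁻¹)
      (P'.prod (volume.restrict (Set.Ioc 0 u))) := by
    refine (hY.mul_prod hg).congr' ?_ (ae_of_all _ fun z => ?_)
    · refine Measurable.aestronglyMeasurable ?_
      simp only [Function.uncurry_def]
      fun_prop
    · simp only [Function.uncurry_def, norm_mul, Complex.norm_real,
        Complex.norm_I, one_mul]
      rw [← Complex.ofReal_mul, Complex.norm_exp_ofReal_mul_I, mul_one]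
  simp only [scoreIntegral]
  rw [integral_integral_swap hint]
  congr 1; ext v
  rw [integral_mul_const, hS.dchar]

theorem memLp_scoreIntegral (hS : IsSample P' Y φ dφ k m) (j : Fin n) (u : ℝ) :
    MemLp (fun ω => scoreIntegral φ u (Y j ω)) 2 P' := by
  have hg : Integrable (fun v => (φ v)⁻¹) (volume.restrict (Set.Ioc 0 u)) :=
    hS.continuous_inv.integrableOn_Ioc
  refine (hS.memLp j).of_le_mul (c := ∫ v in Set.Ioc 0 u, ‖(φ v)⁻¹‖)
    ((measurable_scoreIntegral hS.continuous_char.measurable u).comp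
      (hS.measurable j)).aestronglyMeasurable (ae_of_all _ fun ω => ?_)
  rw [← integral_mul_const]
  refine norm_integral_le_of_norm_le (hg.norm.mul_const _) (ae_of_all _ fun v => ?_)
  rw [norm_mul, norm_I_mul_mul_exp, mul_comm]

/-- Expanding the square as a double integral and taking expectations first turns the product of
exponentials into `k(v - w)`. The Schur test then yields `‖k‖₁`, so the variance carries no factor
`u`. -/
theorem lintegral_scoreIntegral_sq_le (hS : IsSample P' Y φ dφ k m) (j : Fin n) (u : ℝ) :
    ∫⁻ ω, ‖scoreIntegral φ u (Y j ω)‖ₑ ^ 2 ∂P' ≤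
      (∫⁻ v, ‖k v‖ₑ) * ∫⁻ v in Set.Ioc 0 u, invSq φ v := by
  set μ := (volume : Measure ℝ).restrict (Set.Ioc 0 u) with hμ
  have hYm := hS.measurable j
  have hg : Integrable (fun v => (φ v)⁻¹) μ := hS.continuous_inv.integrableOn_Ioc
  have hgm := hS.continuous_inv.measurable
  have hL := hS.memLp_scoreIntegral j u
  let c : ℝ × ℝ → ℂ := fun z => (φ z.1)⁻¹ * starRingEnd ℂ (φ z.2)⁻¹
  have hcm : Measurable c := (hgm.comp _root_.measurable_fst).mul
    (Complex.continuous_conj.measurable.comp (hgm.comp _root_.measurable_snd))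
  have hgc : Integrable (fun v => starRingEnd ℂ (φ v)⁻¹) μ :=
    hg.congr' (Complex.continuous_conj.measurable.comp hgm).aestronglyMeasurable
      (ae_of_all _ fun v => by simp)
  have hc : Integrable c (μ.prod μ) := hg.mul_prod hgc
  have hY2 : Integrable (fun ω => (((Y j ω).1 : ℝ) : ℂ) ^ 2) P' := by
    have := (hS.memLp j).integrable_sq.ofReal (𝕜 := ℂ)
    simpa using this
  have hexp : ∀ (v : ℝ × ℝ) (b : ℝ), ‖Complex.exp (((v.1 - v.2 : ℝ) : ℂ) * b * Complex.I)‖ = 1 :=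
    fun v b => by rw [← Complex.ofReal_mul, Complex.norm_exp_ofReal_mul_I]
  have hint : Integrable (Function.uncurry fun (ω : Ω') (z : ℝ × ℝ) => (((Y j ω).1 : ℝ) : ℂ) ^ 2 *
      Complex.exp (((z.1 - z.2 : ℝ) : ℂ) * (Y j ω).2 * Complex.I) * c z)
      (P'.prod (μ.prod μ)) := by
    refine (hY2.mul_prod hc).congr' ?_ (ae_of_all _ fun z => ?_)
    · refine Measurable.aestronglyMeasurable ?_
      simp only [Function.uncurry_def]
      fun_prop
    · simp only [Function.uncurry_def]
      rw [norm_mul, norm_mul _ (c z.2), norm_mul _ (Complex.exp _), hexp, mul_one]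
  have hsq : ∀ ω, ((‖scoreIntegral φ u (Y j ω)‖ ^ 2 : ℝ) : ℂ) =
      ∫ z, (((Y j ω).1 : ℝ) : ℂ) ^ 2 *
        Complex.exp (((z.1 - z.2 : ℝ) : ℂ) * (Y j ω).2 * Complex.I) * c z ∂μ.prod μ := by
    intro ω
    rw [← Complex.normSq_eq_norm_sq, ← Complex.mul_conj, scoreIntegral, ← integral_conj,
      ← integral_prod_mul]
    congr 1; ext z
    simp only [map_mul, Complex.conj_I, Complex.conj_ofReal, ← Complex.exp_conj, c]
    rw [show (((z.1 - z.2 : ℝ) : ℂ) * (Y j ω).2 * Complex.I) =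
      z.1 * (Y j ω).2 * Complex.I + z.2 * (Y j ω).2 * -Complex.I by push_cast; ring, Complex.exp_add]
    linear_combination (-(((Y j ω).1 : ℂ) ^ 2 * Complex.exp (z.1 * (Y j ω).2 * Complex.I) *
      Complex.exp (z.2 * (Y j ω).2 * -Complex.I) * (φ z.1)⁻¹ * starRingEnd ℂ (φ z.2)⁻¹)) *
      Complex.I_sq
  have hval : ((∫ ω, ‖scoreIntegral φ u (Y j ω)‖ ^ 2 ∂P' : ℝ) : ℂ) =
      ∫ z, k (z.1 - z.2) * c z ∂μ.prod μ := by
    rw [← integral_complex_ofReal]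
    simp_rw [hsq]
    rw [integral_integral_swap hint]
    congr 1; ext z
    rw [integral_mul_const, hS.kchar]
  have hLi : Integrable (fun ω => ‖scoreIntegral φ u (Y j ω)‖ ^ 2) P' :=
    hL.integrable_norm_pow (by norm_num)
  calc ∫⁻ ω, ‖scoreIntegral φ u (Y j ω)‖ₑ ^ 2 ∂P'
      = ENNReal.ofReal (∫ ω, ‖scoreIntegral φ u (Y j ω)‖ ^ 2 ∂P') := by
        rw [ofReal_integral_eq_lintegral_ofReal hLi (ae_of_all _ fun ω => by positivity)]
        simp_rw [ENNReal.ofReal_pow (norm_nonneg _), ofReal_norm]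
    _ = ‖∫ z, k (z.1 - z.2) * c z ∂μ.prod μ‖ₑ := by
        rw [← hval, ← ofReal_norm, Complex.norm_real,
          Real.norm_of_nonneg (integral_nonneg fun ω => by positivity)]
    _ ≤ ∫⁻ z, ‖(φ z.1)⁻¹‖ₑ * ‖(φ z.2)⁻¹‖ₑ * ‖k (z.1 - z.2)‖ₑ ∂μ.prod μ := by
        refine (enorm_integral_le_lintegral_enorm _).trans (lintegral_mono fun z => le_of_eq ?_)
        simp only [c]
        rw [enorm_mul, enorm_mul, mul_comm, ← ofReal_norm (starRingEnd ℂ _), RCLike.norm_conj,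
          ofReal_norm]
    _ ≤ (∫⁻ v, ‖k v‖ₑ) * ∫⁻ v, ‖(φ v)⁻¹‖ₑ ^ 2 ∂μ :=
        lintegral_prod_kernel_le μ Measure.restrict_le_self hgm.enorm hS.measurable_k.enorm
    _ = _ := by simp_rw [hS.enorm_inv_sq]

theorem lintegral_scoreIntegral_pow_le (hS : IsSample P' Y φ dφ k m) (j : Fin n) (u : ℝ) (q : ℕ) :
    ∫⁻ ω, ‖scoreIntegral φ u (Y j ω)‖ₑ ^ (2 * q) ∂P' ≤
      m (2 * q) * (ENNReal.ofReal u * ∫⁻ v in Set.Ioc 0 u, invSq φ v) ^ q := by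
  calc _ ≤ ∫⁻ ω, ‖(Y j ω).1‖ₑ ^ (2 * q) *
        ((∫⁻ v in Set.Ioc 0 u, ‖(φ v)⁻¹‖ₑ) ^ 2) ^ q ∂P' := by
        refine lintegral_mono fun ω => ?_
        rw [← pow_mul, ← mul_pow]
        exact pow_le_pow_left' (enorm_scoreIntegral_le φ u _) _
    _ = m (2 * q) * ((∫⁻ v in Set.Ioc 0 u, ‖(φ v)⁻¹‖ₑ) ^ 2) ^ q := by
        rw [lintegral_mul_const _ ((hS.measurable_fst j).enorm.pow_const _), hS.moment]
    _ ≤ _ := by gcongr; exact hS.lintegral_inv_sq_le u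

theorem integral_dpsiHat_sub_div (hS : IsSample P' Y φ dφ k m) (y : Fin n → ℝ × ℝ) (u : ℝ) :
    ∫ v in Set.Ioc 0 u, (dpsiHat y 0 v - dφ v) * (φ v)⁻¹ =
      1 / (n : ℂ) * ∑ j, scoreIntegral φ u (y j) - ∫ v in Set.Ioc 0 u, dφ v * (φ v)⁻¹ := by
  have hg := hS.continuous_inv
  have hi : ∀ j, Integrable (fun v : ℝ => Complex.I * ((y j).1 : ℂ) *
      Complex.exp (v * (y j).2 * Complex.I) * (φ v)⁻¹) (volume.restrict (Set.Ioc 0 u)) := fun j =>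
    (by fun_prop : Continuous fun v : ℝ => Complex.I * ((y j).1 : ℂ) *
      Complex.exp (v * (y j).2 * Complex.I) * (φ v)⁻¹).integrableOn_Ioc
  have hd : Integrable (fun v => dφ v * (φ v)⁻¹) (volume.restrict (Set.Ioc 0 u)) :=
    (hS.continuous_dchar.mul hg).integrableOn_Ioc
  simp only [scoreIntegral]
  rw [← integral_finsetSum _ fun j _ => hi j, ← integral_const_mul, ← integral_sub
    ((integrable_finsetSum _ fun j _ => hi j).const_mul _) hd]
  congr 1; ext v
  rw [dpsiHat_zero, sub_mul, mul_assoc, Finset.sum_mul]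

/-- The contribution of the linearised error of the numerator. -/
theorem lintegral_numerator_error_pow_le (hS : IsSample P' Y φ dφ k m) (hn : 1 ≤ n) {q : ℕ}
    (hq : 1 ≤ q) (u : ℝ) :
    ∫⁻ ω, ‖∫ v in Set.Ioc 0 u, (dpsiHat (fun j => Y j ω) 0 v - dφ v) * (φ v)⁻¹‖ₑ ^ (2 * q) ∂P' ≤
      2 * empiricalConst q * ((∫⁻ v, ‖k v‖ₑ) ^ q +
        (if 2 ≤ q then m (2 * q) * ENNReal.ofReal u ^ q / (n : ℝ≥0∞) ^ (q - 1) else 0)) *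
        ((∫⁻ v in Set.Ioc 0 u, invSq φ v) / n) ^ q := by
  have hF := measurable_scoreIntegral hS.continuous_char.measurable u
  have hcomp := hS.indep.comp (fun _ => scoreIntegral φ u) (fun _ => hF)
  have hs := fun j => hS.lintegral_scoreIntegral_sq_le j u
  have ht := fun j => hS.lintegral_scoreIntegral_pow_le j u q
  have hi := fun j => (hS.memLp_scoreIntegral j u).integrable one_le_two
  simp_rw [hS.integral_dpsiHat_sub_div]
  generalize (∫⁻ v, ‖k v‖ₑ) = κ at hs ⊢
  generalize (∫⁻ v in Set.Ioc 0 u, invSq φ v) = A at hs ht ⊢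
  have hmain := fun {t : ℝ≥0∞} (h : ∀ j, ∫⁻ ω, ‖scoreIntegral φ u (Y j ω)‖ₑ ^ (2 * q) ∂P' ≤ t) =>
    lintegral_empirical_pow_le (P := P') hn
    (ζ := fun j ω => scoreIntegral φ u (Y j ω)) hcomp
    (fun j => hF.comp (hS.measurable j)) hq hi
    (fun j => hS.integral_scoreIntegral j u) hs h
  have e1 : (κ * A / n) ^ q = κ ^ q * (A / n) ^ q := by rw [mul_div_assoc, mul_pow]
  -- For `q = 1` the variance bound also serves as the bound for the `2q`-th moment, so the crude
  -- term with `u ^ q` is needed only for `q ≥ 2`.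
  rcases hq.eq_or_lt with rfl | hq2
  · have h := hmain (t := κ * A) hs
    refine h.trans (le_of_eq ?_)
    simp only [pow_one, mul_one, show ¬ (2 ≤ 1) by norm_num, if_false, add_zero,
      show 2 - 1 = 1 from rfl, mul_div_assoc]
    ring
  · refine (hmain ht).trans ?_
    rw [if_pos (show 2 ≤ q from hq2), e1]
    have e2 : m (2 * q) * (ENNReal.ofReal u * A) ^ q / (n : ℝ≥0∞) ^ (2 * q - 1) =
        m (2 * q) * ENNReal.ofReal u ^ q / (n : ℝ≥0∞) ^ (q - 1) * (A / n) ^ q := by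
      have hn0 : (n : ℝ≥0∞) ≠ 0 := by simp; omega
      rw [show 2 * q - 1 = (q - 1) + q by omega, pow_add, div_eq_mul_inv, div_eq_mul_inv,
        div_eq_mul_inv, ENNReal.mul_inv (Or.inl (by positivity)) (Or.inl (by finiteness)), mul_pow,
        mul_pow, ENNReal.inv_pow, ENNReal.inv_pow]
      ring
    rw [e2]
    calc _ ≤ 2 * (empiricalConst q * (κ ^ q * (A / n) ^ q +
          m (2 * q) * ENNReal.ofReal u ^ q / (n : ℝ≥0∞) ^ (q - 1) * (A / n) ^ q)) := by
          rw [two_mul (empiricalConst q * _)]; exact le_self_add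
      _ = _ := by ring

end IsSample

end Numerator

/-! ### Mean squared error of the estimated characteristic function -/

section Risk

/-- The constant in the moment bounds for the error of the logarithm. -/
noncomputable def errorConst (q : ℕ) : ℝ≥0∞ :=
  2 * empiricalConst q + fluctuationConst q +
    (2 * empiricalConst q * fluctuationConst q) ^ (1 / 2 : ℝ)

theorem errorConst_ne_top (q : ℕ) : errorConst q ≠ ∞ := by
  have h1 := empiricalConst_ne_top q
  have h2 := fluctuationConst_ne_top q
  simp only [errorConst]
  finiteness

theorem continuous_dpsiHat {n : ℕ} (y : Fin n → ℝ × ℝ) : Continuous fun v => dpsiHat y 0 v := by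
  simp_rw [dpsiHat_zero]
  fun_prop

namespace IsSample

variable {Ω' : Type*} [MeasurableSpace Ω'] {P' : Measure Ω'} [IsProbabilityMeasure P'] {n : ℕ}
  {Y : Fin n → Ω' → ℝ × ℝ} {φ dφ k : ℝ → ℂ} {m : ℕ → ℝ≥0∞}

/-- The three parts of the error of the logarithm of the estimated characteristic function. -/
theorem phiMod_eq (hS : IsSample P' Y φ dφ k m) {u : ℝ} (hu : 0 ≤ u) (ω : Ω') :
    phiMod (fun j => Y j ω) u = Complex.exp (∫ v in (0 : ℝ)..u, dφ v / φ v) * Complex.exp (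
      (∫ v in Set.Ioc 0 u, (dpsiHat (fun j => Y j ω) 0 v - dφ v) * (φ v)⁻¹) +
      (∫ v in Set.Ioc 0 u, dφ v * (1 / psiTilde (fun j => Y j ω) v - 1 / φ v)) +
      (∫ v in Set.Ioc 0 u, (dpsiHat (fun j => Y j ω) 0 v - dφ v) *
        (1 / psiTilde (fun j => Y j ω) v - 1 / φ v))) := by
  set y := fun j => Y j ω with hy
  have hinv := hS.continuous_inv
  have hd := hS.continuous_dchar
  have hdh := continuous_dpsiHat y
  have hψ : Measurable fun v => psiTilde y v := (measurable_psiTilde hS.measurable).section_left ω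
  -- The bound `√n` gives integrability; without it, splitting the integral into the three errors
  -- would not be justified.
  have iT : IntegrableOn (fun v => 1 / psiTilde y v) (Set.Icc 0 u) :=
    (integrable_const (Real.sqrt n)).mono' (hψ.const_div 1).aestronglyMeasurable
      (ae_of_all _ fun v => norm_inv_psiTilde_le y v)
  have iI : IntegrableOn (fun v => 1 / psiTilde y v - 1 / φ v) (Set.Icc 0 u) := by
    refine iT.sub ?_
    simp_rw [one_div]
    exact hinv.integrableOn_Icc
  have i0 : IntegrableOn (fun v => dφ v / φ v) (Set.Ioc 0 u) := by
    simp_rw [div_eq_mul_inv]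
    exact (hd.mul hinv).integrableOn_Ioc
  have i1 : IntegrableOn (fun v => (dpsiHat y 0 v - dφ v) * (φ v)⁻¹) (Set.Ioc 0 u) :=
    ((hdh.sub hd).mul hinv).integrableOn_Ioc
  have i2 : IntegrableOn (fun v => dφ v * (1 / psiTilde y v - 1 / φ v)) (Set.Ioc 0 u) :=
    (iI.continuousOn_mul hd.continuousOn isCompact_Icc).mono_set Set.Ioc_subset_Icc_self
  have i3 : IntegrableOn (fun v => (dpsiHat y 0 v - dφ v) * (1 / psiTilde y v - 1 / φ v))
      (Set.Ioc 0 u) :=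
    (iI.continuousOn_mul (hdh.sub hd).continuousOn isCompact_Icc).mono_set Set.Ioc_subset_Icc_self
  have i12 : IntegrableOn (fun v => (dpsiHat y 0 v - dφ v) * (φ v)⁻¹ +
      dφ v * (1 / psiTilde y v - 1 / φ v)) (Set.Ioc 0 u) := i1.add i2
  have i123 : IntegrableOn (fun v => (dpsiHat y 0 v - dφ v) * (φ v)⁻¹ +
      dφ v * (1 / psiTilde y v - 1 / φ v) +
      (dpsiHat y 0 v - dφ v) * (1 / psiTilde y v - 1 / φ v)) (Set.Ioc 0 u) := i12.add i3
  rw [phiMod, ← Complex.exp_add, intervalIntegral.integral_of_le hu,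
    intervalIntegral.integral_of_le hu, ← integral_add i1 i2, ← integral_add i12 i3,
    ← integral_add i0 i123]
  congr 2; ext v
  ring

/-- The term `G` with an upper bound `κ` in place of its first ingredient. -/
noncomputable def complexity (φ dφ : ℝ → ℂ) (m : ℕ → ℝ≥0∞) (κ : ℝ≥0∞) (n q : ℕ) (u : ℝ) : ℝ≥0∞ :=
  κ ^ q + (∫⁻ v in Set.Icc 0 u, ‖dφ v / φ v‖ₑ ^ 2) ^ q +
    (if 2 ≤ q then m (2 * q) * ENNReal.ofReal u ^ q / (n : ℝ≥0∞) ^ (q - 1) else 0) +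
    m (2 * q) ^ (1 / 2 : ℝ)

theorem complexity_mono (φ dφ : ℝ → ℂ) (m : ℕ → ℝ≥0∞) {κ κ' : ℝ≥0∞} (hκ : κ ≤ κ') (n q : ℕ)
    {u u' : ℝ} (hu : u ≤ u') : complexity φ dφ m κ n q u ≤ complexity φ dφ m κ' n q u' := by
  simp only [complexity]
  gcongr
  split_ifs
  · gcongr
  · exact le_rfl

/-- The numerator uses the first and third summands of `complexity`, the denominator the second and
the product the fourth. `T₃` is taken to the power `q` only, being quadratic in the errors. -/
theorem error_moments_le (hS : IsSample P' Y φ dφ k m) (hn : 1 ≤ n) {q : ℕ} (hq : 1 ≤ q) (u : ℝ) :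
    (∫⁻ ω, ‖∫ v in Set.Ioc 0 u,
        (dpsiHat (fun j => Y j ω) 0 v - dφ v) * (φ v)⁻¹‖ₑ ^ (2 * q) ∂P') +
      (∫⁻ ω, ‖∫ v in Set.Ioc 0 u,
        dφ v * (1 / psiTilde (fun j => Y j ω) v - 1 / φ v)‖ₑ ^ (2 * q) ∂P') +
      (∫⁻ ω, ‖∫ v in Set.Ioc 0 u, (dpsiHat (fun j => Y j ω) 0 v - dφ v) *
        (1 / psiTilde (fun j => Y j ω) v - 1 / φ v)‖ₑ ^ q ∂P') ≤
      errorConst q * complexity φ dφ m (∫⁻ v, ‖k v‖ₑ) n q u *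
        ((∫⁻ v in Set.Icc 0 u, invSq φ v) / n) ^ q := by
  have h1 := hS.lintegral_numerator_error_pow_le hn hq u
  have h2 := hS.lintegral_denominator_error_pow_le hn hq u
  have h3 := hS.lintegral_mixed_error_pow_le hn hq u
  simp only [complexity]
  rw [← Measure.restrict_congr_set (Ioc_ae_eq_Icc (a := (0 : ℝ)) (b := u))]
  refine (add_le_add (add_le_add h1 h2) h3).trans ?_
  generalize (∫⁻ v in Set.Ioc 0 u, ‖dφ v / φ v‖ₑ ^ 2) ^ q = L
  generalize ((∫⁻ v in Set.Ioc 0 u, invSq φ v) / n) ^ q = B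
  generalize (if 2 ≤ q then m (2 * q) * ENNReal.ofReal u ^ q / (n : ℝ≥0∞) ^ (q - 1) else 0) = W
  generalize (∫⁻ v, ‖k v‖ₑ) ^ q = κ
  generalize m (2 * q) ^ (1 / 2 : ℝ) = S
  rw [errorConst]
  generalize 2 * empiricalConst q = a
  generalize fluctuationConst q = b
  generalize (a * b) ^ (1 / 2 : ℝ) = c
  calc a * (κ + W) * B + b * L * B + c * S * B
      ≤ (a * (κ + L + W + S) + b * (κ + L + W + S) + c * (κ + L + W + S)) * B := by
        rw [← add_mul, ← add_mul]
        have hκ : κ + W ≤ κ + L + W + S :=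
          le_add_right (add_le_add_left (le_self_add : κ ≤ κ + L) W)
        have hL : L ≤ κ + L + W + S := le_add_right (le_add_right le_add_self)
        have hS : S ≤ κ + L + W + S := le_add_self
        exact mul_le_mul' (add_le_add (add_le_add (mul_le_mul' le_rfl hκ)
          (mul_le_mul' le_rfl hL)) (mul_le_mul' le_rfl hS)) le_rfl
    _ = _ := by ring

theorem measurable_integral_left (μ : Measure ℝ) [SFinite μ] {f : Ω' × ℝ → ℂ} (hf : Measurable f) :
    Measurable fun ω => ∫ v, f (ω, v) ∂μ :=
  hf.stronglyMeasurable.integral_prod_right'.measurable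

/-- The mean squared error of the estimated characteristic function. -/
theorem lintegral_phiHat_sub_sq_le (hS : IsSample P' Y φ dφ k m) (hn : 1 ≤ n) {p : ℕ} (hp : 1 ≤ p)
    {u : ℝ} (hu : 0 ≤ u) {w : ℂ} (hw : w = Complex.exp (∫ v in (0 : ℝ)..u, dφ v / φ v))
    (hw1 : ‖w‖ ≤ 1) :
    ∫⁻ ω, ‖w - phiHat (fun j => Y j ω) u‖ₑ ^ 2 ∂P' ≤
      (48 + 4 * 9 ^ p) * (‖w‖ₑ ^ 2 * (errorConst 1 * complexity φ dφ m (∫⁻ v, ‖k v‖ₑ) n 1 u *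
        ((∫⁻ v in Set.Icc 0 u, invSq φ v) / n))) +
      (48 + 4 * 9 ^ p) * (errorConst p * complexity φ dφ m (∫⁻ v, ‖k v‖ₑ) n p u *
        ((∫⁻ v in Set.Icc 0 u, invSq φ v) / n) ^ p) := by
  have hb1 := hS.error_moments_le hn le_rfl u
  have hbp := hS.error_moments_le hn hp u
  have hmod := hS.phiMod_eq hu
  have md : Measurable fun z : Ω' × ℝ => dpsiHat (fun j => Y j z.1) 0 z.2 - dφ z.2 :=
    (measurable_dpsiHat hS.measurable).sub
      (hS.continuous_dchar.measurable.comp _root_.measurable_snd)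
  have mi : Measurable fun z : Ω' × ℝ => 1 / psiTilde (fun j => Y j z.1) z.2 - 1 / φ z.2 :=
    ((measurable_psiTilde hS.measurable).const_div 1).sub
      ((hS.continuous_char.measurable.comp _root_.measurable_snd).const_div 1)
  have mφ : Measurable fun z : Ω' × ℝ => (φ z.2)⁻¹ :=
    hS.continuous_inv.measurable.comp _root_.measurable_snd
  have mdφ : Measurable fun z : Ω' × ℝ => dφ z.2 :=
    hS.continuous_dchar.measurable.comp _root_.measurable_snd
  have m1 := measurable_integral_left (volume.restrict (Set.Ioc 0 u)) (md.mul mφ)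
  have m2 := measurable_integral_left (volume.restrict (Set.Ioc 0 u)) (mdφ.mul mi)
  have m3 := measurable_integral_left (volume.restrict (Set.Ioc 0 u)) (md.mul mi)
  simp only [Pi.mul_apply] at m1 m2 m3
  generalize hT1 : (fun ω => ∫ v in Set.Ioc 0 u,
    (dpsiHat (fun j => Y j ω) 0 v - dφ v) * (φ v)⁻¹) = T₁ at m1
  generalize hT2 : (fun ω => ∫ v in Set.Ioc 0 u,
    dφ v * (1 / psiTilde (fun j => Y j ω) v - 1 / φ v)) = T₂ at m2
  generalize hT3 : (fun ω => ∫ v in Set.Ioc 0 u, (dpsiHat (fun j => Y j ω) 0 v - dφ v) *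
    (1 / psiTilde (fun j => Y j ω) v - 1 / φ v)) = T₃ at m3
  have e1 : ∀ ω, _ = T₁ ω := fun ω => congrFun hT1 ω
  have e2 : ∀ ω, _ = T₂ ω := fun ω => congrFun hT2 ω
  have e3 : ∀ ω, _ = T₃ ω := fun ω => congrFun hT3 ω
  simp_rw [e1, e2, e3] at hb1 hbp hmod
  simp only [mul_one, pow_one] at hb1
  have hpt : ∀ ω, ‖w - phiHat (fun j => Y j ω) u‖ₑ ^ 2 ≤
      (48 + 4 * 9 ^ p) * (‖w‖ₑ ^ 2 * (‖T₁ ω‖ₑ ^ 2 + ‖T₂ ω‖ₑ ^ 2 + ‖T₃ ω‖ₑ)) +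
      (48 + 4 * 9 ^ p) * (‖T₁ ω‖ₑ ^ (2 * p) + ‖T₂ ω‖ₑ ^ (2 * p) + ‖T₃ ω‖ₑ ^ p) := by
    intro ω
    have h := norm_truncate_exp_sub_sq_le hw1 p (z := phiMod (fun j => Y j ω) u)
      (by rw [hw]; exact hmod ω)
    rw [← phiHat, norm_sub_rev] at h
    have h' := ENNReal.ofReal_le_ofReal h
    have hc : ENNReal.ofReal (48 + 4 * 9 ^ p) = 48 + 4 * 9 ^ p := by
      rw [ENNReal.ofReal_add (by norm_num) (by positivity), ENNReal.ofReal_mul (by norm_num),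
        ENNReal.ofReal_pow (by norm_num)]
      norm_num
    rw [ENNReal.ofReal_add (by positivity) (by positivity), ENNReal.ofReal_mul (by positivity),
      ENNReal.ofReal_mul (by positivity), ENNReal.ofReal_mul (by positivity), hc,
      ENNReal.ofReal_add (by positivity) (by positivity),
      ENNReal.ofReal_add (by positivity) (by positivity),
      ENNReal.ofReal_add (by positivity) (by positivity),
      ENNReal.ofReal_add (by positivity) (by positivity)] at h'
    simpa only [ENNReal.ofReal_pow (norm_nonneg _), ofReal_norm] using h'
  refine (lintegral_mono hpt).trans ?_
  have n1 : Measurable fun ω => ‖T₁ ω‖ₑ := m1.enorm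
  have n2 : Measurable fun ω => ‖T₂ ω‖ₑ := m2.enorm
  have n3 : Measurable fun ω => ‖T₃ ω‖ₑ := m3.enorm
  have s1 : ∫⁻ ω, (‖T₁ ω‖ₑ ^ 2 + ‖T₂ ω‖ₑ ^ 2 + ‖T₃ ω‖ₑ) ∂P' =
      (∫⁻ ω, ‖T₁ ω‖ₑ ^ 2 ∂P') + (∫⁻ ω, ‖T₂ ω‖ₑ ^ 2 ∂P') + ∫⁻ ω, ‖T₃ ω‖ₑ ∂P' := by
    rw [lintegral_add_right _ n3, lintegral_add_right _ (n2.pow_const 2)]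
  have sp : ∫⁻ ω, (‖T₁ ω‖ₑ ^ (2 * p) + ‖T₂ ω‖ₑ ^ (2 * p) + ‖T₃ ω‖ₑ ^ p) ∂P' =
      (∫⁻ ω, ‖T₁ ω‖ₑ ^ (2 * p) ∂P') + (∫⁻ ω, ‖T₂ ω‖ₑ ^ (2 * p) ∂P') + ∫⁻ ω, ‖T₃ ω‖ₑ ^ p ∂P' := by
    rw [lintegral_add_right _ (n3.pow_const p), lintegral_add_right _ (n2.pow_const _)]
  rw [lintegral_add_right _ (by fun_prop), lintegral_const_mul' _ _ (by finiteness),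
    lintegral_const_mul' _ _ (by finiteness), lintegral_const_mul' _ _ (by finiteness), s1, sp]
  gcongr

end IsSample

end Risk

/-! ### Application to the repeated measurement model -/

namespace RepeatedMeasurements.Model

variable {Ω Ω' : Type*} [MeasurableSpace Ω] [MeasurableSpace Ω'] {P : Measure Ω}
  [IsProbabilityMeasure P] {P' : Measure Ω'} {X ε₁ ε₂ : Ω → ℝ} {n : ℕ} {Y : Fin n → Ω' → ℝ × ℝ}

theorem isSample (hM : Model P P' X ε₁ ε₂ Y) (hX2 : MemLp X 2 P) (hε2 : MemLp ε₁ 2 P)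
    (hε : ∫ ω, ε₁ ω ∂P = 0) (hφX : ∀ u, phi P X u ≠ 0) (hφε : ∀ u, phi P ε₁ u ≠ 0) :
    IsSample P' Y (phi P (X + ε₂)) (fun u => deriv (phi P X) u * phi P ε₁ u)
      (fun u => -(deriv (deriv (phi P X)) u * phi P ε₁ u) +
        ((∫ ω, ε₁ ω ^ 2 ∂P : ℝ) : ℂ) * (phi P X u * phi P ε₁ u))
      (fun q => ∫⁻ ω, ‖X ω + ε₁ ω‖ₑ ^ q ∂P) where
  measurable := hM.measurable_sample
  indep := hM.indep_sample
  memLp j := ((hM.law_sample j).comp (u := Prod.fst) measurable_fst).memLp_iff.2 (hX2.add hε2)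
  continuous_char := continuous_phi (hM.measurable_X.add hM.measurable_ε₂)
  char_ne_zero u := by rw [hM.phi_add]; exact mul_ne_zero (hφX u) (hφε u)
  continuous_dchar := ((contDiff_phi hM.measurable_X hX2).continuous_deriv (by norm_num)).mul
    (continuous_phi hM.measurable_ε₁)
  measurable_k := by
    have h1 := (measurable_deriv (deriv (phi P X)))
    have h2 := (continuous_phi (P := P) hM.measurable_X).measurable
    have h3 := (continuous_phi (P := P) hM.measurable_ε₁).measurable
    exact (h1.mul h3).neg.add ((h2.mul h3).const_mul _)
  char j u := by
    rw [phi_eq_integral (hM.measurable_X.add hM.measurable_ε₂)]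
    exact ((hM.law_sample j).comp (u := fun z : ℝ × ℝ => Complex.exp (u * z.2 * Complex.I))
      (by fun_prop)).integral_eq
  dchar j u := by
    rw [← hM.integral_fst_mul_exp hX2 hε2 hε]
    exact ((hM.law_sample j).comp (u := fun z : ℝ × ℝ =>
      Complex.I * (z.1 : ℂ) * Complex.exp (u * z.2 * Complex.I)) (by fun_prop)).integral_eq
  kchar j u := by
    rw [← hM.integral_fst_sq_mul_exp hX2 hε2 hε]
    exact ((hM.law_sample j).comp (u := fun z : ℝ × ℝ =>
      (z.1 : ℂ) ^ 2 * Complex.exp (u * z.2 * Complex.I)) (by fun_prop)).integral_eq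
  moment j q := ((hM.law_sample j).comp (u := fun z : ℝ × ℝ => ‖z.1‖ₑ ^ q)
      (by fun_prop)).lintegral_eq

theorem lintegral_enorm_kchar_le (hM : Model P P' X ε₁ ε₂ Y) :
    ∫⁻ u, ‖-(deriv (deriv (phi P X)) u * phi P ε₁ u) +
        ((∫ ω, ε₁ ω ^ 2 ∂P : ℝ) : ℂ) * (phi P X u * phi P ε₁ u)‖ₑ ≤
      eLpNorm (fun t => deriv (deriv (phi P X)) t * phi P ε₁ t) 1 volume +
        (∫⁻ ω, ‖ε₁ ω‖ₑ ^ 2 ∂P) * eLpNorm (fun t => phi P X t * phi P ε₁ t) 1 volume := by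
  have h1 := measurable_deriv (deriv (phi P X))
  have h2 := (continuous_phi (P := P) hM.measurable_X).measurable
  have h3 := (continuous_phi (P := P) hM.measurable_ε₁).measurable
  have hv : ‖((∫ ω, ε₁ ω ^ 2 ∂P : ℝ) : ℂ)‖ₑ ≤ ∫⁻ ω, ‖ε₁ ω‖ₑ ^ 2 ∂P := by
    rw [← Complex.ofRealCLM_apply, Complex.ofRealCLM_apply, ← ofReal_norm, Complex.norm_real,
      ofReal_norm]
    refine (enorm_integral_le_lintegral_enorm _).trans_eq ?_
    simp_rw [enorm_pow]
  rw [eLpNorm_one_eq_lintegral_enorm, eLpNorm_one_eq_lintegral_enorm]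
  have hm1 : Measurable fun t => ‖deriv (deriv (phi P X)) t * phi P ε₁ t‖ₑ := (h1.mul h3).enorm
  have hm2 : Measurable fun t => ‖phi P X t * phi P ε₁ t‖ₑ := (h2.mul h3).enorm
  rw [← lintegral_const_mul _ hm2, ← lintegral_add_left hm1]
  refine lintegral_mono fun u => (enorm_add_le _ _).trans ?_
  rw [enorm_neg, enorm_mul (((∫ ω, ε₁ ω ^ 2 ∂P : ℝ) : ℂ))]
  exact add_le_add le_rfl (mul_le_mul' hv le_rfl)

theorem complexity_le (hM : Model P P' X ε₁ ε₂ Y) (hX2 : MemLp X 2 P) (hε2 : MemLp ε₁ 2 P)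
    (hε : ∫ ω, ε₁ ω ∂P = 0) (hφε : ∀ u, phi P ε₁ u ≠ 0) (q : ℕ) {u u' : ℝ} (hu : u ≤ u') :
    IsSample.complexity (phi P (X + ε₂)) (fun u => deriv (phi P X) u * phi P ε₁ u)
      (fun q => ∫⁻ ω, ‖X ω + ε₁ ω‖ₑ ^ q ∂P)
      (∫⁻ u, ‖-(deriv (deriv (phi P X)) u * phi P ε₁ u) +
        ((∫ ω, ε₁ ω ^ 2 ∂P : ℝ) : ℂ) * (phi P X u * phi P ε₁ u)‖ₑ) n q u ≤
      G P X ε₁ ε₂ n q u' := by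
  refine (IsSample.complexity_mono _ _ _
    -- The summand `‖φ_X' φ_ε‖²` of `G` enters only as a nonnegative addition: the variance was
    -- bounded through the uncentred second moment.
    (hM.lintegral_enorm_kchar_le.trans (le_add_of_nonneg_right (b := (eLpNorm (fun t =>
      deriv (phi P X) t * phi P ε₁ t) 2 volume) ^ 2) (by positivity))) n q hu).trans_eq ?_
  simp_rw [IsSample.complexity, G, hM.logDeriv_psi hX2 hε2 hε hφε, hM.phi_add,
    mul_div_mul_right _ _ (hφε _)]

/-- Since `φ_Y = φ_X φ_ε`, quasi-monotonicity bounds `|φ_X(u)|² / |φ_X(z)|²` by `C_X²` for `0 ≤ z ≤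
u`, leaving only `φ_ε`. -/
theorem enorm_phi_sq_mul_lintegral_le (hM : Model P P' X ε₁ ε₂ Y) (hφX : ∀ u, phi P X u ≠ 0)
    {C_X : ℝ} (hC : ∀ u v : ℝ, 0 ≤ v → v ≤ u → ‖phi P X u‖ ≤ C_X * ‖phi P X v‖) (u : ℝ) :
    ‖phi P X u‖ₑ ^ 2 * ∫⁻ z in Set.Icc 0 u, invSq (phi P (X + ε₂)) z ≤
      ENNReal.ofReal (C_X ^ 2) * ∫⁻ z in Set.Icc 0 u, (‖phi P ε₁ z‖ₑ ^ 2)⁻¹ := by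
  rw [← lintegral_const_mul' _ _ (by simp), ← lintegral_const_mul' _ _ (by simp)]
  refine setLIntegral_mono' measurableSet_Icc fun z hz => ?_
  have h := hC u z hz.1 hz.2
  have h0 : 0 < ‖phi P X z‖ := norm_pos_iff.2 (hφX z)
  have h2 : ‖phi P X u‖ₑ ^ 2 ≤ ENNReal.ofReal (C_X ^ 2) * ‖phi P X z‖ₑ ^ 2 := by
    rw [← ofReal_norm, ← ofReal_norm, ← ENNReal.ofReal_pow (norm_nonneg _),
      ← ENNReal.ofReal_pow (norm_nonneg _), ← ENNReal.ofReal_mul (sq_nonneg _), ← mul_pow]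
    exact ENNReal.ofReal_le_ofReal (pow_le_pow_left₀ (norm_nonneg _) h 2)
  have hz0 : ‖phi P X z‖ₑ ^ 2 ≠ 0 := pow_ne_zero _ (enorm_ne_zero.2 (hφX z))
  have hzt : ‖phi P X z‖ₑ ^ 2 ≠ ∞ := by simp
  rw [invSq, hM.phi_add, enorm_mul, mul_pow, ENNReal.mul_inv (.inl hz0) (.inl hzt)]
  calc _ ≤ ENNReal.ofReal (C_X ^ 2) * ‖phi P X z‖ₑ ^ 2 *
        ((‖phi P X z‖ₑ ^ 2)⁻¹ * (‖phi P ε₁ z‖ₑ ^ 2)⁻¹) := mul_le_mul' h2 le_rfl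
    _ = ENNReal.ofReal (C_X ^ 2) * (‖phi P X z‖ₑ ^ 2 * (‖phi P X z‖ₑ ^ 2)⁻¹) *
        (‖phi P ε₁ z‖ₑ ^ 2)⁻¹ := by ring
    _ = _ := by rw [ENNReal.mul_inv_cancel hz0 hzt, mul_one]

/-- The constant of the risk bound. -/
noncomputable def _root_.RepeatedMeasurements.riskConst (p : ℕ) : ℝ≥0∞ :=
  (48 + 4 * 9 ^ p) * (errorConst 1 + errorConst p)

theorem _root_.RepeatedMeasurements.riskConst_ne_top (p : ℕ) : riskConst p ≠ ∞ := by
  have h1 := errorConst_ne_top 1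
  have h2 := errorConst_ne_top p
  simp only [riskConst]
  finiteness

variable [IsProbabilityMeasure P']

theorem lintegral_phi_sub_phiHat_sq_le (hM : Model P P' X ε₁ ε₂ Y) (hX2 : MemLp X 2 P)
    (hε2 : MemLp ε₁ 2 P) (hε : ∫ ω, ε₁ ω ∂P = 0) (hφX : ∀ u, phi P X u ≠ 0)
    (hφε : ∀ u, phi P ε₁ u ≠ 0) (hn : 1 ≤ n) {p : ℕ} (hp : 1 ≤ p)
    {C_X : ℝ} (hC : ∀ u v : ℝ, 0 ≤ v → v ≤ u → ‖phi P X u‖ ≤ C_X * ‖phi P X v‖)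
    {b u : ℝ} (hu : |u| ≤ b) :
    ∫⁻ ω, ‖phi P X u - phiHat (fun j => Y j ω) u‖ₑ ^ 2 ∂P' ≤
      riskConst p * ENNReal.ofReal (C_X ^ 2) * G P X ε₁ ε₂ n 1 b / n *
        (∫⁻ z in Set.Icc 0 |u|, (‖phi P ε₁ z‖ₑ ^ 2)⁻¹) +
      riskConst p * G P X ε₁ ε₂ n p b *
        ((n : ℝ≥0∞)⁻¹ * ∫⁻ z in Set.Icc 0 |u|, (‖phi P (X + ε₂) z‖ₑ ^ 2)⁻¹) ^ p := by
  have hS := hM.isSample hX2 hε2 hε hφX hφε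
  have hpos : ∀ ω, ‖phi P X u - phiHat (fun j => Y j ω) u‖ₑ =
      ‖phi P X |u| - phiHat (fun j => Y j ω) |u|‖ₑ := by
    intro ω
    rcases abs_choice u with h | h
    · rw [h]
    · rw [h, phi_neg, phiHat_neg, ← map_sub, ← ofReal_norm, ← ofReal_norm, RCLike.norm_conj]
  have hw : phi P X |u| = Complex.exp (∫ v in (0 : ℝ)..|u|,
      (deriv (phi P X) v * phi P ε₁ v) / phi P (X + ε₂) v) := by
    simp_rw [hM.phi_add, mul_div_mul_right _ _ (hφε _)]
    exact phi_eq_exp_integral hM.measurable_X hX2 hφX _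
  simp_rw [hpos]
  refine (hS.lintegral_phiHat_sub_sq_le hn hp (abs_nonneg u) hw
    (norm_phi_le_one hM.measurable_X _)).trans ?_
  have hc : ∀ q, _ := fun q => hM.complexity_le (n := n) hX2 hε2 hε hφε q hu
  have h1 := hM.enorm_phi_sq_mul_lintegral_le hφX hC |u|
  have hI : (∫⁻ z in Set.Icc 0 |u|, (‖phi P (X + ε₂) z‖ₑ ^ 2)⁻¹) =
    ∫⁻ z in Set.Icc 0 |u|, invSq (phi P (X + ε₂)) z := rfl
  rw [hI]
  have hr1 : (48 + 4 * 9 ^ p) * errorConst 1 ≤ riskConst p := mul_le_mul' le_rfl le_self_add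
  have hrp : (48 + 4 * 9 ^ p) * errorConst p ≤ riskConst p := mul_le_mul' le_rfl le_add_self
  refine add_le_add ?_ ?_
  · calc _ = ((48 + 4 * 9 ^ p) * errorConst 1) * _ * (‖phi P X |u|‖ₑ ^ 2 *
          ∫⁻ z in Set.Icc 0 |u|, invSq (phi P (X + ε₂)) z) / n := by
          simp only [div_eq_mul_inv]; ring
      _ ≤ riskConst p * G P X ε₁ ε₂ n 1 b * (ENNReal.ofReal (C_X ^ 2) *
          ∫⁻ z in Set.Icc 0 |u|, (‖phi P ε₁ z‖ₑ ^ 2)⁻¹) / n :=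
          ENNReal.div_le_div_right (mul_le_mul' (mul_le_mul' hr1 (hc 1)) h1) _
      _ = _ := by simp only [div_eq_mul_inv]; ring
  · calc _ = ((48 + 4 * 9 ^ p) * errorConst p) * _ * ((n : ℝ≥0∞)⁻¹ *
          ∫⁻ z in Set.Icc 0 |u|, invSq (phi P (X + ε₂)) z) ^ p := by
          simp only [div_eq_mul_inv]; ring
      _ ≤ _ := mul_le_mul' (mul_le_mul' hrp (hc p)) le_rfl

/-- Monotonicity in `|u|` gives measurability without any condition on `g`. -/
theorem _root_.measurable_setLIntegral_Icc_abs (g : ℝ → ℝ≥0∞) :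
    Measurable fun u : ℝ => ∫⁻ z in Set.Icc 0 |u|, g z := by
  have h : Monotone fun t : ℝ => ∫⁻ z in Set.Icc 0 t, g z := fun s t hst =>
    lintegral_mono_set (Set.Icc_subset_Icc_right hst)
  exact h.measurable.comp measurable_norm

theorem lintegral_lintegral_phi_sub_phiHat_sq_le (hM : Model P P' X ε₁ ε₂ Y) (hX2 : MemLp X 2 P)
    (hε2 : MemLp ε₁ 2 P) (hε : ∫ ω, ε₁ ω ∂P = 0) (hφX : ∀ u, phi P X u ≠ 0)
    (hφε : ∀ u, phi P ε₁ u ≠ 0) (hn : 1 ≤ n) {p : ℕ} (hp : 1 ≤ p)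
    {C_X : ℝ} (hC : ∀ u v : ℝ, 0 ≤ v → v ≤ u → ‖phi P X u‖ ≤ C_X * ‖phi P X v‖) (b : ℝ) :
    ∫⁻ ω, (∫⁻ u in Set.Icc (-b) b, ‖phi P X u - phiHat (fun j => Y j ω) u‖ₑ ^ 2) ∂P' ≤
      riskConst p * ENNReal.ofReal (C_X ^ 2) * G P X ε₁ ε₂ n 1 b / n *
        (∫⁻ u in Set.Icc (-b) b, ∫⁻ z in Set.Icc 0 |u|, (‖phi P ε₁ z‖ₑ ^ 2)⁻¹) +
      riskConst p * G P X ε₁ ε₂ n p b *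
        (∫⁻ u in Set.Icc (-b) b,
          ((n : ℝ≥0∞)⁻¹ * ∫⁻ z in Set.Icc 0 |u|, (‖phi P (X + ε₂) z‖ₑ ^ 2)⁻¹) ^ p) := by
  have hm : Measurable fun z : Ω' × ℝ => ‖phi P X z.2 - phiHat (fun j => Y j z.1) z.2‖ₑ ^ 2 :=
    (((continuous_phi hM.measurable_X).measurable.comp measurable_snd).sub
      (measurable_phiHat hM.measurable_sample)).enorm.pow_const 2
  rw [lintegral_lintegral_swap hm.aemeasurable]
  have m1 := measurable_setLIntegral_Icc_abs fun z => (‖phi P ε₁ z‖ₑ ^ 2)⁻¹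
  have m2 := ((measurable_setLIntegral_Icc_abs fun z => (‖phi P (X + ε₂) z‖ₑ ^ 2)⁻¹).const_mul
    (n : ℝ≥0∞)⁻¹).pow_const p
  rw [← lintegral_const_mul _ m1, ← lintegral_const_mul _ m2,
    ← lintegral_add_left (m1.const_mul _)]
  exact setLIntegral_mono' measurableSet_Icc fun u hu =>
    hM.lintegral_phi_sub_phiHat_sq_le hX2 hε2 hε hφX hφε hn hp hC (abs_le.2 hu)

end RepeatedMeasurements.Model

/-! ### The risk bound -/

theorem theorem3p1 (p : ℕ) (hp : 1 ≤ p) :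
    ∃ C : ℝ, 0 < C ∧
      ∀ (Ω Ω' : Type*) [MeasurableSpace Ω] [MeasurableSpace Ω']
        (P : Measure Ω) [IsProbabilityMeasure P] (P' : Measure Ω') [IsProbabilityMeasure P']
        (X ε₁ ε₂ : Ω → ℝ) (n : ℕ) (_ : 1 ≤ n) (Y : Fin n → Ω' → ℝ × ℝ)
        (_ : Model P P' X ε₁ ε₂ Y)
        -- square integrable densities
        (f_X f_ε : ℝ → ℝ)
        (_ : IsDensity P X f_X) (_ : MemLp f_X 2 volume)
        (_ : IsDensity P ε₁ f_ε) (_ : MemLp f_ε 2 volume)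
        -- nowhere vanishing characteristic functions
        (_ : ∀ u, phi P X u ≠ 0)
        (_ : ∀ u, phi P ε₁ u ≠ 0)
        -- centred errors
        (_ : Integrable ε₁ P) (_ : ∫ ω, ε₁ ω ∂P = 0)
        -- quasi-monotonicity of the modulus of the characteristic function of the target
        (C_X : ℝ) (_ : 0 < C_X)
        (_ : ∀ u v : ℝ, 0 ≤ v → v ≤ u →
          ‖phi P X u‖ ≤ C_X * ‖phi P X v‖)
        -- moments and integrability
        (_ : Integrable (fun ω => |X ω + ε₁ ω| ^ (2 * p)) P)
        (_ : Integrable (fun u => deriv (deriv (phi P X)) u *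
          phi P ε₁ u) volume)
        -- kernel with bounded Fourier transform supported on `[-1, 1]`, and bandwidth
        (K : ℝ → ℝ) (_ : MemLp K 2 volume) (M : ℝ)
        (_ : ∀ᵐ u : ℝ, u ∉ Set.Icc (-1 : ℝ) 1 → kernelFourier K u = 0)
        (_ : ∀ᵐ u : ℝ, ‖kernelFourier K u‖ ≤ M)
        (h : ℝ) (_ : 0 < h),
        ∫⁻ ω, (eLpNorm (fun x => (f_X x : ℂ) - fHat K h (fun j => Y j ω) x) 2 volume) ^ 2 ∂P'
          ≤ 2 * (eLpNorm (fun x => f_X x -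
                convolution (scaledKernel K h) f_X (ContinuousLinearMap.mul ℝ ℝ) volume x)
                2 volume) ^ 2
            + ENNReal.ofReal (C * M ^ 2 * C_X ^ 2) * G P X ε₁ ε₂ n 1 (1 / h) / (n : ℝ≥0∞) *
                (∫⁻ u in Set.Icc (-(1 / h)) (1 / h),
                  (∫⁻ z in Set.Icc 0 |u|, (‖phi P ε₁ z‖ₑ ^ 2)⁻¹))
            + ENNReal.ofReal (C * M ^ 2) * G P X ε₁ ε₂ n p (1 / h) *
                (∫⁻ u in Set.Icc (-(1 / h)) (1 / h),
                  ((n : ℝ≥0∞)⁻¹ *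
                    (∫⁻ z in Set.Icc 0 |u|, (‖phi P (X + ε₂) z‖ₑ ^ 2)⁻¹)) ^ p) := by
  -- The added `1` makes positivity of the constant immediate.
  refine ⟨(riskConst p).toReal + 1, by positivity, ?_⟩
  intro Ω Ω' _ _ P _ P' _ X ε₁ ε₂ n hn Y hM f_X f_ε hfX _ _ _ hφX hφε hεi hε C_X _ hC hY _ K hK M
    hsupp hKM h hh
  obtain ⟨hX2, hε2⟩ := hM.memLp_two hp hY hεi
  have hr : riskConst p ≤ ENNReal.ofReal ((riskConst p).toReal + 1) := by
    rw [← ENNReal.ofReal_toReal (riskConst_ne_top p)]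
    exact ENNReal.ofReal_le_ofReal (by simp)
  have hM2 : ENNReal.ofReal (M ^ 2 / Real.pi) ≤ ENNReal.ofReal (M ^ 2) :=
    ENNReal.ofReal_le_ofReal (div_le_self (sq_nonneg M) (by linarith [Real.pi_gt_three]))
  have hpt : ∀ ω, (eLpNorm (fun x => (f_X x : ℂ) - fHat K h (fun j => Y j ω) x) 2 volume) ^ 2 ≤
      2 * (eLpNorm (fun x => f_X x -
        convolution (scaledKernel K h) f_X (ContinuousLinearMap.mul ℝ ℝ) volume x) 2 volume) ^ 2 +
      ENNReal.ofReal (M ^ 2 / Real.pi) * ∫⁻ u in Set.Icc (-(1 / h)) (1 / h),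
        ‖phi P X u - phiHat (fun j => Y j ω) u‖ₑ ^ 2 := fun ω =>
    eLpNorm_density_sub_kernelEstimate_sq_le hK.ofReal hh hM.measurable_X hfX hsupp hKM
      ((measurable_phiHat hM.measurable_sample).section_left ω) fun u => norm_phiHat_le_one _ u
  have hrisk := hM.lintegral_lintegral_phi_sub_phiHat_sq_le hX2 hε2 hε hφX hφε hn hp hC (1 / h)
  generalize (∫⁻ u in Set.Icc (-(1 / h)) (1 / h), ∫⁻ z in Set.Icc 0 |u|, (‖phi P ε₁ z‖ₑ ^ 2)⁻¹) =
    I₁ at hrisk ⊢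
  generalize (∫⁻ u in Set.Icc (-(1 / h)) (1 / h),
    ((n : ℝ≥0∞)⁻¹ * ∫⁻ z in Set.Icc 0 |u|, (‖phi P (X + ε₂) z‖ₑ ^ 2)⁻¹) ^ p) = I₂ at hrisk ⊢
  refine (lintegral_mono hpt).trans ?_
  rw [lintegral_add_left measurable_const, lintegral_const, measure_univ, mul_one,
    lintegral_const_mul' _ _ ENNReal.ofReal_ne_top, add_assoc]
  refine add_le_add le_rfl ((mul_le_mul' hM2 hrisk).trans ?_)
  rw [ENNReal.ofReal_mul (by positivity), ENNReal.ofReal_mul (by positivity), mul_add]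
  refine add_le_add ?_ ?_
  · calc _ = riskConst p * ENNReal.ofReal (M ^ 2) * ENNReal.ofReal (C_X ^ 2) *
          G P X ε₁ ε₂ n 1 (1 / h) / n * I₁ := by simp only [div_eq_mul_inv]; ring
      _ ≤ _ := by gcongr
  · calc _ = riskConst p * ENNReal.ofReal (M ^ 2) * G P X ε₁ ε₂ n p (1 / h) * I₂ := by ring
      _ ≤ _ := by gcongr
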